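/- **Notation.** Let $1\le q\le p$ be integers. For a point $x\in\mathbb R^n$ and $i$-linear forms $D_i$ ($1\le i\le p$) put $\Delta T_j^D(d)=-\sum_{i=1}^j \frac1{i!}D_i[d]^i$ and $\phi_j^{D,\delta}=\max_{\|d\|\le\delta}\Delta T_j^D(d)$, with the Euclidean norm on $\mathbb R^n$ and the operator norm on multilinear forms. For a function $g$ write $\Delta T_{g,j}(x,d)$ and $\phi_{g,j}^{\delta}(x)$ when $D_i=\nabla^i g(x)$, so that $\phi_{g,j}^{\delta}(x)=g(x)-\min_{\|d\|\le\delta}T_{g,j}(x,d)$, where $T_{g,j}(x,\cdot)$ is the Taylor polynomial of degree $j$. $\mathrm{CHECK}(\delta,\Delta,\{a_i\}_{i=1}^r,\xi)$ returns *relative* if $\Delta>0$ and $\sum_{i=1}^r a_i\delta^i/i!\le\omega\Delta$; otherwise *absolute* if $\sum_{i=1}^r a_i\delta^i/i!\le\omega\xi\delta^r/r!$; otherwise *insufficient*. **Algorithm AR$qp$EDA2.** The constants satisfy $\zeta_{\max}\ge0$, $\varsigma\in(0,1]$, $\theta>0$ with $\theta(1+\omega\varsigma)<2\varsigma$, $0<\eta_1\le\eta_2<1$,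 $0<\gamma_1<1<\gamma_2<\gamma_3$, $\gamma_\zeta\in(0,1)$, $0<\sigma_{\min}\le\sigma_0$ and $0<\omega<\min[\frac12\eta_1,\frac14(1-\eta_2)]$. Also given are $x_0\in\mathbb R^n$, tolerances $\epsilon\in(0,1]^q$, radii $\delta_0$ with $\epsilon_j\le\delta_{0,j}\le1$ ($1\le j\le q$), and derivative error bounds $0\le\zeta_i\le\zeta_{\max}$ ($1\le i\le p$). Iteration $k$ starts with $x_k,\sigma_k$, the current bounds $\zeta_i$ and radii $\delta_k=\delta_k^{(0)}$. *Step 1.* Unless still available at $x_k$ for the current bounds, evaluate approximate derivatives $D_i$ with $\|D_i-\nabla^if(x_k)\|\le\zeta_i$ ($1\le i\le p$). Let $\overline m_k(s)=\sum_{i=1}^p\frac1{i!}D_i[s]^i+\frac{\sigma_k}{(p+1)!}\|s\|^{p+1}$ and $\Delta\overline m_k(s)=\overline m_k(0)-\overline m_k(s)$. For $j=1,\dots,q$: (1.1) compute $d$ with $\|d\|\le\delta_{k,j}$ and $\varsigma\,\phi_j^{D,\delta_{k,j}}\le\Delta T^D_j(d)$; if $\mathrm{CHECK}(\delta_{k,j},\Delta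 T_j^D(d),\{\zeta_i\}_{i=1}^j,\frac12\varsigma\epsilon_j)$ is insufficient, go to Step 5. (1.2) If $\Delta T_j^D(d)\le\frac{\varsigma\epsilon_j}{1+\omega}\frac{\delta_{k,j}^j}{j!}$, take the next $j$. (1.3) Otherwise, if $\Delta\overline m_k(d)\ge\frac{\varsigma\epsilon_j}{2(1+\omega)}\frac{\delta_{k,j}^j}{j!}$, go to Step 2 with $j_k=j$, $d_k=d$ and $\delta_k^{(1)}=\delta_k$. (1.4) Otherwise halve $\delta_{k,j}$ and return to (1.1). If all $j$ have been passed, terminate with $x_\epsilon=x_k$, $\delta_\epsilon=\delta_k$. *Step 2.* (2.1) Compute $s_k$ and $\delta_{s_k}\in(0,1]^q$ with $\Delta\overline m_k(s_k)\ge\Delta\overline m_k(d_k)$ and either $\|s_k\|\ge1$ or, for all $1\le\ell\le q$ and some $d_\ell$ with $\|d_\ell\|\le\delta_{s_k,\ell}$, $\varsigma\,\phi_{\overline m_k,\ell}^{\delta_{s_k,\ell}}(s_k)\le\Delta T_{\overline m_k,\ell}(s_k,d_\ell)\le\frac{\varsigma\theta(1-\omega)}{2(1+\omega)}\epsilon_\ell\frac{\delta_{s_k,\ell}^\ell}{\ell!}$.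 (2.2) With $\delta=\delta^{(1)}_{k,j_k}$, go to Step 5 if $\mathrm{CHECK}\big(\|s_k\|,\Delta T^D_p(s_k),\{\zeta_i\}_{i=1}^p,\frac{\varsigma\epsilon_{j_k}}{2(1+\omega)}\frac{p!\,\delta^{j_k}}{j_k!\max[\delta,\|s_k\|]^p}\big)$ is insufficient, or if $\|s_k\|<1$ and, for some $1\le\ell\le q$, $\mathrm{CHECK}\big(\delta_{s_k,\ell},\Delta T_{\overline m_k,\ell}(s_k,d_\ell),\{3\max_{i\le t\le p}\zeta_t\}_{i=1}^\ell,\frac{\varsigma\theta(1-\omega)\epsilon_\ell}{2(1+\omega)^2}\big)$ is insufficient. *Step 3.* Compute $\overline f(x_k+s_k)$, and reuse a known value $\overline f(x_k)$ or compute a new one, so that both have absolute error at most $\omega\Delta T^D_p(s_k)$. Let $\rho_k=(\overline f(x_k)-\overline f(x_k+s_k))/\Delta T_p^D(s_k)$. If $\rho_k\ge\eta_1$, set $x_{k+1}=x_k+s_k$, and $\delta_{k+1}=\delta_{s_k}$ if $\|s_k\|<1$, $\delta_{k+1}=\delta_k^{(1)}$ otherwise; if $\rho_k<\eta_1$, set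 $x_{k+1}=x_k$, $\delta_{k+1}=\delta_k^{(1)}$. *Step 4.* Choose $\sigma_{k+1}$ in $[\max(\sigma_{\min},\gamma_1\sigma_k),\sigma_k]$ if $\rho_k\ge\eta_2$, in $[\sigma_k,\gamma_2\sigma_k]$ if $\eta_1\le\rho_k<\eta_2$, in $[\gamma_2\sigma_k,\gamma_3\sigma_k]$ if $\rho_k<\eta_1$; start iteration $k+1$. *Step 5.* Replace every $\zeta_i$ by $\gamma_\zeta\zeta_i$ and start iteration $k+1$ with $x_{k+1}=x_k$, $\delta_{k+1}=\delta_k^{(0)}$, $\sigma_{k+1}=\sigma_k$. **Theorem.** Let $L_0,\dots,L_p\ge1$. Assume that $f:\mathbb R^n\to\mathbb R$ is $p$ times continuously differentiable, that $\nabla^jf$ is globally Lipschitz with constant $L_j$ for $0\le j\le p$, and that $f\ge f_{\rm low}$. Assume that whenever $\|s_k\|<1$ the radii of Step 2.1 are chosen so that $\delta_{s_k,j}=1$ for $1\le j\le\min(2,q)$ and $\delta_{s_k,j}\ge\min[\kappa_\delta(\sigma_k)\epsilon_j,\delta_{k,j}^{(0)}]$ for $3\le j\le q$, where $\kappa_\delta(\sigma)=\frac{\varsigma\theta(1-\omega)}{8(1+\omega)(3\overline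 L_f+\sigma)}$ and $\overline L_f=\max_{0\le j\le p}L_j+\zeta_{\max}$. Put $\pi_j=\frac{p+1}{p-j+1}$ if $q\in\{1,2\}$ and $\pi_j=\frac{j(p+1)}p$ if $q>2$. Then there are positive constants $\kappa_s,\kappa_a,\kappa_c,\kappa_e,\kappa_f$, depending only on $p,q$, the constants of the algorithm and $L_0,\dots,L_p$ (and not on $n$, $f$, $x_0$, $f_{\rm low}$, $\epsilon$, $\delta_0$ or the initial error bounds), such that, whatever choices the algorithm makes within these rules, it can always be continued until it terminates, it terminates after finitely many elementary operations, and it uses at most $$\kappa_a\frac{f(x_0)-f_{\rm low}}{\min_{1\le j\le q}\epsilon_j^{\pi_j}}+\kappa_c=O\Big(\max_{1\le j\le q}\epsilon_j^{-\pi_j}\Big)$$ evaluations of $f$ and at most $$\kappa_s\frac{f(x_0)-f_{\rm low}}{\min_{1\le j\le q}\epsilon_j^{\pi_j}}+\kappa_e\Big|\log\min_{1\le j\le q}\epsilon_j\Big|+\kappa_f=O\Big(\max_{1\le j\le q}\epsilon_j^{-\pi_j}\Big)$$ evaluations of the derivatives of $f$ of orders $1$ to $p$ (one such evaluation gives all these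 orders at one point), where the $O(\cdot)$ is for fixed $f(x_0)-f_{\rm low}$ and all $\epsilon\in(0,1]^q$. The final $x_\epsilon$ satisfies $\phi_{f,j}^{1}(x_\epsilon)\le\epsilon_j/j!$ for $1\le j\le q$ if $q\in\{1,2\}$, and, if $q>2$, $\delta_\epsilon\in(0,1]^q$ and $\phi_{f,j}^{\delta_{\epsilon,j}}(x_\epsilon)\le\epsilon_j\,\delta_{\epsilon,j}^j/j!$ for $1\le j\le q$. -/

import Mathlib

open scoped Nat

noncomputable section

namespace ARqpEDA2

/-- The space `ℝⁿ` with its Euclidean norm. -/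
abbrev Vec (n : ℕ) : Type := EuclideanSpace ℝ (Fin n)

/-- A family of (exact or approximate) derivative tensors at a point: the `i`-th member is an
`i`-linear form on `ℝⁿ`, with the operator norm. -/
abbrev Tensors (n : ℕ) : Type := FormalMultilinearSeries ℝ (Vec n) ℝ

/-! ### Taylor decrements, optimality measures, regularized model -/

/-- The Taylor decrement of degree `j` in direction `d` built from the tensors `D`:
`T_j(0) - T_j(d) = - ∑_{i=1}^j D_i[d]^i / i!`. -/
def taylorDec {n : ℕ} (D : Tensors n) (j : ℕ) (d : Vec n) : ℝ :=
  -∑ i ∈ Finset.Icc 1 j, D i (fun _ => d) / (i ! : ℝ)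

/-- The exact derivative tensors of `g` at `x`. -/
def exactTensors {n : ℕ} (g : Vec n → ℝ) (x : Vec n) : Tensors n :=
  fun i => iteratedFDeriv ℝ i g x

/-- `max_{‖d‖ ≤ δ} (T_j(0) - T_j(d))`, for the Taylor expansion built from `D`. -/
def optMeasure {n : ℕ} (D : Tensors n) (j : ℕ) (δ : ℝ) : ℝ :=
  sSup (taylorDec D j '' Metric.closedBall (0 : Vec n) δ)

/-- The optimality measure `φ_{g,j}^δ(x) = g(x) - min_{‖d‖ ≤ δ} T_{g,j}(x,d)`. -/
def phi {n : ℕ} (g : Vec n → ℝ) (j : ℕ) (δ : ℝ) (x : Vec n) : ℝ :=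
  optMeasure (exactTensors g x) j δ

/-- The regularized Taylor model of degree `p` built from `D`, without its constant term (which
affects neither its decrements nor its derivatives). -/
def model {n : ℕ} (p : ℕ) (D : Tensors n) (σ : ℝ) (s : Vec n) : ℝ :=
  ∑ i ∈ Finset.Icc 1 p, D i (fun _ => s) / (i ! : ℝ) + σ / ((p + 1)! : ℝ) * ‖s‖ ^ (p + 1)

/-- The model decrease `m(0) - m(s)`. -/
def modelDec {n : ℕ} (p : ℕ) (D : Tensors n) (σ : ℝ) (s : Vec n) : ℝ :=
  model p D σ 0 - model p D σ s

/-! ### The accuracy check -/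

/-- The possible answers of the accuracy check. -/
inductive Accuracy
  | relative
  | absolute
  | insufficient

/-- The accuracy check for a Taylor decrement `dT` of degree `r`, a radius `δ`, absolute error
bounds `acc 1, …, acc r` on the derivatives, and an absolute threshold `ξ`. -/
def check (ω δ dT : ℝ) (acc : ℕ → ℝ) (r : ℕ) (ξ : ℝ) : Accuracy :=
  if 0 < dT ∧ ∑ i ∈ Finset.Icc 1 r, acc i * δ ^ i / (i ! : ℝ) ≤ ω * dT then
    Accuracy.relative
  else if ∑ i ∈ Finset.Icc 1 r, acc i * δ ^ i / (i ! : ℝ) ≤ ω * ξ * (δ ^ r / (r ! : ℝ)) then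
    Accuracy.absolute
  else Accuracy.insufficient

/-! ### The algorithm -/

/-- The constants of the algorithm. -/
structure Params where
  ω : ℝ
  accMax : ℝ
  ς : ℝ
  θ : ℝ
  η₁ : ℝ
  η₂ : ℝ
  γ₁ : ℝ
  γ₂ : ℝ
  γ₃ : ℝ
  γacc : ℝ
  σmin : ℝ
  σ₀ : ℝ

/-- The conditions on the constants of the algorithm. -/
structure Params.Valid (P : Params) : Prop where
  accMax_nonneg : 0 ≤ P.accMax
  ς_pos : 0 < P.ς
  ς_le : P.ς ≤ 1
  θ_pos : 0 < P.θ
  θ_lt : P.θ * (1 + P.ω * P.ς) < 2 * P.ς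
  η₁_pos : 0 < P.η₁
  η₁_le : P.η₁ ≤ P.η₂
  η₂_lt : P.η₂ < 1
  γ₁_pos : 0 < P.γ₁
  γ₁_lt : P.γ₁ < 1
  γ₂_gt : 1 < P.γ₂
  γ₃_gt : P.γ₂ < P.γ₃
  γacc_pos : 0 < P.γacc
  γacc_lt : P.γacc < 1
  ω_pos : 0 < P.ω
  ω_lt : P.ω < min (P.η₁ / 2) ((1 - P.η₂) / 4)
  σmin_pos : 0 < P.σmin
  σmin_le : P.σmin ≤ P.σ₀

/-- The input of the algorithm: degree `p`, order `q`, constants, objective function, starting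
point, tolerances `ε_1, …, ε_q`, initial radii `δ_{0,1}, …, δ_{0,q}`, initial derivative error
bounds for the orders `1, …, p`; and the Lipschitz constants `L_0, …, L_p` of the derivatives of
the objective, which are used by no step of the algorithm, only by `RadiiRule` below. -/
structure Input (n : ℕ) where
  p : ℕ
  q : ℕ
  P : Params
  f : Vec n → ℝ
  x₀ : Vec n
  ε : ℕ → ℝ
  δ₀ : ℕ → ℝ
  acc₀ : ℕ → ℝ
  L : ℕ → ℝ

/-- The point of the algorithm that is to be executed next. The field `δ0` records the radii
`δ_k^{(0)}` with which the current iteration started. -/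
inductive Phase (n : ℕ)
  /-- Beginning of Step 1: get the approximate derivatives. -/
  | start
  /-- Steps 1.1-1.4 for the order `j`. -/
  | test (δ0 : ℕ → ℝ) (j : ℕ)
  /-- Step 2.1, entered with `j_k = j` and `d_k = d`. -/
  | solve (δ0 : ℕ → ℝ) (j : ℕ) (d : Vec n)
  /-- Step 2.2, for the step `s`, the radii `δs` and the displacements `dm` of Step 2.1. -/
  | verify (δ0 : ℕ → ℝ) (j : ℕ) (s : Vec n) (δs : ℕ → ℝ) (dm : ℕ → Vec n)
  /-- Steps 3 and 4. -/
  | accept (s : Vec n) (δs : ℕ → ℝ)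
  /-- The algorithm has terminated with the current `x` and `δ`. -/
  | finished

/-- A configuration of the algorithm. -/
structure Config (n : ℕ) where
  phase : Phase n
  /-- the current iterate `x_k` -/
  x : Vec n
  /-- the current regularization parameter `σ_k` -/
  σ : ℝ
  /-- the current radii `δ_{k,1}, …, δ_{k,q}` -/
  δ : ℕ → ℝ
  /-- the current derivative error bounds, for the orders `1, …, p` -/
  acc : ℕ → ℝ
  /-- the last computed approximate derivatives -/
  D : Tensors n
  /-- whether `D` was computed at the current `x` under the current bounds `acc` -/
  avail : Bool
  /-- the last computed approximate value of `f` at the current `x`, if there is one -/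
  fval : Option ℝ
  /-- number of evaluations of `f` so far -/
  nf : ℕ
  /-- number of evaluations of the derivatives of `f` (of orders `1` to `p`) so far -/
  nd : ℕ

/-- Step 0. -/
def Input.init {n : ℕ} (I : Input n) : Config n where
  phase := .start
  x := I.x₀
  σ := I.P.σ₀
  δ := I.δ₀
  acc := I.acc₀
  D := 0
  avail := false
  fval := none
  nf := 0
  nd := 0

/-- Step 5: tighten the derivative error bounds, and start a new iteration from the same point with
the radii `δ0` with which the present iteration started. -/
def Config.improve {n : ℕ} (c : Config n) (γ : ℝ) (δ0 : ℕ → ℝ) : Config n :=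
  { c with phase := .start, δ := δ0, acc := fun i => γ * c.acc i, avail := false }

/-- `d` is an admissible displacement in Step 1.1 for the order `j`. -/
def Input.Displacement {n : ℕ} (I : Input n) (c : Config n) (j : ℕ) (d : Vec n) : Prop :=
  ‖d‖ ≤ c.δ j ∧ I.P.ς * optMeasure c.D j (c.δ j) ≤ taylorDec c.D j d

/-- The outcome of the accuracy check in Step 1.1. -/
def Input.check1 {n : ℕ} (I : Input n) (c : Config n) (j : ℕ) (d : Vec n) : Accuracy :=
  check I.P.ω (c.δ j) (taylorDec c.D j d) c.acc j (I.P.ς * I.ε j / 2)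

/-- The test of Step 1.2: the Taylor decrement is small. -/
def Input.Small {n : ℕ} (I : Input n) (c : Config n) (j : ℕ) (d : Vec n) : Prop :=
  taylorDec c.D j d ≤ I.P.ς * I.ε j / (1 + I.P.ω) * (c.δ j ^ j / (j ! : ℝ))

/-- The test of Step 1.3: the model decrease is large. -/
def Input.Big {n : ℕ} (I : Input n) (c : Config n) (j : ℕ) (d : Vec n) : Prop :=
  I.P.ς * I.ε j / (2 * (1 + I.P.ω)) * (c.δ j ^ j / (j ! : ℝ)) ≤ modelDec I.p c.D c.σ d

/-- The Taylor decrement of degree `ℓ`, at `s` and in direction `d`, of the current model. -/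
def Input.modelTaylorDec {n : ℕ} (I : Input n) (c : Config n) (ℓ : ℕ) (s d : Vec n) : ℝ :=
  taylorDec (exactTensors (model I.p c.D c.σ) s) ℓ d

/-- The requirements of Step 2.1 on the step `s`, the radii `δs` and the displacements `dm`. -/
structure Input.StepOK {n : ℕ} (I : Input n) (c : Config n) (d s : Vec n) (δs : ℕ → ℝ)
    (dm : ℕ → Vec n) : Prop where
  descent : modelDec I.p c.D c.σ d ≤ modelDec I.p c.D c.σ s
  radii : ∀ ℓ ∈ Finset.Icc 1 I.q, 0 < δs ℓ ∧ δs ℓ ≤ 1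
  optimal : 1 ≤ ‖s‖ ∨ ∀ ℓ ∈ Finset.Icc 1 I.q,
    ‖dm ℓ‖ ≤ δs ℓ ∧
    I.P.ς * phi (model I.p c.D c.σ) ℓ (δs ℓ) s ≤ I.modelTaylorDec c ℓ s (dm ℓ) ∧
    I.modelTaylorDec c ℓ s (dm ℓ) ≤
      I.P.ς * I.P.θ * (1 - I.P.ω) / (2 * (1 + I.P.ω)) * I.ε ℓ * (δs ℓ ^ ℓ / (ℓ ! : ℝ))

/-- The outcome of the first accuracy check in Step 2.2 (with `j = j_k`). -/
def Input.check2 {n : ℕ} (I : Input n) (c : Config n) (j : ℕ) (s : Vec n) : Accuracy :=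
  check I.P.ω ‖s‖ (taylorDec c.D I.p s) c.acc I.p
    (I.P.ς * I.ε j / (2 * (1 + I.P.ω)) *
      ((I.p ! : ℝ) * c.δ j ^ j / ((j ! : ℝ) * max (c.δ j) ‖s‖ ^ I.p)))

/-- The outcome of the `ℓ`-th accuracy check of the second kind in Step 2.2. When `‖s‖ ≤ 1`, the
error on the `i`-th derivative of the model at `s` is at most `3 max_{i ≤ t ≤ p} acc_t`. -/
def Input.check3 {n : ℕ} (I : Input n) (c : Config n) (s : Vec n) (δs : ℕ → ℝ)
    (dm : ℕ → Vec n) (ℓ : ℕ) : Accuracy :=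
  check I.P.ω (δs ℓ) (I.modelTaylorDec c ℓ s (dm ℓ))
    (fun i => 3 * sSup (c.acc '' Set.Icc i I.p)) ℓ
    (I.P.ς * I.P.θ * (1 - I.P.ω) * I.ε ℓ / (2 * (1 + I.P.ω) ^ 2))

/-- Some accuracy check of Step 2.2 fails. -/
def Input.Insufficient2 {n : ℕ} (I : Input n) (c : Config n) (j : ℕ) (s : Vec n) (δs : ℕ → ℝ)
    (dm : ℕ → Vec n) : Prop :=
  I.check2 c j s = .insufficient ∨
    (‖s‖ < 1 ∧ ∃ ℓ ∈ Finset.Icc 1 I.q, I.check3 c s δs dm ℓ = .insufficient)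

/-- The ratio `ρ_k` of Step 3, for the approximate function values `fx` at `x_k` and `fs` at
`x_k + s`. -/
def Input.rho {n : ℕ} (I : Input n) (c : Config n) (s : Vec n) (fx fs : ℝ) : ℝ :=
  (fx - fs) / taylorDec c.D I.p s

/-- In Step 3, `fs` and `fx` are approximate values of `f` at `x_k + s` and `x_k` of the required
accuracy, and `m` evaluations of `f` were made to get them: `m = 2`, or `m = 1` if `fx` is the
value already known. -/
structure Input.Values {n : ℕ} (I : Input n) (c : Config n) (s : Vec n) (fx fs : ℝ)
    (m : ℕ) : Prop where
  acc_s : |fs - I.f (c.x + s)| ≤ I.P.ω * taylorDec c.D I.p s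
  acc_x : |fx - I.f c.x| ≤ I.P.ω * taylorDec c.D I.p s
  count : m = 2 ∨ (m = 1 ∧ c.fval = some fx)

/-- The update rule of Step 4 for the regularization parameter. -/
def Params.SigmaUpdate (P : Params) (ρ σ σ' : ℝ) : Prop :=
  (P.η₂ ≤ ρ → max P.σmin (P.γ₁ * σ) ≤ σ' ∧ σ' ≤ σ) ∧
  (P.η₁ ≤ ρ → ρ < P.η₂ → σ ≤ σ' ∧ σ' ≤ P.γ₂ * σ) ∧
  (ρ < P.η₁ → P.γ₂ * σ ≤ σ' ∧ σ' ≤ P.γ₃ * σ)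

/-- `I.Step c c'`: the algorithm may pass from `c` to `c'` in one elementary step. Everything that
the algorithm leaves open (approximate values and derivatives, displacements, steps, radii,
regularization parameters) is open here. -/
inductive Input.Step {n : ℕ} (I : Input n) : Config n → Config n → Prop
  /-- Step 1, the derivatives are not available: evaluate them to the required accuracy. -/
  | evaluate (c : Config n) (D : Tensors n) (hc : c.phase = .start) (ha : c.avail = false)
      (hD : ∀ i ∈ Finset.Icc 1 I.p, ‖D i - iteratedFDeriv ℝ i I.f c.x‖ ≤ c.acc i) :
      I.Step c { c with phase := .test c.δ 1, D := D, avail := true, nd := c.nd + 1 }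
  /-- Step 1, the derivatives are available. -/
  | reuse (c : Config n) (hc : c.phase = .start) (ha : c.avail = true) :
      I.Step c { c with phase := .test c.δ 1 }
  /-- Step 1.1, the check fails: go to Step 5. -/
  | testImprove (c : Config n) (δ0 : ℕ → ℝ) (j : ℕ) (d : Vec n) (hc : c.phase = .test δ0 j)
      (hd : I.Displacement c j d) (h1 : I.check1 c j d = .insufficient) :
      I.Step c (c.improve I.P.γacc δ0)
  /-- Step 1.2, go to the next order. -/
  | testNext (c : Config n) (δ0 : ℕ → ℝ) (j : ℕ) (d : Vec n) (hc : c.phase = .test δ0 j)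
      (hd : I.Displacement c j d) (h1 : I.check1 c j d ≠ .insufficient)
      (h2 : I.Small c j d) (hj : j < I.q) :
      I.Step c { c with phase := .test δ0 (j + 1) }
  /-- Step 1.2, there is no next order: terminate. -/
  | testStop (c : Config n) (δ0 : ℕ → ℝ) (j : ℕ) (d : Vec n) (hc : c.phase = .test δ0 j)
      (hd : I.Displacement c j d) (h1 : I.check1 c j d ≠ .insufficient)
      (h2 : I.Small c j d) (hj : j = I.q) :
      I.Step c { c with phase := .finished }
  /-- Step 1.3, go to Step 2. -/
  | testSolve (c : Config n) (δ0 : ℕ → ℝ) (j : ℕ) (d : Vec n) (hc : c.phase = .test δ0 j)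
      (hd : I.Displacement c j d) (h1 : I.check1 c j d ≠ .insufficient)
      (h2 : ¬ I.Small c j d) (h3 : I.Big c j d) :
      I.Step c { c with phase := .solve δ0 j d }
  /-- Step 1.4, halve the `j`-th radius and return to Step 1.1. -/
  | testHalve (c : Config n) (δ0 : ℕ → ℝ) (j : ℕ) (d : Vec n) (hc : c.phase = .test δ0 j)
      (hd : I.Displacement c j d) (h1 : I.check1 c j d ≠ .insufficient)
      (h2 : ¬ I.Small c j d) (h3 : ¬ I.Big c j d) :
      I.Step c { c with δ := Function.update c.δ j (c.δ j / 2) }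
  /-- Step 2.1. -/
  | solve (c : Config n) (δ0 : ℕ → ℝ) (j : ℕ) (d s : Vec n) (δs : ℕ → ℝ) (dm : ℕ → Vec n)
      (hc : c.phase = .solve δ0 j d) (hs : I.StepOK c d s δs dm) :
      I.Step c { c with phase := .verify δ0 j s δs dm }
  /-- Step 2.2, some check fails: go to Step 5. -/
  | verifyImprove (c : Config n) (δ0 : ℕ → ℝ) (j : ℕ) (s : Vec n) (δs : ℕ → ℝ)
      (dm : ℕ → Vec n) (hc : c.phase = .verify δ0 j s δs dm)
      (h : I.Insufficient2 c j s δs dm) :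
      I.Step c (c.improve I.P.γacc δ0)
  /-- Step 2.2, all checks succeed. -/
  | verifyAccept (c : Config n) (δ0 : ℕ → ℝ) (j : ℕ) (s : Vec n) (δs : ℕ → ℝ)
      (dm : ℕ → Vec n) (hc : c.phase = .verify δ0 j s δs dm)
      (h : ¬ I.Insufficient2 c j s δs dm) :
      I.Step c { c with phase := .accept s δs }
  /-- Steps 3 and 4, successful iteration. -/
  | success (c : Config n) (s : Vec n) (δs : ℕ → ℝ) (fx fs σ' : ℝ) (m : ℕ)
      (hc : c.phase = .accept s δs) (hv : I.Values c s fx fs m)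
      (hρ : I.P.η₁ ≤ I.rho c s fx fs) (hσ : I.P.SigmaUpdate (I.rho c s fx fs) c.σ σ') :
      I.Step c { c with
        phase := .start, x := c.x + s, σ := σ', δ := if ‖s‖ < 1 then δs else c.δ,
        avail := false, fval := some fs, nf := c.nf + m }
  /-- Steps 3 and 4, unsuccessful iteration. -/
  | failure (c : Config n) (s : Vec n) (δs : ℕ → ℝ) (fx fs σ' : ℝ) (m : ℕ)
      (hc : c.phase = .accept s δs) (hv : I.Values c s fx fs m)
      (hρ : I.rho c s fx fs < I.P.η₁) (hσ : I.P.SigmaUpdate (I.rho c s fx fs) c.σ σ') :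
      I.Step c { c with
        phase := .start, σ := σ', fval := some fx, nf := c.nf + m }

/-! ### The choice of the radii -/

/-- `L̄_f = max_{0 ≤ j ≤ p} L_j + acc_max`. -/
def Input.Lbar {n : ℕ} (I : Input n) : ℝ := sSup (I.L '' Set.Icc 0 I.p) + I.P.accMax

/-- `κ_δ(σ)`. -/
def Input.kappaDelta {n : ℕ} (I : Input n) (σ : ℝ) : ℝ :=
  I.P.ς * I.P.θ * (1 - I.P.ω) / (8 * (1 + I.P.ω) * (3 * I.Lbar + σ))

/-- The rule for the radii `δ_{s_k}` chosen in Step 2.1 when `‖s_k‖ < 1` (they become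
`δ_{k+1}^{(0)}` if the iteration is successful): `δ_{s_k,j} = 1` for `j ≤ min(2,q)`, and
`δ_{s_k,j} ≥ min(κ_δ(σ_k) ε_j, δ_{k,j}^{(0)})` for `3 ≤ j ≤ q`. -/
def Input.RadiiRule {n : ℕ} (I : Input n) (c : Config n) : Prop :=
  ∀ (δ0 : ℕ → ℝ) (j : ℕ) (s : Vec n) (δs : ℕ → ℝ) (dm : ℕ → Vec n),
    c.phase = .verify δ0 j s δs dm → ‖s‖ < 1 →
      (∀ ℓ ∈ Finset.Icc 1 (min 2 I.q), δs ℓ = 1) ∧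
      (∀ ℓ ∈ Finset.Icc 3 I.q, min (I.kappaDelta c.σ * I.ε ℓ) (δ0 ℓ) ≤ δs ℓ)

/-- An elementary step of the algorithm, with the radii chosen according to `RadiiRule`. -/
def Input.RuleStep {n : ℕ} (I : Input n) (c c' : Config n) : Prop :=
  I.Step c c' ∧ I.RadiiRule c'

/-! ### Assumptions and conclusions -/

/-- The assumptions on the objective function and on the input: the derivatives of `f` of orders
`0, …, p` exist, are continuous, and are globally Lipschitz continuous with constants
`L_0, …, L_p`; `f` is bounded below by `flow`; and the tolerances, initial radii and initial error
bounds are in their ranges. -/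
structure Input.Assumptions {n : ℕ} (I : Input n) (flow : ℝ) : Prop where
  smooth : ContDiff ℝ I.p I.f
  lipschitz : ∀ j ≤ I.p, ∀ x y : Vec n,
    ‖iteratedFDeriv ℝ j I.f x - iteratedFDeriv ℝ j I.f y‖ ≤ I.L j * ‖x - y‖
  bounded_below : ∀ x, flow ≤ I.f x
  eps : ∀ j ∈ Finset.Icc 1 I.q, 0 < I.ε j ∧ I.ε j ≤ 1
  radii : ∀ j ∈ Finset.Icc 1 I.q, I.ε j ≤ I.δ₀ j ∧ I.δ₀ j ≤ 1
  acc : ∀ i ∈ Finset.Icc 1 I.p, 0 ≤ I.acc₀ i ∧ I.acc₀ i ≤ I.P.accMax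

/-- `min_{1 ≤ j ≤ q} ε_j ^ π_j`. -/
def minPow (q : ℕ) (ε π : ℕ → ℝ) : ℝ := sInf ((fun j => ε j ^ π j) '' Set.Icc 1 q)

/-- `max_{1 ≤ j ≤ q} ε_j ^ (-π_j)`. -/
def maxPow (q : ℕ) (ε π : ℕ → ℝ) : ℝ := sSup ((fun j => ε j ^ (-π j)) '' Set.Icc 1 q)

/-- `κa (f(x₀) - f_low) / min_j ε_j ^ π_j + κc`, with `gap = f(x₀) - f_low`. -/
def boundF (q : ℕ) (π : ℕ → ℝ) (κa κc gap : ℝ) (ε : ℕ → ℝ) : ℝ :=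
  κa * (gap / minPow q ε π) + κc

/-- `κs (f(x₀) - f_low) / min_j ε_j ^ π_j + κe |log (min_j ε_j)| + κf`. -/
def boundD (q : ℕ) (π : ℕ → ℝ) (κs κe κf gap : ℝ) (ε : ℕ → ℝ) : ℝ :=
  κs * (gap / minPow q ε π) + κe * |Real.log (sInf (ε '' Set.Icc 1 q))| + κf

/-- Whatever is chosen where the algorithm leaves a choice (subject to `RadiiRule`), the algorithm
never makes more than `Nf` evaluations of `f` and `Nd` evaluations of its derivatives, it can always
be continued until it terminates, it cannot be continued forever, and on termination the
configuration satisfies `Final`. -/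
structure Input.ProducesWithin {n : ℕ} (I : Input n) (Nf Nd : ℝ) (Final : Config n → Prop) :
    Prop where
  count_f : ∀ c, Relation.ReflTransGen I.RuleStep I.init c → (c.nf : ℝ) ≤ Nf
  count_d : ∀ c, Relation.ReflTransGen I.RuleStep I.init c → (c.nd : ℝ) ≤ Nd
  progress : ∀ c, Relation.ReflTransGen I.RuleStep I.init c → c.phase ≠ .finished →
    ∃ c', I.RuleStep c c'
  finite : ¬ ∃ run : ℕ → Config n, run 0 = I.init ∧ ∀ t, I.RuleStep (run t) (run (t + 1))
  final : ∀ c, Relation.ReflTransGen I.RuleStep I.init c → c.phase = .finished → Final c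

end ARqpEDA2

end

/-!
The proof follows an execution of the algorithm and charges its evaluations to four kinds of events.

*Successful iterations.* A step decreases the model by more than its regularization term, so a
successful step `s` decreases `f` by a multiple of `‖s‖ ^ (p + 1)`
(`Input.Good.norm_step_le_decrease`). If `‖s‖ < 1`, then `s` is approximately optimal for the model.
If the new point is not approximately optimal for `f`, the derivatives of `f` and of the model must
differ appreciably there (`Input.Good.gap_le_model_error`). As they differ by `O(‖s‖ ^ (p + 1 - i))`
at order `i`, this bounds `‖s‖ ^ (p + 1)` from below by a multiple of `min_j ε_j ^ π_j`
(`rpow_le_of_sum`, `Input.Good.stepConst_mul_minPow_le`). Long steps need no argument. So every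
successful iteration, except possibly one after which the algorithm stops, decreases `f` by at least
a fixed amount, and `f` is bounded below. The exponents `π_j` come from two regimes: for radii above
`‖s‖` the derivative of the highest order dominates the error, for smaller radii the gradient does;
radii equal to one exclude the second regime.

*Unsuccessful iterations.* The ratio of achieved to predicted decrease tends to one as `σ` grows
(`Input.Good.le_rho`), so `σ` is bounded, and unsuccessful iterations are at most proportional to
successful ones (`Input.Good.unsuccessful_le`).

*Improvements of the error bounds.* The accuracy checks succeed once the error bounds are below a
multiple of `(min_j ε_j) ^ (p + 1)` (`Input.Good.accConst_le`), which takes a number of improvements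
that is logarithmic in the tolerances.

*Halvings of the radii.* A small radius makes the terms of the model beyond order `j` negligible
(`Input.Good.big_of_not_small`), so the radii stay above a multiple of `ε_j`.

The difficulty in the feasibility of the algorithm is the norm: `‖·‖ ^ (p + 1)` is not smooth at the
origin, and bounds for its derivatives have to be free of the dimension. Its derivatives along a
line satisfy a recursion in the exponent (`normPowDeriv_add_two`), which bounds them
(`abs_normPowDeriv_le`) and, for segments that miss the origin, bounds its Taylor remainder. On
segments through the origin everything reduces to a binomial sum (`norm_pow_sub_taylor_le`). It
follows that a global minimizer of the model is always an admissible step, with radii one for the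
orders one and two, and with radii proportional to the tolerances for higher orders
(`phi_model_le_of_isMin`, `Input.Good.exists_step`).

All of this is collected in an invariant (`Input.Inv`) of the transition system, from which the
bounds and termination are read off (`exists_complexity_constants`). For `q ≤ 2`, approximate
optimality for some radius implies it for the radius one (`phi_one_le`).
-/

open scoped RealInnerProductSpace Topology

/-! ### Taylor remainders, and polynomials built from multilinear forms -/

section

variable {E F : Type*} [NormedAddCommGroup E] [NormedSpace ℝ E] [NormedAddCommGroup F]
  [NormedSpace ℝ F]

/-- Taylor's formula with a bound on the next derivative along the segment only; nothing is assumed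
away from the segment. -/
lemma abs_sub_taylor_le {f : E → ℝ} {x y : E} {n : ℕ} {C : ℝ}
    (hf : ∀ t ∈ Set.Icc (0 : ℝ) 1, ContDiffAt ℝ (n + 1) f (x + t • y))
    (hC : ∀ t ∈ Set.Icc (0 : ℝ) 1,
      |iteratedFDeriv ℝ (n + 1) f (x + t • y) (fun _ => y)| ≤ C) :
    |f (x + y) - ∑ k ∈ Finset.range (n + 1), iteratedFDeriv ℝ k f x (fun _ => y) / (k ! : ℝ)|
      ≤ C / ((n + 1)! : ℝ) := by
  have h1 : f (x + y) -
      ∑ k ∈ Finset.range (n + 1), iteratedFDeriv ℝ k f x (fun _ => y) / (k ! : ℝ) =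
      (n ! : ℝ)⁻¹ *
        ∫ t in 0..1, (1 - t) ^ n * iteratedFDeriv ℝ (n + 1) f (x + t • y) (fun _ => y) := by
    rw [map_add_eq_sum_add_integral_iteratedFDeriv hf]
    simp [div_eq_inv_mul]
  have h2 : |∫ t in (0 : ℝ)..1, (1 - t) ^ n *
      iteratedFDeriv ℝ (n + 1) f (x + t • y) (fun _ => y)| ≤
        ∫ t in (0 : ℝ)..1, C * (1 - t) ^ n := by
    rw [← Real.norm_eq_abs]
    refine intervalIntegral.norm_integral_le_of_norm_le zero_le_one ?_
      (Continuous.intervalIntegrable (by fun_prop) _ _)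
    refine MeasureTheory.ae_of_all _ fun t ht => ?_
    have ht' : t ∈ Set.Icc (0 : ℝ) 1 := ⟨ht.1.le, ht.2⟩
    rw [norm_mul, Real.norm_eq_abs, Real.norm_eq_abs,
      abs_of_nonneg (pow_nonneg (sub_nonneg.2 ht.2) n), mul_comm]
    exact mul_le_mul_of_nonneg_right (hC t ht') (pow_nonneg (sub_nonneg.2 ht.2) n)
  have h3 : ∫ t in (0 : ℝ)..1, C * (1 - t) ^ n = C / (n + 1) := by
    rw [intervalIntegral.integral_const_mul,
      intervalIntegral.integral_comp_sub_left (fun t => t ^ n) 1]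
    simp [div_eq_mul_inv]
  rw [h1, abs_mul, abs_of_nonneg (by positivity), Nat.factorial_succ]
  push_cast
  calc _ ≤ (n ! : ℝ)⁻¹ * (C / (n + 1)) := by gcongr; exact h2.trans h3.le
    _ = C / ((n + 1) * n !) := by field_simp

/-- Symmetry of the derivative of the top order of a `C^n` function. Adjacent transpositions
generate the permutations; the first one is symmetry of a second derivative, the others act inside a
derivative of lower order. -/
lemma iteratedFDeriv_comp_perm_of_contDiff {n : ℕ} {f : E → F} (hf : ContDiff ℝ n f) (x : E)
    (v : Fin n → E) (σ : Equiv.Perm (Fin n)) :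
    iteratedFDeriv ℝ n f x (v ∘ σ) = iteratedFDeriv ℝ n f x v := by
  induction n generalizing x with
  | zero => congr 1; ext i; exact i.elim0
  | succ n ih =>
    have hσ : σ ∈ Submonoid.closure
        (Set.range fun i : Fin n => Equiv.swap i.castSucc i.succ) := by
      rw [Equiv.Perm.mclosure_swap_castSucc_succ]; trivial
    induction hσ using Submonoid.closure_induction generalizing v with
    | one => rfl
    | mul σ τ _ _ h1 h2 =>
      rw [Equiv.Perm.coe_mul, ← Function.comp_assoc, h2, h1]
    | mem σ hσ =>
      obtain ⟨i, rfl⟩ := hσ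
      have hd : ∀ y, DifferentiableAt ℝ (iteratedFDeriv ℝ n f) y := fun y =>
        hf.contDiffAt.differentiableAt_iteratedFDeriv (by exact_mod_cast n.lt_succ_self)
      obtain _ | m := n
      · exact i.elim0
      rw [(hd x).iteratedFDeriv_succ_apply_left', (hd x).iteratedFDeriv_succ_apply_left']
      obtain rfl | ⟨j, rfl⟩ := i.eq_zero_or_eq_succ
      · set g := iteratedFDeriv ℝ m f with hg
        have hg2 : ContDiff ℝ 2 g := hf.iteratedFDeriv_right (by norm_cast; omega)
        have hgd : ∀ y, DifferentiableAt ℝ g y := fun y =>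
          (hg2.differentiable (by norm_num)) y
        have hg'd : DifferentiableAt ℝ (fderiv ℝ g) x :=
          ((hg2.fderiv_right (m := 1) (by norm_num)).differentiable (by norm_num)) x
        have key : ∀ (a : E) (w : Fin (m + 1) → E),
            fderiv ℝ (fun y => iteratedFDeriv ℝ (m + 1) f y w) x a =
              fderiv ℝ (fderiv ℝ g) x a (w 0) (Fin.tail w) := by
          intro a w
          have : (fun y => iteratedFDeriv ℝ (m + 1) f y w) =
              fun y => fderiv ℝ g y (w 0) (Fin.tail w) := by
            funext y; rfl
          rw [this]
          have h1 : HasFDerivAt (fun y => fderiv ℝ g y (w 0))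
              ((fderiv ℝ (fderiv ℝ g) x).flip (w 0)) x := by
            simpa using! hg'd.hasFDerivAt.clm_apply (hasFDerivAt_const (w 0) x)
          have h2 := h1.continuousMultilinear_apply_const (Fin.tail w)
          rw [h2.fderiv]; rfl
        rw [key, key]
        have hsymm : IsSymmSndFDerivAt ℝ g x :=
          hg2.contDiffAt.isSymmSndFDerivAt (by simp)
        have e0 : (v ∘ Equiv.swap (Fin.castSucc 0) (Fin.succ 0)) 0 =
            Fin.tail v (0 : Fin (m + 1)) := by
          simp [Fin.tail]
        have e1 : Fin.tail (v ∘ Equiv.swap (Fin.castSucc 0) (Fin.succ 0)) (0 : Fin (m + 1)) =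
            v 0 := by
          simp [Fin.tail]
        have e2 : Fin.tail (Fin.tail (v ∘ Equiv.swap (Fin.castSucc (0 : Fin (m + 1))) (Fin.succ 0)))
            = Fin.tail (Fin.tail v) := by
          ext k
          simp only [Fin.tail, Function.comp]
          rw [Equiv.swap_apply_of_ne_of_ne]
          · simp
          · exact fun h => absurd (Fin.succ_injective _ h) (Fin.succ_ne_zero _)
        rw [e0, e1, e2]
        exact congrArg (fun T => T (Fin.tail (Fin.tail v))) (hsymm.eq _ _)
      · have e0 : (v ∘ Equiv.swap j.succ.castSucc j.succ.succ) 0 = v 0 := by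
          simp only [Function.comp]
          rw [Equiv.swap_apply_of_ne_of_ne]
          · simp [Fin.ext_iff]
          · simp [Fin.ext_iff]
        have e1 : Fin.tail (v ∘ Equiv.swap j.succ.castSucc j.succ.succ) =
            Fin.tail v ∘ Equiv.swap j.castSucc j.succ := by
          ext k
          simp only [Fin.tail, Function.comp]
          congr 1
          rw [← Fin.succ_castSucc]
          exact ((Fin.succ_injective _).swap_apply _ _ _)
        rw [e0, e1]
        have : (fun y => iteratedFDeriv ℝ (m + 1) f y (Fin.tail v ∘ Equiv.swap j.castSucc j.succ)) =
            fun y => iteratedFDeriv ℝ (m + 1) f y (Fin.tail v) := by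
          funext y
          exact ih (hf.of_le (by exact_mod_cast (m + 1).le_succ)) y _ _
        rw [this]

variable {i k p : ℕ}

lemma contDiff_diag (D : E [×i]→L[ℝ] ℝ) {n : WithTop ℕ∞} : ContDiff ℝ n fun x => D fun _ => x :=
  D.contDiff.comp (contDiff_pi.2 fun _ => contDiff_id)

lemma norm_iteratedFDeriv_diag_le (D : E [×i]→L[ℝ] ℝ) (k : ℕ) (x : E) :
    ‖iteratedFDeriv ℝ k (fun x => D fun _ => x) x‖ ≤
      (i.descFactorial k : ℝ) * ‖D‖ * ‖x‖ ^ (i - k) := by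
  let g : E →L[ℝ] (Fin i → E) := ContinuousLinearMap.pi (fun i => ContinuousLinearMap.id ℝ E)
  have hg : ‖g‖ ≤ 1 := by
    refine g.opNorm_le_bound zero_le_one fun x => ?_
    rw [one_mul]
    exact (pi_norm_le_iff_of_nonneg (norm_nonneg _)).2 fun _ => le_rfl
  change ‖iteratedFDeriv ℝ k (D ∘ g) x‖ ≤ _
  rw [ContinuousLinearMap.iteratedFDeriv_comp_right g (n := k) D.contDiff x le_rfl]
  refine (ContinuousMultilinearMap.norm_compContinuousLinearMap_le _ _).trans ?_
  refine (mul_le_of_le_one_right (norm_nonneg _)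
    (Finset.prod_le_one (fun _ _ => norm_nonneg _) fun _ _ => hg)).trans ?_
  refine (D.norm_iteratedFDeriv_le k (g x)).trans ?_
  rw [Fintype.card_fin]
  gcongr
  exact (g.le_opNorm x).trans (mul_le_of_le_one_left (norm_nonneg _) hg)

/-- The polynomial `∑_{1 ≤ i ≤ p} D_i[x]^i / i!` attached to a family of multilinear forms. -/
noncomputable def tensorPoly (D : FormalMultilinearSeries ℝ E ℝ) (p : ℕ) (x : E) : ℝ :=
  ∑ i ∈ Finset.Icc 1 p, D i (fun _ => x) / (i ! : ℝ)

lemma contDiff_tensorPoly (D : FormalMultilinearSeries ℝ E ℝ) (p : ℕ) {n : WithTop ℕ∞} :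
    ContDiff ℝ n (tensorPoly D p) :=
  ContDiff.sum fun i _ => (contDiff_diag (D i)).div_const _

lemma iteratedFDeriv_tensorPoly (D : FormalMultilinearSeries ℝ E ℝ) (p k : ℕ) (x : E) :
    iteratedFDeriv ℝ k (tensorPoly D p) x =
      ∑ i ∈ Finset.Icc 1 p, (i ! : ℝ)⁻¹ • iteratedFDeriv ℝ k (fun x => D i fun _ => x) x := by
  have h : tensorPoly D p = fun x => ∑ i ∈ Finset.Icc 1 p, (i ! : ℝ)⁻¹ • D i fun _ => x := by
    funext x; simp [tensorPoly, div_eq_inv_mul]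
  have hc : ∀ i ∈ Finset.Icc 1 p, ContDiffAt ℝ k (fun x => (i ! : ℝ)⁻¹ • D i fun _ => x) x :=
    fun i _ => ((contDiff_diag (D i)).const_smul (i ! : ℝ)⁻¹).contDiffAt
  rw [h]
  refine (iteratedFDeriv_fun_sum_apply hc).trans (Finset.sum_congr rfl fun i _ => ?_)
  exact iteratedFDeriv_const_smul_apply (a := (i ! : ℝ)⁻¹) (f := fun x => D i fun _ => x)
    (contDiff_diag (D i)).contDiffAt

/-- Summing over the degrees produces an exponential, so that the bound involves neither `p` nor the
dimension. -/
lemma norm_iteratedFDeriv_tensorPoly_le (D : FormalMultilinearSeries ℝ E ℝ) {p k : ℕ} {B : ℝ}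
    (hB : 0 ≤ B) (hk : 1 ≤ k) (hD : ∀ i ∈ Finset.Icc k p, ‖D i‖ ≤ B) (x : E) :
    ‖iteratedFDeriv ℝ k (tensorPoly D p) x‖ ≤ B * Real.exp ‖x‖ := by
  rw [iteratedFDeriv_tensorPoly]
  refine (norm_sum_le _ _).trans ?_
  have h1 : ∀ i ∈ Finset.Icc 1 p, ‖(i ! : ℝ)⁻¹ • iteratedFDeriv ℝ k (fun x => D i fun _ => x) x‖ ≤
      if k ≤ i then B * (‖x‖ ^ (i - k) / ((i - k)! : ℝ)) else 0 := by
    intro i hi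
    rw [norm_smul, norm_inv, RCLike.norm_natCast]
    have h := norm_iteratedFDeriv_diag_le (D i) k x
    split_ifs with hki
    · have hf : ((i - k)! : ℝ) * (i.descFactorial k : ℝ) = (i ! : ℝ) := by
        exact_mod_cast Nat.factorial_mul_descFactorial hki
      have hD' := hD i (Finset.mem_Icc.2 ⟨hki, (Finset.mem_Icc.1 hi).2⟩)
      calc _ ≤ (i ! : ℝ)⁻¹ * ((i.descFactorial k : ℝ) * B * ‖x‖ ^ (i - k)) := by
            gcongr; exact h.trans (by gcongr)
        _ = _ := by
            rw [← hf]
            have : (i.descFactorial k : ℝ) ≠ 0 := by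
              exact_mod_cast (Nat.descFactorial_pos.2 hki).ne'
            field_simp
    · rw [Nat.descFactorial_eq_zero_iff_lt.2 (not_le.1 hki)] at h
      have h0 : ‖iteratedFDeriv ℝ k (fun x => D i fun _ => x) x‖ = 0 :=
        le_antisymm (by simpa using h) (norm_nonneg _)
      simp [h0]
  refine (Finset.sum_le_sum h1).trans ?_
  rw [← Finset.sum_filter]
  have h2 : (Finset.Icc 1 p).filter (fun i => k ≤ i) = Finset.Ico k (p + 1) := by
    ext i; simp only [Finset.mem_filter, Finset.mem_Icc, Finset.mem_Ico]; omega
  rw [h2, Finset.sum_Ico_eq_sum_range, ← Finset.mul_sum]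
  gcongr
  simp only [Nat.add_sub_cancel_left]
  exact Real.sum_le_exp_of_nonneg (norm_nonneg x) _

/-- The polynomial built from symmetric forms has these forms as its derivatives at the origin, and
its derivative of the top order is constant. -/
lemma iteratedFDeriv_tensorPoly_eq (D : FormalMultilinearSeries ℝ E ℝ) {p k : ℕ} (hk : 1 ≤ k)
    (hkp : k ≤ p) (hD : ∀ (v : Fin k → E) (σ : Equiv.Perm (Fin k)), D k (v ∘ σ) = D k v) {x : E}
    (hx : x = 0 ∨ k = p) : iteratedFDeriv ℝ k (tensorPoly D p) x = D k := by
  rw [iteratedFDeriv_tensorPoly, Finset.sum_eq_single_of_mem k (Finset.mem_Icc.2 ⟨hk, hkp⟩)]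
  · ext v
    rw [_root_.smul_apply, ContinuousMultilinearMap.iteratedFDeriv_comp_diagonal]
    have : ∀ σ : Equiv.Perm (Fin k), D k (fun i => v (σ i)) = D k v := hD v
    simp only [this, Finset.sum_const, Finset.card_univ, Fintype.card_perm, Fintype.card_fin]
    have hk0 : (k ! : ℝ) ≠ 0 := by exact_mod_cast k.factorial_ne_zero
    rw [nsmul_eq_mul, smul_eq_mul, inv_mul_cancel_left₀ hk0]
  · intro i hi hik
    have h := norm_iteratedFDeriv_diag_le (D i) k x
    have h0 : (i.descFactorial k : ℝ) * ‖D i‖ * ‖x‖ ^ (i - k) = 0 := by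
      rcases lt_or_gt_of_ne hik with h | h
      · rw [Nat.descFactorial_eq_zero_iff_lt.2 h]; simp
      · have hx0 : x = 0 := hx.resolve_right fun h' => by
          have := (Finset.mem_Icc.1 hi).2; omega
        simp [hx0, Nat.sub_ne_zero_of_lt h]
    rw [h0] at h
    rw [norm_le_zero_iff.1 h, smul_zero]

/-- The derivatives of the Taylor remainder of a function whose top derivative is Lipschitz. -/
lemma norm_iteratedFDeriv_sub_tensorPoly_le {f : E → ℝ} {p : ℕ} {L : ℝ} (hp : 1 ≤ p)
    (hf : ContDiff ℝ p f)
    (x : E) (hL : ∀ y, ‖iteratedFDeriv ℝ p f y - iteratedFDeriv ℝ p f x‖ ≤ L * ‖y - x‖) {k : ℕ}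
    (hk : k ≤ p) (s : E) :
    ‖iteratedFDeriv ℝ k (fun s => f (x + s) -
      (f x + tensorPoly (fun i => iteratedFDeriv ℝ i f x) p s)) s‖ ≤ L * ‖s‖ ^ (p + 1 - k) := by
  set T : FormalMultilinearSeries ℝ E ℝ := fun i => iteratedFDeriv ℝ i f x with hT
  set R : E → ℝ := fun s => f (x + s) - (f x + tensorPoly T p s) with hR
  have hfx : ContDiff ℝ p fun s => f (x + s) := hf.comp (contDiff_const.add contDiff_id)
  have hcT : ContDiff ℝ p fun s => f x + tensorPoly T p s :=
    contDiff_const.add (contDiff_tensorPoly T p)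
  have hRc : ContDiff ℝ p R := hfx.sub hcT
  have hd : ∀ k ≤ p, 1 ≤ k → ∀ s, iteratedFDeriv ℝ k R s =
      iteratedFDeriv ℝ k f (x + s) - iteratedFDeriv ℝ k (tensorPoly T p) s := by
    intro k hk hk1 s
    have hkp : (k : WithTop ℕ∞) ≤ p := by exact_mod_cast hk
    rw [hR, fun_iteratedFDeriv_sub_apply (hfx.of_le hkp).contDiffAt (hcT.of_le hkp).contDiffAt,
      iteratedFDeriv_comp_add_left, fun_iteratedFDeriv_add_apply contDiff_const.contDiffAt
        (contDiff_tensorPoly T p).contDiffAt, iteratedFDeriv_const_of_ne (by omega)]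
    simp
  have hsymm : ∀ k ≤ p, ∀ (v : Fin k → E) (σ : Equiv.Perm (Fin k)), T k (v ∘ σ) = T k v :=
    fun k hk v σ => iteratedFDeriv_comp_perm_of_contDiff (hf.of_le (by exact_mod_cast hk)) x v σ
  have h0 : ∀ k ≤ p, iteratedFDeriv ℝ k R 0 = 0 := by
    intro k hk
    obtain rfl | hk1 := k.eq_zero_or_pos
    · ext v
      have : tensorPoly T p 0 = 0 := by
        refine Finset.sum_eq_zero fun i hi => ?_
        have : NeZero i := ⟨by have := (Finset.mem_Icc.1 hi).1; omega⟩
        rw [(T i).map_coord_zero (0 : Fin i) rfl, zero_div]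
      simp [hR, this]
    · rw [hd k hk hk1, iteratedFDeriv_tensorPoly_eq T hk1 hk (hsymm k hk) (Or.inl rfl), add_zero,
        sub_self]
  -- downward induction on the order: the derivatives of order less than `p` vanish at the origin,
  -- so that the mean value inequality gains one power of the distance at each order
  have key : ∀ j k : ℕ, k + j = p → ∀ s, ‖iteratedFDeriv ℝ k R s‖ ≤ L * ‖s‖ ^ (j + 1) := by
    intro j
    induction j with
    | zero =>
      rintro k rfl s
      rw [add_zero] at *
      rw [hd k le_rfl hp, iteratedFDeriv_tensorPoly_eq T hp le_rfl (hsymm k le_rfl) (Or.inr rfl)]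
      simpa [hT] using hL (x + s)
    | succ j ih =>
      intro k hkj s
      have hdiff : Differentiable ℝ (iteratedFDeriv ℝ k R) :=
        hRc.differentiable_iteratedFDeriv (by exact_mod_cast (by omega : k < p))
      have hL0 : 0 ≤ L * ‖s‖ ^ (j + 1) :=
        (norm_nonneg _).trans (ih (k + 1) (by omega) s)
      have hb : ∀ y ∈ Metric.closedBall (0 : E) ‖s‖,
          ‖fderiv ℝ (iteratedFDeriv ℝ k R) y‖ ≤ L * ‖s‖ ^ (j + 1) := by
        intro y hy
        rw [norm_fderiv_iteratedFDeriv]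
        refine (ih (k + 1) (by omega) y).trans ?_
        have hys : ‖y‖ ≤ ‖s‖ := by simpa using hy
        rcases (norm_nonneg s).eq_or_lt with hs | hs
        · have : ‖y‖ = ‖s‖ := le_antisymm hys (hs ▸ norm_nonneg y)
          rw [this]
        · have hL' : 0 ≤ L := nonneg_of_mul_nonneg_left hL0 (pow_pos hs _)
          gcongr
      have := (convex_closedBall (0 : E) ‖s‖).norm_image_sub_le_of_norm_fderiv_le
        (fun y _ => hdiff y) hb (x := 0) (y := s) (by simp) (by simp)
      rw [h0 k (by omega), sub_zero, sub_zero] at this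
      rwa [pow_succ, ← mul_assoc]
  have := key (p - k) k (by omega) s
  rwa [show p - k + 1 = p + 1 - k by omega] at this

end

/-! ### Directional derivatives of powers of the norm -/

section

variable {E F : Type*} [NormedAddCommGroup E] [NormedSpace ℝ E] [NormedAddCommGroup F]
  [NormedSpace ℝ F]

lemma ContDiffAt.hasDerivAt_iteratedFDeriv_line {f : E → F} {x d : E} {k : ℕ}
    (hf : ContDiffAt ℝ (k + 1) f x) :
    HasDerivAt (fun s : ℝ => iteratedFDeriv ℝ k f (x + s • d) fun _ => d)
      (iteratedFDeriv ℝ (k + 1) f x fun _ => d) 0 := by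
  have hx : x + (0 : ℝ) • d = x := by simp
  have h1 : DifferentiableAt ℝ (iteratedFDeriv ℝ k f) (x + (0 : ℝ) • d) := by
    rw [hx]
    exact hf.differentiableAt_iteratedFDeriv (by exact_mod_cast k.lt_succ_self)
  have h2 : DifferentiableAt ℝ (fun s : ℝ => iteratedFDeriv ℝ k f (x + s • d) fun _ => d) 0 := by
    have h3 : DifferentiableAt ℝ (fun y => iteratedFDeriv ℝ k f y fun _ => d) (x + (0 : ℝ) • d) :=
      h1.continuousMultilinear_apply_const _
    exact h3.comp (0 : ℝ) (f := fun s : ℝ => x + s • d) (by fun_prop)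
  have h3 := h2.hasDerivAt
  rwa [ContDiffAt.deriv_fderiv_add_smul (by rwa [hx]), hx] at h3

end

section

variable {E : Type*} [NormedAddCommGroup E] [InnerProductSpace ℝ E]

/-- The `k`-th derivative of `x ↦ ‖x‖ ^ N` in direction `d`. -/
noncomputable def normPowDeriv (d : E) (N k : ℕ) (x : E) : ℝ :=
  iteratedFDeriv ℝ k (fun x : E => ‖x‖ ^ N) x fun _ => d

variable {d x : E} {N k : ℕ}

lemma contDiffAt_norm_pow (N : ℕ) (hx : x ≠ 0) {n : WithTop ℕ∞} :
    ContDiffAt ℝ n (fun x : E => ‖x‖ ^ N) x :=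
  (contDiffAt_norm ℝ hx).pow N

lemma normPowDeriv_zero : normPowDeriv d N 0 x = ‖x‖ ^ N := rfl

lemma hasDerivAt_normPowDeriv (hx : x ≠ 0) :
    HasDerivAt (fun s : ℝ => normPowDeriv d N k (x + s • d)) (normPowDeriv d N (k + 1) x) 0 :=
  (contDiffAt_norm_pow N hx).hasDerivAt_iteratedFDeriv_line

lemma hasDerivAt_norm_line (hx : x ≠ 0) :
    HasDerivAt (fun s : ℝ => ‖x + s • d‖) (⟪x, d⟫ / ‖x‖) 0 := by
  have h1 : HasDerivAt (fun s : ℝ => x + s • d) d 0 := by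
    simpa using ((hasDerivAt_id (0 : ℝ)).smul_const d).const_add x
  have h2 := h1.norm_sq.sqrt (by simpa using hx)
  simp only [zero_smul, add_zero, Real.sqrt_sq (norm_nonneg _)] at h2
  convert h2 using 1
  field_simp

lemma hasDerivAt_inner_line : HasDerivAt (fun s : ℝ => ⟪x + s • d, d⟫) (‖d‖ ^ 2) 0 := by
  have : (fun s : ℝ => ⟪x + s • d, d⟫) = fun s : ℝ => ⟪x, d⟫ + s * ‖d‖ ^ 2 := by
    funext s; rw [inner_add_left, real_inner_smul_left, real_inner_self_eq_norm_sq]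
  rw [this]
  simpa using ((hasDerivAt_id (0 : ℝ)).mul_const (‖d‖ ^ 2)).const_add ⟪x, d⟫

lemma eventually_line_ne_zero (hx : x ≠ 0) : ∀ᶠ s : ℝ in 𝓝 0, x + s • d ≠ 0 := by
  have : ContinuousAt (fun s : ℝ => x + s • d) 0 := by fun_prop
  exact this.eventually_ne (by simpa using hx)

/-- Derivatives of successive orders can be computed one by one along the line. -/
lemma normPowDeriv_succ_eq {g : E → ℝ} {g' : ℝ} (hx : x ≠ 0)
    (hg : ∀ y : E, y ≠ 0 → normPowDeriv d N k y = g y)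
    (hg' : HasDerivAt (fun s : ℝ => g (x + s • d)) g' 0) : normPowDeriv d N (k + 1) x = g' := by
  refine (hasDerivAt_normPowDeriv hx).unique (hg'.congr_of_eventuallyEq ?_)
  filter_upwards [eventually_line_ne_zero hx] with s hs using hg _ hs

lemma normPowDeriv_one (hx : x ≠ 0) : normPowDeriv d 1 1 x = ⟪x, d⟫ / ‖x‖ :=
  normPowDeriv_succ_eq hx (fun y _ => by rw [normPowDeriv_zero, pow_one]) (hasDerivAt_norm_line hx)

/-- A recursion in steps of two in the exponent: the derivative of `‖·‖ ^ (N + 2)` along the line is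
`(N + 2) ⟪·, d⟫ ‖·‖ ^ N`, and the linear factor contributes two terms to the Leibniz rule. At
`k = 0` the truncated `k - 1` carries the coefficient zero. -/
lemma normPowDeriv_add_two (hx : x ≠ 0) :
    normPowDeriv d (N + 2) (k + 1) x = (N + 2) *
      (⟪x, d⟫ * normPowDeriv d N k x + k * ‖d‖ ^ 2 * normPowDeriv d N (k - 1) x) := by
  induction k generalizing x with
  | zero =>
    refine normPowDeriv_succ_eq hx (fun y _ => normPowDeriv_zero) ?_
    refine ((hasDerivAt_norm_line (d := d) hx).pow (N + 2)).congr_deriv ?_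
    have : ‖x‖ ≠ 0 := norm_ne_zero_iff.2 hx
    simp only [normPowDeriv_zero, zero_smul, add_zero]
    push_cast
    field_simp
    ring
  | succ k ih =>
    refine normPowDeriv_succ_eq hx (fun y hy => ih hy) ?_
    have h1 := (hasDerivAt_inner_line (d := d) (x := x)).mul
      (hasDerivAt_normPowDeriv (d := d) (N := N) (k := k) hx)
    have h2 : HasDerivAt (fun s : ℝ => k * ‖d‖ ^ 2 * normPowDeriv d N (k - 1) (x + s • d))
        (k * ‖d‖ ^ 2 * normPowDeriv d N k x) 0 := by
      rcases k with _ | k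
      · simpa using hasDerivAt_const (0 : ℝ) (0 : ℝ)
      · exact (hasDerivAt_normPowDeriv hx).const_mul _
    refine ((h1.add h2).const_mul ((N : ℝ) + 2)).congr_deriv ?_
    simp only [zero_smul, add_zero, Nat.add_sub_cancel]
    push_cast
    ring

/-- The Gram determinant of `x` and `d`; it is constant along lines of direction `d`. -/
noncomputable def gram (d x : E) : ℝ := ‖d‖ ^ 2 * ‖x‖ ^ 2 - ⟪x, d⟫ ^ 2

lemma gram_line (s : ℝ) : gram d (x + s • d) = gram d x := by
  have h : ‖x + s • d‖ ^ 2 = ‖x‖ ^ 2 + 2 * s * ⟪x, d⟫ + s ^ 2 * ‖d‖ ^ 2 := by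
    rw [norm_add_sq_real, inner_smul_right, norm_smul, mul_pow, Real.norm_eq_abs, sq_abs]; ring
  rw [gram, gram, h, inner_add_left, real_inner_smul_left, real_inner_self_eq_norm_sq]
  ring

lemma gram_nonneg : 0 ≤ gram d x := by
  have h := abs_real_inner_le_norm x d
  have : ⟪x, d⟫ ^ 2 ≤ (‖x‖ * ‖d‖) ^ 2 := sq_le_sq' (abs_le.1 h).1 (abs_le.1 h).2
  rw [gram]; nlinarith

lemma gram_le : gram d x ≤ (‖d‖ * ‖x‖) ^ 2 := by
  rw [gram, mul_pow]; nlinarith [sq_nonneg ⟪x, d⟫]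

/-- The numerator of the derivative of order `N + 1` of `‖·‖ ^ N`, as a function of the Gram
determinant. It vanishes for even `N`, where `‖·‖ ^ N` is a polynomial of degree `N`. -/
noncomputable def topCoeff : ℕ → ℝ → ℝ
  | 0, _ => 0
  | 1, g => g
  | N + 2, g => (N + 2) ^ 2 * g * topCoeff N g

lemma topCoeff_bounds {g r : ℝ} (hg : 0 ≤ g) (hgr : g ≤ r ^ 2) (hr : 0 ≤ r) (N : ℕ) :
    0 ≤ topCoeff N g ∧ topCoeff N g ≤ (N + 1)! * r ^ (N + 1) := by
  induction N using Nat.twoStepInduction with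
  | zero => simp [topCoeff, hr]
  | one =>
    refine ⟨hg, ?_⟩
    simp only [topCoeff]
    norm_num
    nlinarith [sq_nonneg r]
  | more N ih _ =>
    obtain ⟨h0, h1⟩ := ih
    refine ⟨by rw [topCoeff]; positivity, ?_⟩
    rw [topCoeff, show N + 2 + 1 = (N + 2) + 1 by omega, Nat.factorial_succ, Nat.factorial_succ]
    push_cast
    calc ((N : ℝ) + 2) ^ 2 * g * topCoeff N g
        ≤ ((N : ℝ) + 2) ^ 2 * r ^ 2 * ((N + 1)! * r ^ (N + 1)) := by gcongr
      _ = ((N : ℝ) + 2) * ((N + 2) * (N + 1)!) * r ^ (N + 2 + 1) := by ring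
      _ ≤ ((N : ℝ) + 2 + 1) * ((N + 1 + 1) * (N + 1)!) * r ^ (N + 2 + 1) := by
        rw [show (N : ℝ) + 1 + 1 = N + 2 by ring]
        exact mul_le_mul_of_nonneg_right
          (mul_le_mul_of_nonneg_right (by linarith) (by positivity)) (by positivity)

/-- The derivative one order above the exponent. The numerator is constant along the line, which
makes the induction work. -/
lemma normPowDeriv_top (hx : x ≠ 0) :
    normPowDeriv d N (N + 1) x = topCoeff N (gram d x) / ‖x‖ ^ (N + 2) := by
  induction N using Nat.twoStepInduction generalizing x with
  | zero =>
    have : HasDerivAt (fun _ : ℝ => (1 : ℝ)) 0 0 := hasDerivAt_const _ _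
    simpa [topCoeff] using normPowDeriv_succ_eq (g := fun _ => 1) hx (d := d) (N := 0) (k := 0)
      (fun y _ => by simp [normPowDeriv_zero]) this
  | one =>
    refine normPowDeriv_succ_eq hx (fun y hy => normPowDeriv_one hy) ?_
    have hx' : ‖x‖ ≠ 0 := norm_ne_zero_iff.2 hx
    refine ((hasDerivAt_inner_line (d := d) (x := x)).div (hasDerivAt_norm_line (d := d) hx)
      (by simpa using hx)).congr_deriv ?_
    simp only [topCoeff, gram, zero_smul, add_zero]
    field_simp
    ring
  | more N ih _ =>
    have hx' : ‖x‖ ≠ 0 := norm_ne_zero_iff.2 hx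
    have h1 : normPowDeriv d N (N + 2) x =
        -(N + 2) * topCoeff N (gram d x) * ⟪x, d⟫ / ‖x‖ ^ (N + 4) := by
      refine normPowDeriv_succ_eq hx (fun y hy => ih hy) ?_
      simp only [gram_line]
      refine ((((hasDerivAt_norm_line (d := d) hx).pow (N + 2)).inv
        (by simpa using hx)).const_mul (topCoeff N (gram d x))).congr_deriv ?_
      simp only [Pi.pow_apply, zero_smul, add_zero]
      push_cast
      field_simp
      ring
    rw [normPowDeriv_add_two hx, h1, show N + 2 - 1 = N + 1 by omega, ih hx, topCoeff, gram]
    push_cast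
    field_simp
    ring

/-- The derivatives of `‖·‖ ^ N` in direction `d` are bounded as those of a homogeneous polynomial
of degree `N`, up to the factor `N + 1`. For `k` at most `N - 1` the recursion gives the bound for
the exponent `N` from that for `N - 2`; the term of order one above the exponent, which the
recursion meets at `k = N`, is `normPowDeriv_top`. -/
lemma abs_normPowDeriv_le (hx : x ≠ 0) (hk : k ≤ N) :
    |normPowDeriv d N k x| ≤ (N + 1) * N.descFactorial k * ‖x‖ ^ (N - k) * ‖d‖ ^ k := by
  have hx0 : 0 < ‖x‖ := norm_pos_iff.2 hx
  induction N using Nat.twoStepInduction generalizing k with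
  | zero =>
    obtain rfl : k = 0 := by omega
    simp [normPowDeriv_zero]
  | one =>
    obtain rfl | rfl : k = 0 ∨ k = 1 := by omega
    · simp only [normPowDeriv_zero, pow_one, abs_norm]; norm_num; linarith
    · rw [normPowDeriv_one hx, abs_div, abs_norm, div_le_iff₀ hx0]
      have := abs_real_inner_le_norm x d
      norm_num
      nlinarith [mul_nonneg hx0.le (norm_nonneg d)]
  | more N ih _ =>
    obtain _ | j := k
    · simp only [normPowDeriv_zero, Nat.descFactorial_zero, Nat.sub_zero, pow_zero, abs_pow,
        abs_norm]
      have : 0 ≤ ‖x‖ ^ (N + 2) := by positivity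
      push_cast
      nlinarith
    have hj : j ≤ N + 1 := by omega
    rw [normPowDeriv_add_two hx, abs_mul, abs_of_nonneg (by positivity : (0 : ℝ) ≤ N + 2)]
    have hi := abs_real_inner_le_norm x d
    obtain rfl | hjN := hj.eq_or_lt
    · have ht := topCoeff_bounds (gram_nonneg (d := d) (x := x)) gram_le (by positivity) N
      have h1 : |normPowDeriv d N (N + 1) x| ≤ (N + 1)! * ‖d‖ ^ (N + 1) / ‖x‖ := by
        rw [normPowDeriv_top hx, abs_of_nonneg (by have := ht.1; positivity),
          div_le_div_iff₀ (by positivity) hx0]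
        calc _ ≤ (N + 1)! * (‖d‖ * ‖x‖) ^ (N + 1) * ‖x‖ := by gcongr; exact ht.2
          _ = _ := by ring
      have h2 := ih le_rfl
      rw [Nat.descFactorial_self, Nat.sub_self, pow_zero, mul_one] at h2
      have hf : ((N + 1)! : ℝ) = (N + 1) * N ! := by rw [Nat.factorial_succ]; push_cast; ring
      rw [show N + 1 + 1 = N + 2 by omega, Nat.descFactorial_self, Nat.sub_self, pow_zero, mul_one,
        Nat.add_sub_cancel]
      rw [hf] at h1
      calc ((N : ℝ) + 2) * |⟪x, d⟫ * normPowDeriv d N (N + 1) x +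
            ((N + 1 : ℕ) : ℝ) * ‖d‖ ^ 2 * normPowDeriv d N N x|
          ≤ (N + 2) * (|⟪x, d⟫| * |normPowDeriv d N (N + 1) x| +
            ((N + 1 : ℕ) : ℝ) * ‖d‖ ^ 2 * |normPowDeriv d N N x|) := by
            gcongr
            refine (abs_add_le _ _).trans_eq ?_
            rw [abs_mul, abs_mul, abs_of_nonneg (by positivity : 0 ≤ ((N + 1 : ℕ) : ℝ) * ‖d‖ ^ 2)]
        _ ≤ (N + 2) * ((‖x‖ * ‖d‖) * ((N + 1) * N ! * ‖d‖ ^ (N + 1) / ‖x‖) +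
            ((N + 1 : ℕ) : ℝ) * ‖d‖ ^ 2 * ((N + 1) * N ! * ‖d‖ ^ N)) := by gcongr
        _ = (N + 2) * ((N + 2) * ((N + 1) * N ! * ‖d‖ ^ (N + 2))) := by
            push_cast; field_simp; ring
        _ ≤ (N + 3) * ((N + 2) * ((N + 1) * N ! * ‖d‖ ^ (N + 2))) := by gcongr; norm_num
        _ = _ := by push_cast [Nat.factorial_succ]; ring
    · have hjN' : j ≤ N := by omega
      have hdesc : ((N + 2).descFactorial (j + 1) : ℝ) =
          (N + 2) * (N.descFactorial j + j * N.descFactorial (j - 1)) := by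
        rw [Nat.succ_descFactorial_succ]
        push_cast
        rcases j with _ | i
        · simp; ring
        · rw [Nat.succ_descFactorial_succ, Nat.add_sub_cancel, Nat.descFactorial_succ]
          have : ((N - i : ℕ) : ℝ) = N - i := by rw [Nat.cast_sub (by omega)]
          push_cast
          rw [this]
          ring
      have h1 := ih hjN'
      have h2 : (j : ℝ) * ‖d‖ ^ 2 * |normPowDeriv d N (j - 1) x| ≤
          (j : ℝ) * ((N + 1) * N.descFactorial (j - 1) * ‖x‖ ^ (N + 1 - j) * ‖d‖ ^ (j + 1)) := by
        rcases j with _ | i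
        · simp
        · have := ih (k := i) (by omega)
          rw [Nat.add_sub_cancel, mul_assoc]
          refine mul_le_mul_of_nonneg_left ?_ (by positivity)
          calc _ ≤ ‖d‖ ^ 2 * ((N + 1) * N.descFactorial i * ‖x‖ ^ (N - i) * ‖d‖ ^ i) := by gcongr
            _ = _ := by rw [show N + 1 - (i + 1) = N - i by omega]; ring
      calc ((N : ℝ) + 2) * |⟪x, d⟫ * normPowDeriv d N j x +
            (j : ℝ) * ‖d‖ ^ 2 * normPowDeriv d N (j - 1) x|
          ≤ (N + 2) * (|⟪x, d⟫| * |normPowDeriv d N j x| +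
            (j : ℝ) * ‖d‖ ^ 2 * |normPowDeriv d N (j - 1) x|) := by
            gcongr
            refine (abs_add_le _ _).trans_eq ?_
            rw [abs_mul, abs_mul, abs_of_nonneg (by positivity : 0 ≤ (j : ℝ) * ‖d‖ ^ 2)]
        _ ≤ (N + 2) * ((‖x‖ * ‖d‖) * ((N + 1) * N.descFactorial j * ‖x‖ ^ (N - j) * ‖d‖ ^ j) +
            (j : ℝ) * ((N + 1) * N.descFactorial (j - 1) * ‖x‖ ^ (N + 1 - j) * ‖d‖ ^ (j + 1))) := by
            gcongr
        _ = (N + 1) * ((N + 2).descFactorial (j + 1)) * ‖x‖ ^ (N + 1 - j) * ‖d‖ ^ (j + 1) := by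
            rw [hdesc, show N + 1 - j = (N - j) + 1 by omega]; ring
        _ ≤ _ := by
            rw [show N + 2 - (j + 1) = N + 1 - j by omega]
            push_cast
            gcongr
            linarith

end

/-! ### Taylor expansion of powers of the norm -/

section

variable {E : Type*} [NormedAddCommGroup E] [InnerProductSpace ℝ E]
variable {d x : E} {N k l : ℕ}

lemma two_pow_le_two_mul_factorial (m : ℕ) : 2 ^ m ≤ 2 * m ! := by
  induction m with
  | zero => simp
  | succ m ih =>
    rcases m with _ | m
    · simp
    · rw [pow_succ, Nat.factorial_succ (m + 1)]
      nlinarith [(m + 1).factorial_pos]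

lemma add_mul_two_pow_le (m : ℕ) (hl : 2 ≤ l) :
    (m + l + 2) * 2 ^ m ≤ 4 * (l + 1) * m ! := by
  have h1 : m * 2 ^ m ≤ 4 * m ! := by
    rcases m with _ | m
    · simp
    · have := two_pow_le_two_mul_factorial m
      rw [pow_succ, Nat.factorial_succ]
      nlinarith
  have h2 := two_pow_le_two_mul_factorial m
  nlinarith [m.factorial_pos]

/-- Taylor's formula for `‖·‖ ^ N` on a segment that avoids the origin. -/
lemma abs_norm_pow_sub_taylor_le (hseg : ∀ t ∈ Set.Icc (0 : ℝ) 1, x + t • d ≠ 0)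
    (hlN : l + 1 ≤ N) (hx : ‖x‖ ≤ 1) (hd : ‖d‖ ≤ 1) (hl : 2 ≤ l) :
    |‖x + d‖ ^ N - ∑ k ∈ Finset.range (l + 1), normPowDeriv d N k x / (k ! : ℝ)| ≤
      4 * (N ! / (l ! : ℝ)) * ‖d‖ ^ (l + 1) := by
  have hb : ∀ t ∈ Set.Icc (0 : ℝ) 1, |normPowDeriv d N (l + 1) (x + t • d)| ≤
      (N + 1) * N.descFactorial (l + 1) * 2 ^ (N - (l + 1)) * ‖d‖ ^ (l + 1) := by
    intro t ht
    refine (abs_normPowDeriv_le (hseg t ht) hlN).trans ?_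
    have : ‖x + t • d‖ ≤ 2 := by
      refine (norm_add_le _ _).trans ?_
      rw [norm_smul, Real.norm_eq_abs, abs_of_nonneg ht.1]
      nlinarith [ht.1, ht.2, norm_nonneg d]
    gcongr
  refine (abs_sub_taylor_le (fun t ht => contDiffAt_norm_pow N (hseg t ht)) hb).trans ?_
  obtain ⟨m, rfl⟩ := Nat.exists_eq_add_of_le hlN
  rw [show l + 1 + m - (l + 1) = m by omega]
  have h1 : ((m ! : ℕ) : ℝ) * ((l + 1 + m).descFactorial (l + 1) : ℝ) = ((l + 1 + m)! : ℝ) := by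
    have := Nat.factorial_mul_descFactorial (show l + 1 ≤ l + 1 + m by omega)
    rw [show l + 1 + m - (l + 1) = m by omega] at this
    exact_mod_cast this
  have h2 : ((m : ℝ) + l + 2) * 2 ^ m ≤ 4 * (l + 1) * m ! := by
    exact_mod_cast add_mul_two_pow_le m hl
  rw [← h1, Nat.factorial_succ l, div_le_iff₀ (by positivity)]
  push_cast
  calc _ = (((m : ℝ) + l + 2) * 2 ^ m) * ((l + 1 + m).descFactorial (l + 1) * ‖d‖ ^ (l + 1)) := by
        ring
    _ ≤ (4 * (l + 1) * m !) * ((l + 1 + m).descFactorial (l + 1) * ‖d‖ ^ (l + 1)) := by gcongr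
    _ = _ := by field_simp

/-- In radial directions `‖·‖ ^ N` behaves as a monomial. -/
lemma normPowDeriv_radial (hx : x ≠ 0) (c : ℝ) :
    normPowDeriv (c • x) N k x = N.descFactorial k * c ^ k * ‖x‖ ^ N := by
  have key : ∀ μ : ℝ, 0 < μ →
      normPowDeriv (c • x) N k (μ • x) = N.descFactorial k * c ^ k * μ ^ (N - k) * ‖x‖ ^ N := by
    induction k with
    | zero =>
      intro μ hμ
      simp [normPowDeriv_zero, norm_smul, abs_of_pos hμ, mul_pow]
    | succ k ih =>
      intro μ hμ
      have hne : μ • x ≠ 0 := smul_ne_zero hμ.ne' hx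
      refine (hasDerivAt_normPowDeriv hne).unique ?_
      have h1 : HasDerivAt (fun s : ℝ => μ + s * c) c 0 := by
        simpa using ((hasDerivAt_id (0 : ℝ)).mul_const c).const_add μ
      have h2 := ((h1.pow (N - k)).const_mul ((N.descFactorial k : ℝ) * c ^ k)).mul_const
        (‖x‖ ^ N)
      refine (h2.congr_of_eventuallyEq ?_).congr_deriv ?_
      · have hpos : ∀ᶠ s : ℝ in 𝓝 0, 0 < μ + s * c := by
          have : ContinuousAt (fun s : ℝ => μ + s * c) 0 := by fun_prop
          exact continuousAt_const.eventually_lt this (by simpa using hμ)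
        filter_upwards [hpos] with s hs
        rw [show μ • x + s • c • x = (μ + s * c) • x by rw [smul_smul, add_smul], ih _ hs]
        rfl
      · simp only [zero_mul, add_zero, Nat.descFactorial_succ]
        rw [show N - k - 1 = N - (k + 1) by omega]
        push_cast
        ring
  simpa using key 1 one_pos

lemma sum_choose_le (hlN : l + 1 ≤ N) (hl : 1 ≤ l) :
    ∑ k ∈ Finset.Ico (l + 1) (N + 1), (N.choose k : ℝ) ≤ 2 * (N ! / (l ! : ℝ)) := by
  have h1 : ∀ k ∈ Finset.Ico (l + 1) (N + 1),
      (N.choose k : ℝ) ≤ (N ! / ((l + 1)! : ℝ)) * (1 / ((N - k)! : ℝ)) := by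
    intro k hk
    obtain ⟨hk1, hk2⟩ := Finset.mem_Ico.1 hk
    rw [Nat.cast_choose ℝ (by omega : k ≤ N), div_mul_div_comm, mul_one]
    have : ((l + 1)! : ℝ) ≤ k ! := by exact_mod_cast Nat.factorial_le hk1
    gcongr
  refine (Finset.sum_le_sum h1).trans ?_
  rw [← Finset.mul_sum, Finset.sum_Ico_eq_sum_range]
  have h2 : ∑ i ∈ Finset.range (N + 1 - (l + 1)), 1 / ((N - (l + 1 + i))! : ℝ) ≤ 3 := by
    rw [← Finset.sum_range_reflect]
    have h3 : ∀ j ∈ Finset.range (N + 1 - (l + 1)),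
        1 / ((N - (l + 1 + (N + 1 - (l + 1) - 1 - j)))! : ℝ) = 1 ^ j / (j ! : ℝ) := by
      intro j hj
      have := Finset.mem_range.1 hj
      rw [show N - (l + 1 + (N + 1 - (l + 1) - 1 - j)) = j by omega, one_pow]
    rw [Finset.sum_congr rfl h3]
    refine (Real.sum_le_exp_of_nonneg zero_le_one _).trans ?_
    linarith [Real.exp_one_lt_d9]
  have hl' : (1 : ℝ) ≤ l := by exact_mod_cast hl
  calc _ ≤ (N ! / ((l + 1)! : ℝ)) * 3 := by gcongr
    _ ≤ _ := by
      rw [Nat.factorial_succ]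
      push_cast
      rw [div_mul_eq_mul_div, ← mul_div_assoc, div_le_div_iff₀ (by positivity) (by positivity)]
      have : (0 : ℝ) ≤ N ! * l ! := by positivity
      nlinarith

/-- The Taylor polynomial of `‖·‖ ^ N` at `x ≠ 0` underestimates `‖·‖ ^ N` by at most a multiple,
independent of the dimension, of the next power of the displacement, also when the segment passes
through the origin, where `‖·‖ ^ N` need not be smooth. -/
lemma norm_pow_sub_taylor_le (hx0 : x ≠ 0) (hlN : l + 1 ≤ N) (hx : ‖x‖ ≤ 1) (hd : ‖d‖ ≤ 1)
    (hl : 2 ≤ l) :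
    ‖x + d‖ ^ N - ∑ k ∈ Finset.range (l + 1), normPowDeriv d N k x / (k ! : ℝ) ≤
      4 * (N ! / (l ! : ℝ)) * ‖d‖ ^ (l + 1) := by
  by_cases hseg : ∀ t ∈ Set.Icc (0 : ℝ) 1, x + t • d ≠ 0
  · exact (le_abs_self _).trans (abs_norm_pow_sub_taylor_le hseg hlN hx hd hl)
  push Not at hseg
  obtain ⟨t, ht, h0⟩ := hseg
  have ht0 : 0 < t := lt_of_le_of_ne ht.1 fun h => hx0 (by simpa [← h] using h0)
  -- the displacement is `-c • x` with `c ≥ 1`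
  obtain ⟨c, hc, rfl⟩ : ∃ c : ℝ, 1 ≤ c ∧ d = (-c) • x := by
    refine ⟨t⁻¹, (one_le_inv₀ ht0).2 ht.2, ?_⟩
    rw [neg_smul, eq_neg_of_add_eq_zero_left h0, smul_neg, neg_neg, smul_smul,
      inv_mul_cancel₀ ht0.ne', one_smul]
  have hnd : ‖(-c) • x‖ = c * ‖x‖ := by
    rw [norm_smul, norm_neg, Real.norm_eq_abs, abs_of_nonneg (by linarith)]
  have hnx : ‖x + (-c) • x‖ = (c - 1) * ‖x‖ := by
    rw [show x + (-c) • x = (1 - c) • x by rw [sub_smul, one_smul, neg_smul, sub_eq_add_neg],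
      norm_smul, Real.norm_eq_abs, abs_sub_comm, abs_of_nonneg (by linarith)]
  have hterm : ∀ k ∈ Finset.range (l + 1), normPowDeriv ((-c) • x) N k x / (k ! : ℝ) =
      (N.choose k : ℝ) * (-c) ^ k * ‖x‖ ^ N := by
    intro k _
    rw [normPowDeriv_radial hx0, Nat.descFactorial_eq_factorial_mul_choose]
    push_cast
    field_simp
  have hbin : (1 - c) ^ N = ∑ k ∈ Finset.range (l + 1), (N.choose k : ℝ) * (-c) ^ k +
      ∑ k ∈ Finset.Ico (l + 1) (N + 1), (N.choose k : ℝ) * (-c) ^ k := by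
    rw [Finset.sum_range_add_sum_Ico _ (by omega), sub_eq_neg_add, add_pow]
    simp [mul_comm]
  have htail : (∑ k ∈ Finset.Ico (l + 1) (N + 1), (N.choose k : ℝ) * (-c) ^ k) * ‖x‖ ^ N ≤
      (∑ k ∈ Finset.Ico (l + 1) (N + 1), (N.choose k : ℝ)) * (c * ‖x‖) ^ (l + 1) := by
    rw [Finset.sum_mul, Finset.sum_mul]
    refine Finset.sum_le_sum fun k hk => ?_
    obtain ⟨hk1, hk2⟩ := Finset.mem_Ico.1 hk
    rw [mul_assoc]
    refine mul_le_mul_of_nonneg_left ?_ (by positivity)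
    calc (-c) ^ k * ‖x‖ ^ N ≤ c ^ k * ‖x‖ ^ N := by
          refine mul_le_mul_of_nonneg_right ((le_abs_self _).trans_eq ?_) (by positivity)
          rw [abs_pow, abs_neg, abs_of_nonneg (by linarith)]
      _ = (c * ‖x‖) ^ k * ‖x‖ ^ (N - k) := by
          rw [mul_pow, mul_assoc, ← pow_add, show k + (N - k) = N by omega]
      _ ≤ (c * ‖x‖) ^ (l + 1) * 1 := by
          exact mul_le_mul (pow_le_pow_of_le_one (by positivity) (hnd ▸ hd) hk1)
            (pow_le_one₀ (norm_nonneg _) hx) (by positivity) (by positivity)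
      _ = _ := mul_one _
  -- for odd `N` the signs of `(c - 1) ^ N` and `(1 - c) ^ N` differ, which costs one more term
  have hpow : (c - 1) ^ N * ‖x‖ ^ N ≤ (1 - c) ^ N * ‖x‖ ^ N + 2 * (c * ‖x‖) ^ (l + 1) := by
    have h1 : (c - 1) ^ N * ‖x‖ ^ N ≤ (c * ‖x‖) ^ (l + 1) := by
      rw [← mul_pow]
      calc ((c - 1) * ‖x‖) ^ N ≤ (c * ‖x‖) ^ N := by gcongr; linarith
        _ ≤ _ := pow_le_pow_of_le_one (by positivity) (hnd ▸ hd) hlN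
    have h2 : -((c - 1) ^ N * ‖x‖ ^ N) ≤ (1 - c) ^ N * ‖x‖ ^ N := by
      rw [← neg_mul]
      gcongr
      refine le_trans (le_of_eq ?_) (neg_abs_le _)
      rw [abs_pow, abs_sub_comm, abs_of_nonneg (by linarith)]
    linarith
  rw [Finset.sum_congr rfl hterm, ← Finset.sum_mul, hnx, mul_pow, hnd]
  have hch := sum_choose_le hlN (by omega : 1 ≤ l)
  have hq : (1 : ℝ) ≤ N ! / (l ! : ℝ) := by
    rw [one_le_div (by positivity)]
    exact_mod_cast Nat.factorial_le (by omega)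
  have hz : 0 ≤ (c * ‖x‖) ^ (l + 1) := by positivity
  have := mul_le_mul_of_nonneg_right hch hz
  rw [hbin, add_mul] at hpow
  nlinarith

end

/-! ### Necessary optimality conditions -/

section

variable {E : Type*} [NormedAddCommGroup E] [NormedSpace ℝ E]

lemma IsLocalMin.iteratedFDeriv_one_eq_zero {f : E → ℝ} {x : E} (h : IsLocalMin f x) (d : E) :
    iteratedFDeriv ℝ 1 f x (fun _ => d) = 0 := by
  rw [iteratedFDeriv_one_apply, h.fderiv_eq_zero, zero_apply]

/-- The second order necessary optimality condition: along `d` the Taylor expansion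
`t² f''/2 + O(t³)` of `f (x + t d) - f x` is nonnegative for all small `t`. -/
lemma IsLocalMin.iteratedFDeriv_two_nonneg {f : E → ℝ} {x : E} (h : IsLocalMin f x)
    (hf : ContDiffAt ℝ 3 f x) (d : E) : 0 ≤ iteratedFDeriv ℝ 2 f x (fun _ => d) := by
  have hline : Filter.Tendsto (fun t : ℝ => x + t • d) (𝓝 0) (𝓝 x) := by
    have : ContinuousAt (fun t : ℝ => x + t • d) 0 := by fun_prop
    simpa [ContinuousAt] using this
  have e1 : ∀ᶠ t : ℝ in 𝓝 0, ContDiffAt ℝ 3 f (x + t • d) :=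
    hline.eventually (hf.eventually (by simp))
  set C := ‖iteratedFDeriv ℝ 3 f x‖ + 1
  have e2 : ∀ᶠ t : ℝ in 𝓝 0, ‖iteratedFDeriv ℝ 3 f (x + t • d)‖ < C := by
    refine hline.eventually (p := fun y => ‖iteratedFDeriv ℝ 3 f y‖ < C) ?_
    have : ContinuousAt (iteratedFDeriv ℝ 3 f) x :=
      (hf.iteratedFDeriv_right (i := 3) (m := 0) (by norm_num)).continuousAt
    exact this.norm.eventually_lt continuousAt_const (lt_add_one _)
  have e3 : ∀ᶠ t : ℝ in 𝓝 0, f x ≤ f (x + t • d) :=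
    hline.eventually h
  obtain ⟨r, hr, hball⟩ := Metric.eventually_nhds_iff.1 (e1.and (e2.and e3))
  have hin : ∀ t : ℝ, 0 < t → t < r → ∀ u ∈ Set.Icc (0 : ℝ) 1, dist (u * t) 0 < r := by
    intro t h0 htr u hu
    rw [Real.dist_0_eq_abs, abs_of_nonneg (mul_nonneg hu.1 h0.le)]
    nlinarith [hu.1, hu.2]
  have key : ∀ t : ℝ, 0 < t → t < r →
      -(C * ‖d‖ ^ 3 * t) ≤ iteratedFDeriv ℝ 2 f x (fun _ => d) := by
    intro t h0 htr
    have hT := abs_sub_taylor_le (f := f) (x := x) (y := t • d) (n := 2)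
      (C := C * ‖t • d‖ ^ 3)
      (fun u hu => by
        rw [smul_smul]
        exact (hball (hin t h0 htr u hu)).1)
      (fun u hu => by
        rw [smul_smul, ← Real.norm_eq_abs]
        refine (ContinuousMultilinearMap.le_opNorm _ _).trans ?_
        rw [Finset.prod_const, Finset.card_fin]
        gcongr
        exact (hball (hin t h0 htr u hu)).2.1.le)
    have hhom : ∀ k : ℕ, iteratedFDeriv ℝ k f x (fun _ => t • d) =
        t ^ k * iteratedFDeriv ℝ k f x (fun _ => d) := by
      intro k
      rw [ContinuousMultilinearMap.map_smul_univ (iteratedFDeriv ℝ k f x) (fun _ => t)]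
      simp
    simp only [Finset.sum_range_succ, Finset.sum_range_zero, iteratedFDeriv_zero_apply, hhom,
      h.iteratedFDeriv_one_eq_zero d, norm_smul, Real.norm_eq_abs, abs_of_pos h0] at hT
    have h1 := (hball (by simpa using hin t h0 htr 1 (by simp))).2.2
    have h2 := (abs_le.1 hT).2
    norm_num [Nat.factorial] at h2
    have h3 : -(C * ‖d‖ ^ 3 * t) * t ^ 2 ≤ iteratedFDeriv ℝ 2 f x (fun _ => d) * t ^ 2 := by
      have : 0 ≤ C * ‖d‖ ^ 3 * t ^ 3 := by positivity
      nlinarith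
    exact le_of_mul_le_mul_right h3 (by positivity)
  have hlim : Filter.Tendsto (fun t : ℝ => -(C * ‖d‖ ^ 3 * t)) (𝓝[>] 0) (𝓝 0) := by
    have : Filter.Tendsto (fun t : ℝ => -(C * ‖d‖ ^ 3 * t)) (𝓝 0) (𝓝 (-(C * ‖d‖ ^ 3 * 0))) :=
      Continuous.tendsto (by fun_prop) 0
    rw [mul_zero, neg_zero] at this
    exact this.mono_left nhdsWithin_le_nhds
  refine le_of_tendsto hlim ?_
  filter_upwards [Ioo_mem_nhdsGT hr] with t ht using key t ht.1 ht.2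

end

noncomputable section
namespace ARqpEDA2

/-! ### Taylor decrements and the regularized model -/

variable {n : ℕ}

lemma continuous_taylorDec (D : Tensors n) (j : ℕ) : Continuous (taylorDec D j) := by
  have h : taylorDec D j = fun d => -tensorPoly D j d := rfl
  rw [h]
  exact ((contDiff_tensorPoly D j (n := 0)).continuous).neg

lemma taylorDec_zero (D : Tensors n) (j : ℕ) : taylorDec D j 0 = 0 := by
  rw [taylorDec, neg_eq_zero]
  refine Finset.sum_eq_zero fun i hi => ?_
  have : NeZero i := ⟨by have := (Finset.mem_Icc.1 hi).1; omega⟩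
  rw [(D i).map_coord_zero (0 : Fin i) rfl, zero_div]

lemma taylorDec_le_optMeasure (D : Tensors n) (j : ℕ) {δ : ℝ} {d : Vec n} (hd : ‖d‖ ≤ δ) :
    taylorDec D j d ≤ optMeasure D j δ :=
  le_csSup ((isCompact_closedBall _ _).bddAbove_image (continuous_taylorDec D j).continuousOn)
    ⟨d, by simpa using hd, rfl⟩

lemma exists_taylorDec_eq_optMeasure (D : Tensors n) (j : ℕ) {δ : ℝ} (hδ : 0 ≤ δ) :
    ∃ d, ‖d‖ ≤ δ ∧ taylorDec D j d = optMeasure D j δ := by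
  obtain ⟨d, hd, h⟩ := (isCompact_closedBall (0 : Vec n) δ).exists_sSup_image_eq
    ⟨0, by simpa using hδ⟩ (continuous_taylorDec D j).continuousOn
  exact ⟨d, by simpa using hd, h.symm⟩

lemma optMeasure_le {D : Tensors n} {j : ℕ} {δ B : ℝ} (hδ : 0 ≤ δ)
    (h : ∀ d, ‖d‖ ≤ δ → taylorDec D j d ≤ B) : optMeasure D j δ ≤ B := by
  obtain ⟨d, hd, hd'⟩ := exists_taylorDec_eq_optMeasure D j hδ
  exact hd' ▸ h d hd

lemma optMeasure_nonneg (D : Tensors n) (j : ℕ) {δ : ℝ} (hδ : 0 ≤ δ) : 0 ≤ optMeasure D j δ :=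
  (taylorDec_zero D j).symm.le.trans (taylorDec_le_optMeasure D j (by simpa using hδ))

/-- Decrements built from close tensors are close. -/
lemma abs_taylorDec_sub_le {D D' : Tensors n} {j : ℕ} {d : Vec n} {a : ℕ → ℝ}
    (h : ∀ i ∈ Finset.Icc 1 j, |D i (fun _ => d) - D' i (fun _ => d)| ≤ a i) :
    |taylorDec D j d - taylorDec D' j d| ≤ ∑ i ∈ Finset.Icc 1 j, a i / (i ! : ℝ) := by
  rw [taylorDec, taylorDec, neg_sub_neg, ← Finset.sum_sub_distrib]
  refine (Finset.abs_sum_le_sum_abs _ _).trans (Finset.sum_le_sum fun i hi => ?_)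
  rw [← sub_div, abs_div, abs_sub_comm, abs_of_nonneg (by positivity : (0 : ℝ) ≤ (i ! : ℝ))]
  gcongr
  exact h i hi

lemma abs_apply_diag_le {i : ℕ} (T : ContinuousMultilinearMap ℝ (fun _ : Fin i => Vec n) ℝ)
    {B r : ℝ} (hT : ‖T‖ ≤ B) {d : Vec n} (hd : ‖d‖ ≤ r) : |T (fun _ => d)| ≤ B * r ^ i := by
  rw [← Real.norm_eq_abs]
  refine (T.le_opNorm _).trans ?_
  rw [Finset.prod_const, Finset.card_fin]
  have := (norm_nonneg T).trans hT
  gcongr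

lemma abs_taylorDec_sub_le_of_norm {D D' : Tensors n} {j : ℕ} {d : Vec n} {a : ℕ → ℝ} {r : ℝ}
    (h : ∀ i ∈ Finset.Icc 1 j, ‖D i - D' i‖ ≤ a i) (hd : ‖d‖ ≤ r) :
    |taylorDec D j d - taylorDec D' j d| ≤ ∑ i ∈ Finset.Icc 1 j, a i * r ^ i / (i ! : ℝ) :=
  abs_taylorDec_sub_le fun i hi => abs_apply_diag_le (D i - D' i) (h i hi) hd

lemma model_eq (p : ℕ) (D : Tensors n) (σ : ℝ) (s : Vec n) :
    model p D σ s = tensorPoly D p s + σ / ((p + 1)! : ℝ) * ‖s‖ ^ (p + 1) := rfl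

lemma tensorPoly_eq_neg_taylorDec (p : ℕ) (D : Tensors n) (s : Vec n) :
    tensorPoly D p s = -taylorDec D p s := by rw [taylorDec, neg_neg]; rfl

lemma model_zero (p : ℕ) (D : Tensors n) (σ : ℝ) : model p D σ 0 = 0 := by
  rw [model_eq, tensorPoly_eq_neg_taylorDec, taylorDec_zero]; simp

lemma modelDec_eq (p : ℕ) (D : Tensors n) (σ : ℝ) (s : Vec n) :
    modelDec p D σ s = taylorDec D p s - σ / ((p + 1)! : ℝ) * ‖s‖ ^ (p + 1) := by
  rw [modelDec, model_zero, model_eq, tensorPoly_eq_neg_taylorDec]; ring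

lemma continuous_model (p : ℕ) (D : Tensors n) (σ : ℝ) : Continuous (model p D σ) :=
  ((contDiff_tensorPoly D p (n := 0)).continuous).add
    (continuous_const.mul (continuous_norm.pow _))

lemma contDiffAt_model (p : ℕ) (D : Tensors n) (σ : ℝ) {s : Vec n} (hs : s ≠ 0)
    {m : WithTop ℕ∞} : ContDiffAt ℝ m (model p D σ) s :=
  (contDiff_tensorPoly D p).contDiffAt.add
    (contDiffAt_const.mul (contDiffAt_norm_pow (p + 1) hs))

lemma iteratedFDeriv_model (p : ℕ) (D : Tensors n) (σ : ℝ) {s : Vec n} (hs : s ≠ 0) (k : ℕ)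
    (d : Vec n) :
    iteratedFDeriv ℝ k (model p D σ) s (fun _ => d) =
      iteratedFDeriv ℝ k (tensorPoly D p) s (fun _ => d) +
        σ / ((p + 1)! : ℝ) * normPowDeriv d (p + 1) k s := by
  have h : model p D σ =
      fun s => tensorPoly D p s + (σ / ((p + 1)! : ℝ)) • ‖s‖ ^ (p + 1) := rfl
  have hn : ContDiffAt ℝ k (fun x : Vec n => ‖x‖ ^ (p + 1)) s := contDiffAt_norm_pow (p + 1) hs
  have hn' : ContDiffAt ℝ k (fun s : Vec n => (σ / ((p + 1)! : ℝ)) • ‖s‖ ^ (p + 1)) s :=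
    hn.const_smul _
  rw [h, fun_iteratedFDeriv_add_apply (contDiff_tensorPoly D p).contDiffAt hn']
  have h2 : iteratedFDeriv ℝ k (fun s : Vec n => (σ / ((p + 1)! : ℝ)) • ‖s‖ ^ (p + 1)) s =
      (σ / ((p + 1)! : ℝ)) • iteratedFDeriv ℝ k (fun s : Vec n => ‖s‖ ^ (p + 1)) s :=
    iteratedFDeriv_const_smul_apply (a := σ / ((p + 1)! : ℝ)) (f := fun s : Vec n => ‖s‖ ^ (p + 1))
      hn
  rw [h2]
  rfl

/-- The regularized model attains its minimum, since the regularization has a higher degree than the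
polynomial. -/
lemma exists_forall_model_le (p : ℕ) (D : Tensors n) {σ : ℝ} (hσ : 0 < σ) :
    ∃ s, ∀ y, model p D σ s ≤ model p D σ y := by
  refine (continuous_model p D σ).exists_forall_le' 0 ?_
  set B := ∑ i ∈ Finset.Icc 1 p, ‖D i‖ with hB
  have hB0 : 0 ≤ B := Finset.sum_nonneg fun _ _ => norm_nonneg _
  set c := σ / ((p + 1)! : ℝ) with hc
  have hc0 : 0 < c := by positivity
  have hev : ∀ᶠ y : Vec n in Filter.cocompact (Vec n), max 1 (B / c) ≤ ‖y‖ :=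
    tendsto_norm_cocompact_atTop.eventually_ge_atTop _
  filter_upwards [hev] with y hy
  have hy1 : 1 ≤ ‖y‖ := (le_max_left _ _).trans hy
  have hy2 : B ≤ c * ‖y‖ := by
    have := (le_max_right _ _).trans hy
    rwa [div_le_iff₀' hc0] at this
  rw [model_zero, model_eq]
  have h1 : |tensorPoly D p y| ≤ B * ‖y‖ ^ p := by
    rw [tensorPoly, hB, Finset.sum_mul]
    refine (Finset.abs_sum_le_sum_abs _ _).trans (Finset.sum_le_sum fun i hi => ?_)
    have hi1 : (1 : ℝ) ≤ (i ! : ℝ) := by exact_mod_cast i.factorial_pos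
    rw [abs_div, abs_of_nonneg (by positivity : (0 : ℝ) ≤ (i ! : ℝ))]
    refine (div_le_self (abs_nonneg _) hi1).trans ((abs_apply_diag_le (D i) le_rfl le_rfl).trans ?_)
    gcongr
    exact (Finset.mem_Icc.1 hi).2
  have h2 : B * ‖y‖ ^ p ≤ c * ‖y‖ ^ (p + 1) := by
    calc _ ≤ c * ‖y‖ * ‖y‖ ^ p := by gcongr
      _ = _ := by ring
  have := (abs_le.1 h1).1
  linarith

lemma sum_range_succ_eq_taylorDec (g : Vec n → ℝ) (l : ℕ) (s d : Vec n) :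
    ∑ k ∈ Finset.range (l + 1), iteratedFDeriv ℝ k g s (fun _ => d) / (k ! : ℝ) =
      g s - taylorDec (exactTensors g s) l d := by
  rw [Finset.range_eq_Ico, Finset.sum_eq_sum_Ico_succ_bot (by omega), taylorDec, sub_neg_eq_add]
  simp only [iteratedFDeriv_zero_apply, Nat.factorial_zero, Nat.cast_one, div_one, zero_add]
  rfl

/-- At a minimizer of the model, the Taylor decrements of the model are of higher order in the
radius. The constant does not involve the dimension. -/
lemma phi_model_le_of_isMin {p l : ℕ} {D : Tensors n} {σ B δ : ℝ} {s : Vec n}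
    (hmin : ∀ y, model p D σ s ≤ model p D σ y) (hs0 : s ≠ 0) (hs : ‖s‖ ≤ 1) (hσ : 0 ≤ σ)
    (hB : 0 ≤ B) (hD : ∀ i ∈ Finset.Icc (l + 1) p, ‖D i‖ ≤ B) (hl : 2 ≤ l) (hlp : l ≤ p)
    (hδ : 0 ≤ δ) (hδ1 : δ ≤ 1) :
    phi (model p D σ) l δ s ≤ 4 * (3 * B + σ) * (δ ^ (l + 1) / (l ! : ℝ)) := by
  refine optMeasure_le hδ fun d hd => ?_
  have hd1 : ‖d‖ ≤ 1 := hd.trans hδ1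
  -- the polynomial part
  have h1 : |tensorPoly D p (s + d) - ∑ k ∈ Finset.range (l + 1),
      iteratedFDeriv ℝ k (tensorPoly D p) s (fun _ => d) / (k ! : ℝ)| ≤
      9 * B * ‖d‖ ^ (l + 1) / ((l + 1)! : ℝ) := by
    refine abs_sub_taylor_le (fun t _ => (contDiff_tensorPoly D p).contDiffAt) fun t ht => ?_
    refine abs_apply_diag_le _ ?_ le_rfl
    refine (norm_iteratedFDeriv_tensorPoly_le D hB (by omega) hD _).trans ?_
    rw [mul_comm]
    gcongr
    have h2 : ‖s + t • d‖ ≤ 2 := by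
      refine (norm_add_le _ _).trans ?_
      rw [norm_smul, Real.norm_eq_abs, abs_of_nonneg ht.1]
      nlinarith [ht.1, ht.2, norm_nonneg d]
    calc Real.exp ‖s + t • d‖ ≤ Real.exp (1 + 1) := Real.exp_le_exp.2 (by linarith)
      _ = Real.exp 1 * Real.exp 1 := Real.exp_add _ _
      _ ≤ 9 := by nlinarith [Real.exp_one_lt_d9, Real.exp_pos 1]
  -- the regularization
  have h2 := norm_pow_sub_taylor_le (d := d) (N := p + 1) hs0 (by omega) hs hd1 hl
  have hsum := sum_range_succ_eq_taylorDec (model p D σ) l s d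
  simp only [iteratedFDeriv_model p D σ hs0] at hsum
  have hsplit : ∑ k ∈ Finset.range (l + 1), (iteratedFDeriv ℝ k (tensorPoly D p) s (fun _ => d) +
      σ / ((p + 1)! : ℝ) * normPowDeriv d (p + 1) k s) / (k ! : ℝ) =
      ∑ k ∈ Finset.range (l + 1),
        iteratedFDeriv ℝ k (tensorPoly D p) s (fun _ => d) / (k ! : ℝ) +
      σ / ((p + 1)! : ℝ) *
        ∑ k ∈ Finset.range (l + 1), normPowDeriv d (p + 1) k s / (k ! : ℝ) := by
    rw [Finset.mul_sum, ← Finset.sum_add_distrib]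
    refine Finset.sum_congr rfl fun k _ => ?_
    ring
  rw [hsplit] at hsum
  have hm := hmin (s + d)
  rw [model_eq p D σ (s + d)] at hm
  have h3 := (abs_le.1 h1).2
  have h4 := mul_le_mul_of_nonneg_left h2 (by positivity : 0 ≤ σ / ((p + 1)! : ℝ))
  have h5 : σ / ((p + 1)! : ℝ) * (4 * ((p + 1)! / (l ! : ℝ)) * ‖d‖ ^ (l + 1)) =
      4 * σ * (‖d‖ ^ (l + 1) / (l ! : ℝ)) := by field_simp
  have h6 : 9 * B * ‖d‖ ^ (l + 1) / ((l + 1)! : ℝ) ≤ 12 * B * (‖d‖ ^ (l + 1) / (l ! : ℝ)) := by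
    rw [mul_div_assoc]
    gcongr
    · norm_num
    · omega
  have h7 : ‖d‖ ^ (l + 1) / (l ! : ℝ) ≤ δ ^ (l + 1) / (l ! : ℝ) := by gcongr
  have h8 : 0 ≤ 4 * (3 * B + σ) := by positivity
  have h9 := mul_le_mul_of_nonneg_left h7 h8
  rw [h5] at h4
  nlinarith

/-- At a minimizer of the model, the Taylor decrements of orders one and two are nonpositive: this
is why radii equal to one are admissible for these orders. -/
lemma phi_model_nonpos_of_isMin {p l : ℕ} {D : Tensors n} {σ δ : ℝ} {s : Vec n}
    (hmin : ∀ y, model p D σ s ≤ model p D σ y) (hs0 : s ≠ 0) (hl : l ≤ 2) (hδ : 0 ≤ δ) :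
    phi (model p D σ) l δ s ≤ 0 := by
  refine optMeasure_le hδ fun d _ => ?_
  have hloc : IsLocalMin (model p D σ) s := Filter.Eventually.of_forall hmin
  have h1 := hloc.iteratedFDeriv_one_eq_zero d
  have h2 := hloc.iteratedFDeriv_two_nonneg (contDiffAt_model p D σ hs0) d
  rw [taylorDec, neg_nonpos]
  refine Finset.sum_nonneg fun i hi => ?_
  obtain ⟨hi1, hi2⟩ := Finset.mem_Icc.1 hi
  obtain rfl | rfl : i = 1 ∨ i = 2 := by omega
  · exact div_nonneg h1.ge (by positivity)
  · exact div_nonneg h2 (by positivity)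

/-- The derivatives of `f` at `x + s` and of the exact model at `s` are close; the second part of
the constant accounts for the regularization. -/
lemma abs_iteratedFDeriv_sub_model_le {f : Vec n → ℝ} {p : ℕ} {L σ : ℝ} (hp : 1 ≤ p)
    (hf : ContDiff ℝ p f) (x : Vec n)
    (hL : ∀ y, ‖iteratedFDeriv ℝ p f y - iteratedFDeriv ℝ p f x‖ ≤ L * ‖y - x‖) (hσ : 0 ≤ σ)
    {i : ℕ} (hi : 1 ≤ i) (hip : i ≤ p) {s : Vec n} (hs : s ≠ 0) (d : Vec n) :
    |iteratedFDeriv ℝ i f (x + s) (fun _ => d) -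
      iteratedFDeriv ℝ i (model p (exactTensors f x) σ) s (fun _ => d)| ≤
      (L + (p + 2) * σ) * ‖s‖ ^ (p + 1 - i) * ‖d‖ ^ i := by
  rw [iteratedFDeriv_model _ _ _ hs]
  have h1 : ‖iteratedFDeriv ℝ i (fun s => f (x + s) -
      (f x + tensorPoly (exactTensors f x) p s)) s‖ ≤ L * ‖s‖ ^ (p + 1 - i) :=
    norm_iteratedFDeriv_sub_tensorPoly_le hp hf x hL hip s
  have hip' : (i : WithTop ℕ∞) ≤ p := by exact_mod_cast hip
  have hfx : ContDiffAt ℝ i (fun s => f (x + s)) s :=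
    ((hf.of_le hip').comp (contDiff_const.add contDiff_id)).contDiffAt
  have hcT : ContDiffAt ℝ i (fun s => f x + tensorPoly (exactTensors f x) p s) s :=
    (contDiff_const.add (contDiff_tensorPoly _ p)).contDiffAt
  rw [fun_iteratedFDeriv_sub_apply hfx hcT,
    iteratedFDeriv_comp_add_left, fun_iteratedFDeriv_add_apply contDiff_const.contDiffAt
        (contDiff_tensorPoly _ p).contDiffAt, iteratedFDeriv_const_of_ne (by omega)] at h1
  simp only [Pi.zero_apply, zero_add] at h1
  have h2 := abs_apply_diag_le _ h1 (le_refl ‖d‖)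
  have h3 := abs_normPowDeriv_le (d := d) (N := p + 1) (k := i) hs (by omega)
  have h4 : |σ / ((p + 1)! : ℝ) * normPowDeriv d (p + 1) i s| ≤
      (p + 2) * σ * ‖s‖ ^ (p + 1 - i) * ‖d‖ ^ i := by
    rw [abs_mul, abs_of_nonneg (by positivity : 0 ≤ σ / ((p + 1)! : ℝ))]
    have hdf : ((p + 1).descFactorial i : ℝ) ≤ ((p + 1)! : ℝ) := by
      have := Nat.factorial_mul_descFactorial (show i ≤ p + 1 by omega)
      exact_mod_cast this ▸ Nat.le_mul_of_pos_left _ (Nat.factorial_pos _)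
    calc _ ≤ σ / ((p + 1)! : ℝ) * (((p + 1 : ℕ) + 1) * ((p + 1)! : ℝ) *
          ‖s‖ ^ (p + 1 - i) * ‖d‖ ^ i) := by
          gcongr
          exact h3.trans (by gcongr)
      _ = _ := by push_cast; field_simp; ring
  have h5 : ∀ a b c : ℝ, |a - (b + c)| ≤ |a - b| + |c| := fun a b c => by
    rw [← sub_sub]; exact abs_sub _ _
  refine (h5 _ _ _).trans ((add_le_add h2 h4).trans_eq ?_)
  ring

lemma abs_sub_taylorDec_le {f : Vec n → ℝ} {p : ℕ} {L : ℝ} (hp : 1 ≤ p)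
    (hf : ContDiff ℝ p f) (x : Vec n)
    (hL : ∀ y, ‖iteratedFDeriv ℝ p f y - iteratedFDeriv ℝ p f x‖ ≤ L * ‖y - x‖) (s : Vec n) :
    |f x - f (x + s) - taylorDec (exactTensors f x) p s| ≤ L * ‖s‖ ^ (p + 1) := by
  have h1 := norm_iteratedFDeriv_sub_tensorPoly_le hp hf x hL (Nat.zero_le p) s
  rw [norm_iteratedFDeriv_zero, Nat.sub_zero, Real.norm_eq_abs, abs_sub_comm] at h1
  have h2 : tensorPoly (fun i => iteratedFDeriv ℝ i f x) p s =
    -taylorDec (exactTensors f x) p s := tensorPoly_eq_neg_taylorDec _ _ _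
  rw [h2] at h1
  convert h1 using 2
  ring

/-- Errors on the tensors at the origin of the model are carried over to its derivatives at a
point of the unit ball. -/
lemma abs_iteratedFDeriv_model_sub_le {p : ℕ} {D D' : Tensors n} {σ a : ℝ} {i : ℕ} (hi : 1 ≤ i)
    (ha : 0 ≤ a) (h : ∀ t ∈ Finset.Icc i p, ‖D t - D' t‖ ≤ a) {s : Vec n} (hs0 : s ≠ 0)
    (hs : ‖s‖ ≤ 1) {d : Vec n} {r : ℝ} (hd : ‖d‖ ≤ r) :
    |iteratedFDeriv ℝ i (model p D σ) s (fun _ => d) -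
      iteratedFDeriv ℝ i (model p D' σ) s (fun _ => d)| ≤ 3 * a * r ^ i := by
  rw [iteratedFDeriv_model _ _ _ hs0, iteratedFDeriv_model _ _ _ hs0, add_sub_add_right_eq_sub]
  have h1 := norm_iteratedFDeriv_tensorPoly_le (D - D') ha hi h s
  have h2 : tensorPoly (D - D') p = fun s => tensorPoly D p s - tensorPoly D' p s := by
    funext s
    rw [tensorPoly, tensorPoly, tensorPoly, ← Finset.sum_sub_distrib]
    exact Finset.sum_congr rfl fun i _ => sub_div _ _ _
  rw [h2, fun_iteratedFDeriv_sub_apply (contDiff_tensorPoly D p).contDiffAt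
    (contDiff_tensorPoly D' p).contDiffAt] at h1
  refine abs_apply_diag_le _ (h1.trans ?_) hd
  rw [mul_comm]
  gcongr
  exact (Real.exp_le_exp.2 hs).trans (by linarith [Real.exp_one_lt_d9])

end ARqpEDA2
end

noncomputable section
namespace ARqpEDA2

/-! ### Constants of the analysis -/

/-- The standing hypotheses on the input of the algorithm. -/
structure Input.Good {n : ℕ} (I : Input n) (flow : ℝ) : Prop where
  one_le_q : 1 ≤ I.q
  q_le_p : I.q ≤ I.p
  valid : I.P.Valid
  one_le_L : ∀ j ≤ I.p, 1 ≤ I.L j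
  assumptions : I.Assumptions flow

namespace Params.Valid

variable {P : Params} (h : P.Valid)
include h

lemma two_ω_lt_η₁ : 2 * P.ω < P.η₁ := by
  have := h.ω_lt.trans_le (min_le_left _ _); linarith

lemma four_ω_lt : 4 * P.ω < 1 - P.η₂ := by
  have := h.ω_lt.trans_le (min_le_right _ _); linarith

lemma ω_lt_half : P.ω < 1 / 2 := by
  have := h.two_ω_lt_η₁; linarith [h.η₁_le, h.η₂_lt]

lemma θ_lt_two : P.θ < 2 := by
  have h1 := h.θ_lt
  have : P.θ * 1 ≤ P.θ * (1 + P.ω * P.ς) := by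
    have := mul_pos h.ω_pos h.ς_pos
    exact mul_le_mul_of_nonneg_left (by linarith) h.θ_pos.le
  linarith [h.ς_le]

end Params.Valid

/-- An upper bound for the regularization parameters generated by the algorithm: iterations with a
parameter above `4 L_p (p + 1)! / (1 - η₂)` do not increase it, the others increase it by at most
the factor `γ₃`. -/
def sigmaMax (P : Params) (p : ℕ) (L : ℕ → ℝ) : ℝ :=
  max P.σ₀ (P.γ₃ * (4 * L p * (p + 1)! / (1 - P.η₂)))

/-- The ratio of the radii to the tolerances never falls below this value of `κ_δ`. -/
def radiusRatio (P : Params) (p : ℕ) (L : ℕ → ℝ) : ℝ :=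
  P.ς * P.θ * (1 - P.ω) /
    (8 * (1 + P.ω) * (3 * (sSup (L '' Set.Icc 0 p) + P.accMax) + sigmaMax P p L))

/-- The tensors of `c` have the accuracy that `c.acc` promises. -/
def Input.TensorsOK {n : ℕ} (I : Input n) (c : Config n) : Prop :=
  ∀ i ∈ Finset.Icc 1 I.p, ‖c.D i - iteratedFDeriv ℝ i I.f c.x‖ ≤ c.acc i

variable {n : ℕ} {I : Input n} {flow : ℝ} {c : Config n}

lemma Input.L_le_Lbar (I : Input n) {j : ℕ} (hj : j ≤ I.p) : I.L j + I.P.accMax ≤ I.Lbar := by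
  have : I.L j ≤ sSup (I.L '' Set.Icc 0 I.p) :=
    le_csSup ((Set.finite_Icc 0 I.p).image I.L).bddAbove ⟨j, ⟨Nat.zero_le _, hj⟩, rfl⟩
  rw [Input.Lbar]; linarith

lemma Input.radiusRatio_eq (I : Input n) : radiusRatio I.P I.p I.L = I.P.ς * I.P.θ * (1 - I.P.ω) /
    (8 * (1 + I.P.ω) * (3 * I.Lbar + sigmaMax I.P I.p I.L)) := rfl

namespace Input.Good

variable (h : I.Good flow)
include h

lemma one_le_p : 1 ≤ I.p := h.one_le_q.trans h.q_le_p

lemma one_le_Lbar : 1 ≤ I.Lbar := by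
  have := I.L_le_Lbar (Nat.zero_le _)
  linarith [h.one_le_L 0 (Nat.zero_le _), h.valid.accMax_nonneg]

lemma sigmaMax_pos : 0 < sigmaMax I.P I.p I.L :=
  (h.valid.σmin_pos.trans_le h.valid.σmin_le).trans_le (le_max_left _ _)

lemma kappaDelta_pos {σ : ℝ} (hσ : 0 ≤ σ) : 0 < I.kappaDelta σ := by
  have h1 := h.one_le_Lbar
  have h2 := h.valid.ω_lt_half
  have := h.valid.ς_pos
  have := h.valid.θ_pos
  have := h.valid.ω_pos
  have : 0 < 1 - I.P.ω := by linarith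
  rw [Input.kappaDelta]
  positivity

lemma kappaDelta_mul {σ : ℝ} (hσ : 0 ≤ σ) :
    8 * (1 + I.P.ω) * (3 * I.Lbar + σ) * I.kappaDelta σ = I.P.ς * I.P.θ * (1 - I.P.ω) := by
  have h1 := h.one_le_Lbar
  have := h.valid.ω_pos
  rw [Input.kappaDelta]
  field_simp

lemma kappaDelta_le_one {σ : ℝ} (hσ : 0 ≤ σ) : I.kappaDelta σ ≤ 1 := by
  have h1 := h.one_le_Lbar
  have h3 := h.valid.ω_pos
  rw [Input.kappaDelta, div_le_one (by positivity)]
  have h2 := h.valid.ω_lt_half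
  have h4 : I.P.ς * I.P.θ ≤ 1 * 2 :=
    mul_le_mul h.valid.ς_le h.valid.θ_lt_two.le h.valid.θ_pos.le zero_le_one
  have h5 : I.P.ς * I.P.θ * (1 - I.P.ω) ≤ 2 * 1 :=
    mul_le_mul (by linarith) (by linarith) (by linarith) (by norm_num)
  nlinarith

lemma radiusRatio_pos : 0 < radiusRatio I.P I.p I.L := h.kappaDelta_pos h.sigmaMax_pos.le

lemma radiusRatio_le_one : radiusRatio I.P I.p I.L ≤ 1 := h.kappaDelta_le_one h.sigmaMax_pos.le

lemma radiusRatio_le_kappaDelta {σ : ℝ} (hσ : 0 ≤ σ) (hσ' : σ ≤ sigmaMax I.P I.p I.L) :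
    radiusRatio I.P I.p I.L ≤ I.kappaDelta σ := by
  have h1 := h.one_le_Lbar
  have h2 := h.valid.ω_lt_half
  have := h.valid.ς_pos
  have := h.valid.θ_pos
  have := h.valid.ω_pos
  have : 0 < 1 - I.P.ω := by linarith
  rw [I.radiusRatio_eq, Input.kappaDelta]
  gcongr

lemma norm_iteratedFDeriv_le {i : ℕ} (hi : i ∈ Finset.Icc 1 I.p) (x : Vec n) :
    ‖iteratedFDeriv ℝ i I.f x‖ ≤ I.L (i - 1) := by
  obtain ⟨hi1, hi2⟩ := Finset.mem_Icc.1 hi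
  obtain ⟨j, rfl⟩ := Nat.exists_eq_add_of_le' hi1
  rw [← norm_fderiv_iteratedFDeriv, Nat.add_sub_cancel]
  have hL := h.one_le_L j (by omega)
  refine norm_fderiv_le_of_lip' ℝ (by linarith) (Filter.Eventually.of_forall fun y => ?_)
  exact h.assumptions.lipschitz j (by omega) y x

lemma norm_tensor_le (hD : I.TensorsOK c) (hacc : ∀ i ∈ Finset.Icc 1 I.p, c.acc i ≤ I.P.accMax)
    {i : ℕ} (hi : i ∈ Finset.Icc 1 I.p) : ‖c.D i‖ ≤ I.Lbar := by
  have h1 := h.norm_iteratedFDeriv_le hi c.x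
  have h2 := (hD i hi).trans (hacc i hi)
  have h3 := I.L_le_Lbar (j := i - 1) (by have := (Finset.mem_Icc.1 hi).2; omega)
  have h4 := norm_le_norm_sub_add (c.D i) (iteratedFDeriv ℝ i I.f c.x)
  linarith

end Input.Good

/-! ### The tests of optimality of the current point -/

lemma check_ne_insufficient {ω δ dT ξ : ℝ} {acc : ℕ → ℝ} {r : ℕ}
    (h : check ω δ dT acc r ξ ≠ .insufficient) :
    (0 < dT ∧ ∑ i ∈ Finset.Icc 1 r, acc i * δ ^ i / (i ! : ℝ) ≤ ω * dT) ∨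
      ∑ i ∈ Finset.Icc 1 r, acc i * δ ^ i / (i ! : ℝ) ≤ ω * ξ * (δ ^ r / (r ! : ℝ)) := by
  by_contra hc
  push Not at hc
  refine h ?_
  rw [check, if_neg (fun h' => (hc.1 h'.1).not_ge h'.2), if_neg hc.2.not_ge]

lemma check_eq_insufficient {ω δ dT ξ : ℝ} {acc : ℕ → ℝ} {r : ℕ}
    (h : check ω δ dT acc r ξ = .insufficient) :
    ¬ (0 < dT ∧ ∑ i ∈ Finset.Icc 1 r, acc i * δ ^ i / (i ! : ℝ) ≤ ω * dT) ∧
      ¬ ∑ i ∈ Finset.Icc 1 r, acc i * δ ^ i / (i ! : ℝ) ≤ ω * ξ * (δ ^ r / (r ! : ℝ)) := by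
  rw [check] at h
  split_ifs at h with h1 h2
  exact ⟨h1, h2⟩

lemma Input.TensorsOK.abs_taylorDec_sub_le (hD : I.TensorsOK c) {j : ℕ} (hj : j ≤ I.p) {d : Vec n}
    {r : ℝ} (hd : ‖d‖ ≤ r) :
    |taylorDec c.D j d - taylorDec (exactTensors I.f c.x) j d| ≤
      ∑ i ∈ Finset.Icc 1 j, c.acc i * r ^ i / (i ! : ℝ) :=
  abs_taylorDec_sub_le_of_norm (fun i hi => hD i (Finset.Icc_subset_Icc_right hj hi)) hd

namespace Input.Good

variable (h : I.Good flow)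
include h

/-- A sufficiently accurate and small Taylor decrement certifies approximate optimality of the true
`f`. -/
lemma phi_le_of_small (hD : I.TensorsOK c) {j : ℕ} (hj : j ∈ Finset.Icc 1 I.q) (hδ : 0 < c.δ j)
    {d : Vec n} (hd : I.Displacement c j d) (h1 : I.check1 c j d ≠ .insufficient)
    (h2 : I.Small c j d) : phi I.f j (c.δ j) c.x ≤ I.ε j * c.δ j ^ j / (j ! : ℝ) := by
  have hjp : j ≤ I.p := (Finset.mem_Icc.1 hj).2.trans h.q_le_p
  have hε := h.assumptions.eps j hj
  have hω := h.valid.ω_pos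
  have hς := h.valid.ς_pos
  have hω2 := h.valid.ω_lt_half
  set r := c.δ j ^ j / (j ! : ℝ) with hr
  have hr0 : 0 < r := by positivity
  rw [mul_div_assoc, ← hr]
  refine optMeasure_le hδ.le fun y hy => ?_
  have e1 := (abs_le.1 (hD.abs_taylorDec_sub_le hjp hy)).1
  have e2 : I.P.ς * taylorDec c.D j y ≤ taylorDec c.D j d :=
    (mul_le_mul_of_nonneg_left (taylorDec_le_optMeasure c.D j hy) hς.le).trans hd.2
  set S := ∑ i ∈ Finset.Icc 1 j, c.acc i * c.δ j ^ i / (i ! : ℝ)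
  have h2' : taylorDec c.D j d * (1 + I.P.ω) ≤ I.P.ς * I.ε j * r := by
    have h3 : taylorDec c.D j d ≤ I.P.ς * I.ε j / (1 + I.P.ω) * r := h2
    calc _ ≤ I.P.ς * I.ε j / (1 + I.P.ω) * r * (1 + I.P.ω) := by gcongr
      _ = _ := by field_simp
  refine le_of_mul_le_mul_left (a := I.P.ς) ?_ hς
  have e3 : I.P.ς * taylorDec (exactTensors I.f c.x) j y ≤ taylorDec c.D j d + I.P.ς * S := by
    nlinarith
  refine e3.trans ?_
  rcases check_ne_insufficient h1 with ⟨hpos, hS⟩ | hS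
  · have e4 : I.P.ς * S ≤ 1 * (I.P.ω * taylorDec c.D j d) := by
      have : 0 ≤ I.P.ω * taylorDec c.D j d := by positivity
      have h5 : I.P.ς * S ≤ I.P.ς * (I.P.ω * taylorDec c.D j d) :=
        mul_le_mul_of_nonneg_left hS hς.le
      exact h5.trans (mul_le_mul_of_nonneg_right h.valid.ς_le this)
    nlinarith
  · have e4 : S ≤ I.P.ω * I.P.ς * I.ε j / 2 * r := by
      refine hS.trans_eq ?_; rw [← hr]; ring
    have e5 : taylorDec c.D j d ≤ I.P.ς * I.ε j * r * (1 - I.P.ω / 2) := by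
      have h6 : (I.P.ς * I.ε j * r) * 1 ≤
          (I.P.ς * I.ε j * r) * ((1 - I.P.ω / 2) * (1 + I.P.ω)) := by
        have : 0 ≤ I.P.ς * I.ε j * r := by have := hε.1; positivity
        refine mul_le_mul_of_nonneg_left ?_ this
        nlinarith
      refine le_of_mul_le_mul_right (a := 1 + I.P.ω) ?_ (by linarith)
      linarith
    have e6 : I.P.ς * S ≤ 1 * (I.P.ω * I.P.ς * I.ε j / 2 * r) := by
      have : 0 ≤ I.P.ω * I.P.ς * I.ε j / 2 * r := by have := hε.1; positivity
      have h5 := mul_le_mul_of_nonneg_left e4 hς.le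
      exact h5.trans (mul_le_mul_of_nonneg_right h.valid.ς_le this)
    linarith

/-- A sufficiently accurate Taylor decrement that is not small shows that the optimality measure of
the true `f` is large. -/
lemma le_phi_of_not_small (hD : I.TensorsOK c) {j : ℕ} (hj : j ∈ Finset.Icc 1 I.q)
    (hδ : 0 < c.δ j) {d : Vec n} (hd : I.Displacement c j d)
    (h1 : I.check1 c j d ≠ .insufficient) (h2 : ¬ I.Small c j d) :
    I.P.ς * (1 - I.P.ω) / (1 + I.P.ω) * I.ε j * (c.δ j ^ j / (j ! : ℝ)) ≤
      phi I.f j (c.δ j) c.x := by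
  have hjp : j ≤ I.p := (Finset.mem_Icc.1 hj).2.trans h.q_le_p
  have hε := (h.assumptions.eps j hj).1
  have hω := h.valid.ω_pos
  have hς := h.valid.ς_pos
  have hω2 := h.valid.ω_lt_half
  refine le_trans ?_ (taylorDec_le_optMeasure _ j hd.1)
  set r := c.δ j ^ j / (j ! : ℝ) with hr
  have hr0 : 0 < r := by positivity
  have e1 := (abs_le.1 (hD.abs_taylorDec_sub_le hjp hd.1)).2
  set S := ∑ i ∈ Finset.Icc 1 j, c.acc i * c.δ j ^ i / (i ! : ℝ)
  have e2 : I.P.ς * I.ε j / (1 + I.P.ω) * r < taylorDec c.D j d := not_le.1 h2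
  have e3 : S ≤ I.P.ω * taylorDec c.D j d := by
    rcases check_ne_insufficient h1 with ⟨_, hS⟩ | hS
    · exact hS
    · refine hS.trans ?_
      rw [mul_assoc]
      refine mul_le_mul_of_nonneg_left (le_trans ?_ e2.le) hω.le
      refine mul_le_mul_of_nonneg_right ?_ hr0.le
      exact div_le_div_of_nonneg_left (by positivity) (by linarith) (by linarith)
  calc _ = (1 - I.P.ω) * (I.P.ς * I.ε j / (1 + I.P.ω) * r) := by ring
    _ ≤ (1 - I.P.ω) * taylorDec c.D j d := mul_le_mul_of_nonneg_left e2.le (by linarith)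
    _ ≤ _ := by linarith

/-- When the radius is small, a large Taylor decrement forces a large model decrease: the terms of
higher degree and the regularization carry one more power of the radius. So radii are never halved
below `radiusRatio * ε_j`. -/
lemma big_of_not_small (hD : I.TensorsOK c)
    (hacc : ∀ i ∈ Finset.Icc 1 I.p, c.acc i ≤ I.P.accMax)
    (hσ' : c.σ ≤ sigmaMax I.P I.p I.L) {j : ℕ} (hj : j ∈ Finset.Icc 1 I.q)
    (hδ : 0 < c.δ j) (hδ1 : c.δ j ≤ 1) (hδr : c.δ j ≤ 2 * (radiusRatio I.P I.p I.L * I.ε j))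
    {d : Vec n} (hd : ‖d‖ ≤ c.δ j) (h2 : ¬ I.Small c j d) : I.Big c j d := by
  have hjp : j ≤ I.p := (Finset.mem_Icc.1 hj).2.trans h.q_le_p
  have hj1 := (Finset.mem_Icc.1 hj).1
  have hε := (h.assumptions.eps j hj).1
  have hω := h.valid.ω_pos
  have hς := h.valid.ς_pos
  have hω2 := h.valid.ω_lt_half
  have hLb := h.one_le_Lbar
  set r := c.δ j ^ j / (j ! : ℝ) with hr
  have hr0 : 0 < r := by positivity
  have e2 : I.P.ς * I.ε j / (1 + I.P.ω) * r < taylorDec c.D j d := not_le.1 h2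
  -- the terms of degree above `j`
  have e3 : taylorDec c.D j d - 3 * I.Lbar * c.δ j * r ≤ taylorDec c.D I.p d := by
    have hsplit : taylorDec c.D I.p d = taylorDec c.D j d -
        ∑ i ∈ Finset.Ico (j + 1) (I.p + 1), c.D i (fun _ => d) / (i ! : ℝ) := by
      have hcons := Finset.sum_Ico_consecutive
        (fun i => c.D i (fun _ => d) / (i ! : ℝ)) (show 1 ≤ j + 1 by omega)
        (show j + 1 ≤ I.p + 1 by omega)
      rw [taylorDec, taylorDec]
      have e : ∀ a : ℕ, Finset.Icc 1 a = Finset.Ico 1 (a + 1) := fun a => by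
        ext; simp only [Finset.mem_Icc, Finset.mem_Ico]; omega
      rw [e, e, ← hcons]
      ring
    have hle : ∑ i ∈ Finset.Ico (j + 1) (I.p + 1), c.D i (fun _ => d) / (i ! : ℝ) ≤
        ∑ i ∈ Finset.Ico (j + 1) (I.p + 1), I.Lbar * c.δ j * r * (1 / ((i - (j + 1))! : ℝ)) := by
      refine Finset.sum_le_sum fun i hi => ?_
      obtain ⟨hi1, hi2⟩ := Finset.mem_Ico.1 hi
      have h5 := (le_abs_self _).trans (abs_apply_diag_le (c.D i)
        (h.norm_tensor_le hD hacc (Finset.mem_Icc.2 ⟨by omega, by omega⟩)) hd)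
      have h6 : c.δ j ^ i ≤ c.δ j ^ (j + 1) := pow_le_pow_of_le_one hδ.le hδ1 hi1
      have h7 : (j ! : ℝ) * ((i - (j + 1))! : ℝ) ≤ (i ! : ℝ) := by
        have : j ! * (i - (j + 1))! ≤ (j + (i - (j + 1)))! :=
          Nat.le_of_dvd (Nat.factorial_pos _) (Nat.factorial_mul_factorial_dvd_factorial_add _ _)
        exact_mod_cast this.trans (Nat.factorial_le (by omega))
      calc _ ≤ (I.Lbar * c.δ j ^ (j + 1)) / ((j ! : ℝ) * ((i - (j + 1))! : ℝ)) := by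
            gcongr
            exact h5.trans (by gcongr)
        _ = _ := by rw [hr]; field_simp; ring
    rw [← Finset.mul_sum] at hle
    have h8 : ∑ i ∈ Finset.Ico (j + 1) (I.p + 1), 1 / ((i - (j + 1))! : ℝ) ≤ 3 := by
      rw [Finset.sum_Ico_eq_sum_range]
      simp only [Nat.add_sub_cancel_left]
      have := Real.sum_le_exp_of_nonneg zero_le_one (I.p + 1 - (j + 1))
      simp only [one_pow] at this
      linarith [Real.exp_one_lt_d9]
    have h9 : 0 ≤ I.Lbar * c.δ j * r := by positivity
    have := mul_le_mul_of_nonneg_left h8 h9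
    linarith
  have e4 : c.σ / ((I.p + 1)! : ℝ) * ‖d‖ ^ (I.p + 1) ≤
      sigmaMax I.P I.p I.L * c.δ j * r := by
    calc _ ≤ sigmaMax I.P I.p I.L / (j ! : ℝ) * c.δ j ^ (j + 1) := by
          have hs := h.sigmaMax_pos.le
          have : (j ! : ℝ) ≤ ((I.p + 1)! : ℝ) := by exact_mod_cast Nat.factorial_le (by omega)
          have h1 : ‖d‖ ^ (I.p + 1) ≤ c.δ j ^ (j + 1) :=
            (pow_le_pow_left₀ (norm_nonneg _) hd _).trans
              (pow_le_pow_of_le_one hδ.le hδ1 (by omega))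
          gcongr
      _ = _ := by rw [hr]; ring
  have e5 : (3 * I.Lbar + sigmaMax I.P I.p I.L) * c.δ j ≤
      I.P.ς * I.ε j / (2 * (1 + I.P.ω)) := by
    have hk := h.kappaDelta_mul h.sigmaMax_pos.le
    have hs := h.sigmaMax_pos
    change _ * _ * _ * radiusRatio I.P I.p I.L = _ at hk
    rw [le_div_iff₀ (by positivity)]
    have h1 : (3 * I.Lbar + sigmaMax I.P I.p I.L) * c.δ j * (2 * (1 + I.P.ω)) ≤
        (3 * I.Lbar + sigmaMax I.P I.p I.L) * (2 * (radiusRatio I.P I.p I.L * I.ε j)) *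
          (2 * (1 + I.P.ω)) := by gcongr
    refine h1.trans ?_
    have h2 : (3 * I.Lbar + sigmaMax I.P I.p I.L) * (2 * (radiusRatio I.P I.p I.L * I.ε j)) *
          (2 * (1 + I.P.ω)) = I.P.ς * I.P.θ * (1 - I.P.ω) * I.ε j / 2 := by
      rw [← hk]; ring
    rw [h2]
    have h3 : I.P.θ * (1 - I.P.ω) ≤ 2 * 1 :=
      mul_le_mul h.valid.θ_lt_two.le (by linarith) (by linarith) (by norm_num)
    have h4 : 0 ≤ I.P.ς * I.ε j := by positivity
    nlinarith
  rw [Input.Big, modelDec_eq, ← hr]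
  have e6 := mul_le_mul_of_nonneg_right e5 hr0.le
  have e7 : I.P.ς * I.ε j / (1 + I.P.ω) * r = 2 * (I.P.ς * I.ε j / (2 * (1 + I.P.ω)) * r) := by
    field_simp
  nlinarith

end Input.Good
end ARqpEDA2
end

noncomputable section
namespace ARqpEDA2

/-! ### Consequences of a step -/

/-- The coefficient of the gap between the optimality level that a step achieves for the model and
the level whose failure keeps the algorithm running. -/
def gapConst (P : Params) : ℝ := (1 - P.ω) / (2 * (1 + P.ω)) * (2 * P.ς - P.θ * (1 + P.ω * P.ς))

/-- Lipschitz-type constant for the derivatives of the model error. -/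
def modelLip (P : Params) (p : ℕ) (L : ℕ → ℝ) : ℝ := L p + (p + 2) * sigmaMax P p L

/-- The constant `c` in the step length bound `c ε ^ π ≤ ‖s‖ ^ (p + 1)`. -/
def stepConst (P : Params) (p : ℕ) (L : ℕ → ℝ) : ℝ :=
  (min 1 (gapConst P / (modelLip P p L * p * (p ! : ℝ))) * radiusRatio P p L ^ p) ^ (p + 1)

/-- No accuracy check fails once all derivative error bounds are at most this constant times
`(min_j ε_j) ^ (p + 1)`. -/
def accConst (P : Params) (p : ℕ) (L : ℕ → ℝ) : ℝ :=
  P.ω * min (P.ς * P.θ * (1 - P.ω) / (4 * (1 + P.ω) ^ 2)) P.σmin * radiusRatio P p L ^ p /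
    (3 * p * ((p + 1)! : ℝ))

variable {n : ℕ} {I : Input n} {flow : ℝ} {c : Config n}

/-- The threshold that the decrease of the model has to reach; `I.Big c j d` says that the
displacement `d` reaches it. -/
def Input.threshold (I : Input n) (c : Config n) (j : ℕ) : ℝ :=
  I.P.ς * I.ε j / (2 * (1 + I.P.ω)) * (c.δ j ^ j / (j ! : ℝ))

/-- What is known of a step `s` that has passed all accuracy checks: the decrement is positive,
dominates the regularization term, and is known with relative accuracy `ω`. -/
structure Input.StepGood (I : Input n) (c : Config n) (s : Vec n) : Prop where
  pos : 0 < taylorDec c.D I.p s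
  reg : c.σ / ((I.p + 1)! : ℝ) * ‖s‖ ^ (I.p + 1) ≤ taylorDec c.D I.p s
  acc : ∑ i ∈ Finset.Icc 1 I.p, c.acc i * ‖s‖ ^ i / (i ! : ℝ) ≤ I.P.ω * taylorDec c.D I.p s

lemma Input.threshold_le_taylorDec (hσ : 0 ≤ c.σ) {j : ℕ} {s : Vec n}
    (hs : I.threshold c j ≤ modelDec I.p c.D c.σ s) : I.threshold c j ≤ taylorDec c.D I.p s := by
  rw [modelDec_eq] at hs
  have : 0 ≤ c.σ / ((I.p + 1)! : ℝ) * ‖s‖ ^ (I.p + 1) := by positivity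
  linarith

/-- Sufficient decrease in successful iterations. -/
lemma Input.StepGood.le_decrease {s : Vec n} (hs : I.StepGood c s) {fx fs : ℝ} {m : ℕ}
    (hv : I.Values c s fx fs m) (hρ : I.P.η₁ ≤ I.rho c s fx fs) :
    (I.P.η₁ - 2 * I.P.ω) * taylorDec c.D I.p s ≤ I.f c.x - I.f (c.x + s) := by
  rw [Input.rho, le_div_iff₀ hs.pos] at hρ
  have h3 := (abs_le.1 hv.acc_s).1
  have h4 := (abs_le.1 hv.acc_x).2
  linarith

namespace Input.Good

variable (h : I.Good flow)
include h

lemma threshold_pos {j : ℕ} (hj : j ∈ Finset.Icc 1 I.q) (hδ : 0 < c.δ j) :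
    0 < I.threshold c j := by
  have := (h.assumptions.eps j hj).1
  have := h.valid.ω_pos
  have := h.valid.ς_pos
  rw [Input.threshold]; positivity

lemma step_ne_zero {j : ℕ} (hj : j ∈ Finset.Icc 1 I.q) (hδ : 0 < c.δ j) {s : Vec n}
    (hs : I.threshold c j ≤ modelDec I.p c.D c.σ s) : s ≠ 0 := by
  rintro rfl
  have := h.threshold_pos hj hδ
  rw [modelDec, sub_self] at hs
  linarith

lemma stepGood (hσ : 0 ≤ c.σ) {j : ℕ} (hj : j ∈ Finset.Icc 1 I.q) (hδ : 0 < c.δ j) {s : Vec n}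
    (hs : I.threshold c j ≤ modelDec I.p c.D c.σ s) (h2 : I.check2 c j s ≠ .insufficient) :
    I.StepGood c s := by
  have h0 := h.threshold_pos hj hδ
  have h1 := Input.threshold_le_taylorDec hσ hs
  have hω := h.valid.ω_pos
  refine ⟨h0.trans_le h1, ?_, ?_⟩
  · rw [modelDec_eq] at hs; linarith
  · rcases check_ne_insufficient h2 with ⟨_, hS⟩ | hS
    · exact hS
    · refine hS.trans ?_
      rw [mul_assoc]
      refine mul_le_mul_of_nonneg_left (le_trans ?_ h1) hω.le
      have hm : 0 < max (c.δ j) ‖s‖ := hδ.trans_le (le_max_left _ _)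
      have hε := (h.assumptions.eps j hj).1
      have hς := h.valid.ς_pos
      have hle : ‖s‖ ^ I.p / max (c.δ j) ‖s‖ ^ I.p ≤ 1 := by
        rw [div_le_one (by positivity)]
        exact pow_le_pow_left₀ (norm_nonneg _) (le_max_right _ _) _
      calc _ = I.threshold c j * (‖s‖ ^ I.p / max (c.δ j) ‖s‖ ^ I.p) := by
            rw [Input.threshold]; field_simp
        _ ≤ I.threshold c j * 1 := by gcongr
        _ = _ := mul_one _

lemma abs_decrease_sub_le (hD : I.TensorsOK c) {s : Vec n} (hs : I.StepGood c s) :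
    |I.f c.x - I.f (c.x + s) - taylorDec c.D I.p s| ≤
      I.P.ω * taylorDec c.D I.p s + I.L I.p * ‖s‖ ^ (I.p + 1) := by
  have h1 := (hD.abs_taylorDec_sub_le le_rfl (le_refl ‖s‖)).trans hs.acc
  have h2 := abs_sub_taylorDec_le h.one_le_p h.assumptions.smooth c.x
    (fun y => h.assumptions.lipschitz _ le_rfl y c.x) s
  rw [abs_le] at h1 h2 ⊢
  constructor <;> linarith [h1.1, h1.2, h2.1, h2.2]

/-- The regularization parameter is not increased once it is large. -/
lemma le_rho (hD : I.TensorsOK c) {s : Vec n} (hs : I.StepGood c s) {fx fs : ℝ} {m : ℕ}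
    (hv : I.Values c s fx fs m)
    (hσ : 4 * I.L I.p * (I.p + 1)! / (1 - I.P.η₂) ≤ c.σ) : I.P.η₂ ≤ I.rho c s fx fs := by
  have hη := h.valid.η₂_lt
  have h1 := (abs_le.1 (h.abs_decrease_sub_le hD hs)).1
  have h2 : I.L I.p * ‖s‖ ^ (I.p + 1) ≤ (1 - I.P.η₂) / 4 * taylorDec c.D I.p s := by
    rw [div_le_iff₀ (by linarith)] at hσ
    have h3 : I.L I.p ≤ (1 - I.P.η₂) / 4 * (c.σ / ((I.p + 1)! : ℝ)) := by
      rw [← mul_div_assoc, le_div_iff₀ (by positivity)]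
      linarith
    calc _ ≤ (1 - I.P.η₂) / 4 * (c.σ / ((I.p + 1)! : ℝ)) * ‖s‖ ^ (I.p + 1) := by gcongr
      _ = (1 - I.P.η₂) / 4 * (c.σ / ((I.p + 1)! : ℝ) * ‖s‖ ^ (I.p + 1)) := by ring
      _ ≤ _ := mul_le_mul_of_nonneg_left hs.reg (by linarith)
  have h3 := (abs_le.1 hv.acc_s).2
  have h4 := (abs_le.1 hv.acc_x).1
  rw [Input.rho, le_div_iff₀ hs.pos]
  have h5 := mul_lt_mul_of_pos_right h.valid.four_ω_lt hs.pos
  linarith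

/-- If `x + s` is not approximately optimal for `f` although `s` is for the model, then the model
error at `s` is bounded below. -/
lemma gap_le_model_error (hD : I.TensorsOK c) (hacc : ∀ i ∈ Finset.Icc 1 I.p, 0 ≤ c.acc i)
    (hσ : 0 ≤ c.σ)
    (hσ' : c.σ ≤ sigmaMax I.P I.p I.L) {l : ℕ} (hl : l ∈ Finset.Icc 1 I.q) {s : Vec n}
    (hs0 : s ≠ 0) (hs1 : ‖s‖ < 1) {δs : ℕ → ℝ} (hδ : 0 < δs l) {dm : ℕ → Vec n}
    (hopt1 : I.P.ς * phi (model I.p c.D c.σ) l (δs l) s ≤ I.modelTaylorDec c l s (dm l))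
    (hopt2 : I.modelTaylorDec c l s (dm l) ≤
      I.P.ς * I.P.θ * (1 - I.P.ω) / (2 * (1 + I.P.ω)) * I.ε l * (δs l ^ l / (l ! : ℝ)))
    (h3 : I.check3 c s δs dm l ≠ .insufficient)
    (hphi : I.P.ς * (1 - I.P.ω) / (1 + I.P.ω) * I.ε l * (δs l ^ l / (l ! : ℝ)) ≤
      phi I.f l (δs l) (c.x + s)) :
    gapConst I.P * I.ε l * (δs l ^ l / (l ! : ℝ)) ≤
      ∑ i ∈ Finset.Icc 1 l,
        modelLip I.P I.p I.L * ‖s‖ ^ (I.p + 1 - i) * δs l ^ i / (i ! : ℝ) := by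
  obtain ⟨hl1, hlq⟩ := Finset.mem_Icc.1 hl
  have hlp : l ≤ I.p := hlq.trans h.q_le_p
  have hε := (h.assumptions.eps l hl).1
  have hω := h.valid.ω_pos
  have hω2 := h.valid.ω_lt_half
  have hς := h.valid.ς_pos
  have hθ := h.valid.θ_pos
  set r := δs l ^ l / (l ! : ℝ) with hr
  have hr0 : 0 < r := by positivity
  obtain ⟨d, hd, hdeq⟩ := exists_taylorDec_eq_optMeasure (exactTensors I.f (c.x + s)) l hδ.le
  rw [phi, ← hdeq] at hphi
  set Tm := taylorDec (exactTensors (model I.p (exactTensors I.f c.x) c.σ) s) l d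
  -- the error of the exact model
  have e1 : |taylorDec (exactTensors I.f (c.x + s)) l d - Tm| ≤ ∑ i ∈ Finset.Icc 1 l,
      modelLip I.P I.p I.L * ‖s‖ ^ (I.p + 1 - i) * δs l ^ i / (i ! : ℝ) := by
    refine ARqpEDA2.abs_taylorDec_sub_le fun i hi => ?_
    obtain ⟨hi1, hi2⟩ := Finset.mem_Icc.1 hi
    refine (abs_iteratedFDeriv_sub_model_le h.one_le_p h.assumptions.smooth c.x
      (fun y => h.assumptions.lipschitz _ le_rfl y c.x) hσ hi1 (hi2.trans hlp) hs0 d).trans ?_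
    have hL := h.one_le_L I.p le_rfl
    have hs := h.sigmaMax_pos
    rw [modelLip]
    gcongr
  -- the effect of the inexact derivatives
  have e2 : |Tm - taylorDec (exactTensors (model I.p c.D c.σ) s) l d| ≤
      ∑ i ∈ Finset.Icc 1 l, 3 * sSup (c.acc '' Set.Icc i I.p) * δs l ^ i / (i ! : ℝ) := by
    refine ARqpEDA2.abs_taylorDec_sub_le fun i hi => ?_
    obtain ⟨hi1, hi2⟩ := Finset.mem_Icc.1 hi
    have hbdd := ((Set.finite_Icc i I.p).image c.acc).bddAbove
    have hmem : ∀ t ∈ Finset.Icc i I.p, c.acc t ≤ sSup (c.acc '' Set.Icc i I.p) := fun t ht =>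
      le_csSup hbdd ⟨t, Finset.mem_Icc.1 ht, rfl⟩
    have h0 : 0 ≤ sSup (c.acc '' Set.Icc i I.p) :=
      (hacc i (Finset.mem_Icc.2 ⟨hi1, hi2.trans hlp⟩)).trans
        (hmem i (Finset.mem_Icc.2 ⟨le_rfl, hi2.trans hlp⟩))
    rw [abs_sub_comm]
    refine abs_iteratedFDeriv_model_sub_le hi1 h0 (fun t ht => ?_) hs0 hs1.le hd
    obtain ⟨ht1, ht2⟩ := Finset.mem_Icc.1 ht
    exact (hD t (Finset.mem_Icc.2 ⟨by omega, ht2⟩)).trans (hmem t ht)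
  set E := ∑ i ∈ Finset.Icc 1 l, 3 * sSup (c.acc '' Set.Icc i I.p) * δs l ^ i / (i ! : ℝ)
  set A := I.P.θ * (1 - I.P.ω) / (2 * (1 + I.P.ω)) * I.ε l * r with hA
  have h1ω : 0 < 1 - I.P.ω := by linarith
  have hA0 : 0 ≤ A := by positivity
  have hςA : I.P.ς * I.P.θ * (1 - I.P.ω) / (2 * (1 + I.P.ω)) * I.ε l * r = I.P.ς * A := by
    rw [hA]; ring
  rw [hςA] at hopt2
  have hE : E ≤ I.P.ω * (I.P.ς * A) := by
    rcases check_ne_insufficient h3 with ⟨_, hS⟩ | hS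
    · exact hS.trans (mul_le_mul_of_nonneg_left hopt2 hω.le)
    · refine hS.trans ?_
      rw [mul_assoc]
      refine mul_le_mul_of_nonneg_left ?_ hω.le
      calc _ = I.P.ς * A / (1 + I.P.ω) := by rw [hA, ← hr]; field_simp
        _ ≤ _ := div_le_self (by positivity) (by linarith)
  have e3 : taylorDec (exactTensors (model I.p c.D c.σ) s) l d ≤ A := by
    refine le_of_mul_le_mul_left (le_trans ?_ (hopt1.trans hopt2)) hς
    exact mul_le_mul_of_nonneg_left (taylorDec_le_optMeasure _ l hd) hς.le
  have e1' := (abs_le.1 e1).2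
  have e2' := (abs_le.1 e2).2
  have e4 : gapConst I.P * I.ε l * r =
      I.P.ς * (1 - I.P.ω) / (1 + I.P.ω) * I.ε l * r - A - I.P.ω * (I.P.ς * A) := by
    rw [gapConst, hA]; field_simp; ring
  linarith

end Input.Good

lemma gapConst_pos {P : Params} (h : P.Valid) : 0 < gapConst P := by
  have := h.ω_pos
  have := h.ω_lt_half
  have h1 : 0 < 1 - P.ω := by linarith
  have h2 : 0 < 2 * P.ς - P.θ * (1 + P.ω * P.ς) := by linarith [h.θ_lt]
  rw [gapConst]; positivity

/-- Solving the inequality of `gap_le_model_error` for the length `S` of the step. For radii below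
`S` the first term of the sum dominates, for larger radii the last one does. -/
lemma rpow_le_of_sum {p l : ℕ} (hl : 1 ≤ l) (hlp : l ≤ p) {g K ρ S δ ε π : ℝ} (hg : 0 < g)
    (hK : 0 < K) (hρ : 0 < ρ) (hρ1 : ρ ≤ 1) (hS : 0 < S) (hS1 : S < 1) (hδ : 0 < δ)
    (hε : 0 < ε) (hε1 : ε ≤ 1) (hδ2 : l ≤ 2 → δ = 1) (hδ3 : 3 ≤ l → ρ * ε ≤ δ)
    (hπ : ((p : ℝ) + 1) / (p - l + 1) ≤ π) (hπ3 : 3 ≤ l → (l : ℝ) * (p + 1) / p ≤ π)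
    (hsum : g * ε * (δ ^ l / (l ! : ℝ)) ≤
      ∑ i ∈ Finset.Icc 1 l, K * S ^ (p + 1 - i) * δ ^ i / (i ! : ℝ)) :
    (min 1 (g / (K * p * (p ! : ℝ))) * ρ ^ p) ^ (p + 1) * ε ^ π ≤ S ^ (p + 1) := by
  have hp : (1 : ℝ) ≤ p := by exact_mod_cast hl.trans hlp
  set k := min 1 (g / (K * p * (p ! : ℝ))) with hk
  have hk0 : 0 < k := lt_min one_pos (by positivity)
  have hk1 : k ≤ 1 := min_le_left _ _
  have hρp : ρ ^ p ≤ 1 := pow_le_one₀ hρ.le hρ1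
  -- bound by a common value of the terms
  have main : ∀ M : ℝ, (∀ i ∈ Finset.Icc 1 l, S ^ (p + 1 - i) * δ ^ i ≤ M) → 0 ≤ M →
      k * ε * δ ^ l ≤ M := by
    intro M hM hM0
    have h1 : ∑ i ∈ Finset.Icc 1 l, K * S ^ (p + 1 - i) * δ ^ i / (i ! : ℝ) ≤ p * (K * M) := by
      calc _ ≤ ∑ i ∈ Finset.Icc 1 l, K * M := by
            refine Finset.sum_le_sum fun i hi => ?_
            have hi1 : (1 : ℝ) ≤ (i ! : ℝ) := by exact_mod_cast i.factorial_pos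
            refine (div_le_self (by positivity) hi1).trans ?_
            rw [mul_assoc]
            exact mul_le_mul_of_nonneg_left (hM i hi) hK.le
        _ = l * (K * M) := by simp
        _ ≤ p * (K * M) := by gcongr
    have h2 : k ≤ g / (K * p * (p ! : ℝ)) := min_le_right _ _
    have h3 : (l ! : ℝ) ≤ (p ! : ℝ) := by exact_mod_cast Nat.factorial_le hlp
    calc k * ε * δ ^ l ≤ g / (K * p * (p ! : ℝ)) * ε * δ ^ l := by gcongr
      _ = (g * ε * (δ ^ l / (p ! : ℝ))) / (p * K) := by field_simp
      _ ≤ (g * ε * (δ ^ l / (l ! : ℝ))) / (p * K) := by gcongr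
      _ ≤ (p * (K * M)) / (p * K) := div_le_div_of_nonneg_right (hsum.trans h1) (by positivity)
      _ = M := by field_simp
  -- taking roots
  have root : ∀ (m : ℕ) (e : ℝ), 1 ≤ m → 0 ≤ e → ((p : ℝ) + 1) / m * e ≤ π →
      k * ρ ^ p * ε ^ e ≤ S ^ m → (k * ρ ^ p) ^ (p + 1) * ε ^ π ≤ S ^ (p + 1) := by
    intro m e hm he hmπ hle
    have hm0 : (1 : ℝ) ≤ m := by exact_mod_cast hm
    have hκ0 : 0 < k * ρ ^ p := by positivity
    have hκ1 : k * ρ ^ p ≤ 1 := mul_le_one₀ hk1 (by positivity) hρp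
    have h1 := Real.rpow_le_rpow (by positivity) hle (by positivity : 0 ≤ ((p : ℝ) + 1) / m)
    have h2 : (S ^ m) ^ (((p : ℝ) + 1) / m) = S ^ (p + 1) := by
      rw [← Real.rpow_natCast S m, ← Real.rpow_mul hS.le, ← Real.rpow_natCast S (p + 1)]
      congr 1
      push_cast
      field_simp
    rw [h2, Real.mul_rpow hκ0.le (by positivity), ← Real.rpow_mul hε.le] at h1
    refine le_trans ?_ h1
    refine mul_le_mul ?_ ?_ (by positivity) (by positivity)
    · rw [← Real.rpow_natCast (k * ρ ^ p) (p + 1)]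
      refine Real.rpow_le_rpow_of_exponent_ge hκ0 hκ1 ?_
      push_cast
      exact div_le_self (by positivity) hm0
    · exact Real.rpow_le_rpow_of_exponent_ge hε hε1 (by linarith)
  rcases le_or_gt S δ with hSδ | hSδ
  · have h1 : k * ε * δ ^ l ≤ S ^ (p + 1 - l) * δ ^ l := by
      refine main _ (fun i hi => ?_) (by positivity)
      obtain ⟨hi1, hi2⟩ := Finset.mem_Icc.1 hi
      calc S ^ (p + 1 - i) * δ ^ i = S ^ (p + 1 - l) * S ^ (l - i) * δ ^ i := by
            rw [← pow_add]; congr 2; omega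
        _ ≤ S ^ (p + 1 - l) * δ ^ (l - i) * δ ^ i := by gcongr
        _ = S ^ (p + 1 - l) * δ ^ l := by rw [mul_assoc, ← pow_add]; congr 2; omega
    have h2 : k * ε ≤ S ^ (p + 1 - l) := le_of_mul_le_mul_right h1 (by positivity)
    refine root (p + 1 - l) 1 (by omega) zero_le_one ?_ ?_
    · rw [mul_one, Nat.cast_sub (by omega)]
      push_cast
      rwa [show (p : ℝ) + 1 - l = p - l + 1 by ring]
    · rw [Real.rpow_one]
      refine le_trans ?_ h2
      rw [mul_right_comm]
      exact mul_le_of_le_one_right (by positivity) hρp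
  · have hl3 : 3 ≤ l := by
      by_contra hc
      have := hδ2 (by omega)
      linarith
    have h1 : k * ε * δ ^ l ≤ S ^ p * δ := by
      refine main _ (fun i hi => ?_) (by positivity)
      obtain ⟨hi1, hi2⟩ := Finset.mem_Icc.1 hi
      calc S ^ (p + 1 - i) * δ ^ i = S ^ (p + 1 - i) * δ ^ (i - 1) * δ := by
            rw [mul_assoc, ← pow_succ]; congr 2; omega
        _ ≤ S ^ (p + 1 - i) * S ^ (i - 1) * δ := by gcongr
        _ = S ^ p * δ := by rw [← pow_add]; congr 2; omega
    have h2 : k * ε * δ ^ (l - 1) ≤ S ^ p := by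
      refine le_of_mul_le_mul_right (le_trans (le_of_eq ?_) h1) hδ
      rw [mul_assoc, ← pow_succ]; congr 2; omega
    refine root p l (by omega) (by positivity) ?_ ?_
    · have := hπ3 hl3
      rwa [div_mul_eq_mul_div, mul_comm]
    · refine le_trans ?_ h2
      rw [Real.rpow_natCast]
      have h3 : (ρ * ε) ^ (l - 1) ≤ δ ^ (l - 1) := by gcongr; exact hδ3 hl3
      calc k * ρ ^ p * ε ^ l ≤ k * ρ ^ (l - 1) * ε ^ l := by
            have := pow_le_pow_of_le_one hρ.le hρ1 (show l - 1 ≤ p by omega)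
            gcongr
        _ = k * ε * (ρ * ε) ^ (l - 1) := by
            rw [mul_pow]
            have : ε ^ l = ε * ε ^ (l - 1) := by rw [← pow_succ']; congr 1; omega
            rw [this]; ring
        _ ≤ _ := by gcongr

end ARqpEDA2
end

noncomputable section
namespace ARqpEDA2

/-! ### Feasibility of the steps, and success of the accuracy checks -/

variable {n : ℕ} {I : Input n} {flow : ℝ} {c : Config n}

lemma check_ne_insufficient_of_relative {ω δ dT ξ : ℝ} {acc : ℕ → ℝ} {r : ℕ} (h0 : 0 < dT)
    (h : ∑ i ∈ Finset.Icc 1 r, acc i * δ ^ i / (i ! : ℝ) ≤ ω * dT) :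
    check ω δ dT acc r ξ ≠ .insufficient := fun h' => (check_eq_insufficient h').1 ⟨h0, h⟩

lemma check_ne_insufficient_of_absolute {ω δ dT ξ : ℝ} {acc : ℕ → ℝ} {r : ℕ}
    (h : ∑ i ∈ Finset.Icc 1 r, acc i * δ ^ i / (i ! : ℝ) ≤ ω * ξ * (δ ^ r / (r ! : ℝ))) :
    check ω δ dT acc r ξ ≠ .insufficient := fun h' => (check_eq_insufficient h').2 h

lemma sum_acc_le {acc : ℕ → ℝ} {r : ℕ} {A δ B : ℝ} (hA : 0 ≤ A) (hδ : 0 ≤ δ)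
    (hB : ∀ i ∈ Finset.Icc 1 r, δ ^ i ≤ B) (hacc : ∀ i ∈ Finset.Icc 1 r, acc i ≤ A) :
    ∑ i ∈ Finset.Icc 1 r, acc i * δ ^ i / (i ! : ℝ) ≤ r * A * B := by
  calc _ ≤ ∑ i ∈ Finset.Icc 1 r, A * B := by
        refine Finset.sum_le_sum fun i hi => ?_
        have hi1 : (1 : ℝ) ≤ (i ! : ℝ) := by exact_mod_cast i.factorial_pos
        have hB0 : 0 ≤ B := (pow_nonneg hδ i).trans (hB i hi)
        calc acc i * δ ^ i / (i ! : ℝ) ≤ A * δ ^ i / (i ! : ℝ) := by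
              have := hacc i hi
              gcongr
          _ ≤ A * δ ^ i := div_le_self (by positivity) hi1
          _ ≤ _ := mul_le_mul_of_nonneg_left (hB i hi) hA
    _ = _ := by simp [mul_assoc]

namespace Input.Good

variable (h : I.Good flow)
include h

lemma exists_displacement {j : ℕ} (hδ : 0 ≤ c.δ j) : ∃ d, I.Displacement c j d := by
  obtain ⟨d, hd, hd'⟩ := exists_taylorDec_eq_optMeasure c.D j hδ
  refine ⟨d, hd, ?_⟩
  rw [hd']
  exact mul_le_of_le_one_left (optMeasure_nonneg _ _ hδ) h.valid.ς_le

/-- Suitable steps exist, with radii obeying the rule on their choice: a global minimizer of the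
model qualifies. -/
lemma exists_step (hD : I.TensorsOK c) (hacc : ∀ i ∈ Finset.Icc 1 I.p, c.acc i ≤ I.P.accMax)
    (hσ : 0 < c.σ) {j : ℕ} (hj : j ∈ Finset.Icc 1 I.q) (hδ : 0 < c.δ j) {d : Vec n}
    (hd : I.threshold c j ≤ modelDec I.p c.D c.σ d) (δ0 : ℕ → ℝ) :
    ∃ (s : Vec n) (δs : ℕ → ℝ) (dm : ℕ → Vec n), I.StepOK c d s δs dm ∧
      (‖s‖ < 1 → (∀ ℓ ∈ Finset.Icc 1 (min 2 I.q), δs ℓ = 1) ∧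
        ∀ ℓ ∈ Finset.Icc 3 I.q, min (I.kappaDelta c.σ * I.ε ℓ) (δ0 ℓ) ≤ δs ℓ) := by
  obtain ⟨s, hmin⟩ := exists_forall_model_le I.p c.D hσ
  have hdec : modelDec I.p c.D c.σ d ≤ modelDec I.p c.D c.σ s := sub_le_sub_left (hmin d) _
  have hs0 : s ≠ 0 := h.step_ne_zero hj hδ (hd.trans hdec)
  have hω := h.valid.ω_pos
  have hω2 := h.valid.ω_lt_half
  have hς := h.valid.ς_pos
  have hθ := h.valid.θ_pos
  have hLb := h.one_le_Lbar
  have h1ω : 0 < 1 - I.P.ω := by linarith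
  let δs : ℕ → ℝ := fun ℓ => if ℓ ≤ 2 then 1 else I.kappaDelta c.σ * I.ε ℓ
  have hδs : ∀ ℓ ∈ Finset.Icc 1 I.q, 0 < δs ℓ ∧ δs ℓ ≤ 1 := by
    intro ℓ hℓ
    have hε := h.assumptions.eps ℓ hℓ
    have hk := h.kappaDelta_pos hσ.le
    dsimp only [δs]
    split_ifs
    · exact ⟨one_pos, le_rfl⟩
    · exact ⟨mul_pos hk hε.1, mul_le_one₀ (h.kappaDelta_le_one hσ.le) hε.1.le hε.2⟩
  -- displacements maximizing the Taylor decrements of the model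
  have hex : ∀ ℓ, ∃ d', ℓ ∈ Finset.Icc 1 I.q → ‖d'‖ ≤ δs ℓ ∧
      I.modelTaylorDec c ℓ s d' = phi (model I.p c.D c.σ) ℓ (δs ℓ) s := fun ℓ => by
    by_cases hℓ : ℓ ∈ Finset.Icc 1 I.q
    · obtain ⟨d', h1, h2⟩ := exists_taylorDec_eq_optMeasure
        (exactTensors (model I.p c.D c.σ) s) ℓ (hδs ℓ hℓ).1.le
      exact ⟨d', fun _ => ⟨h1, h2⟩⟩
    · exact ⟨0, fun h' => absurd h' hℓ⟩
  choose dm hdm using hex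
  refine ⟨s, δs, dm, ⟨hdec, hδs, ?_⟩, fun _ => ⟨fun ℓ hℓ => ?_, fun ℓ hℓ => ?_⟩⟩
  · rcases le_or_gt 1 ‖s‖ with hs | hs
    · exact Or.inl hs
    refine Or.inr fun ℓ hℓ => ?_
    obtain ⟨hℓ1, hℓq⟩ := Finset.mem_Icc.1 hℓ
    obtain ⟨h1, h2⟩ := hdm ℓ hℓ
    obtain ⟨hδ0, hδ1⟩ := hδs ℓ hℓ
    have hε := (h.assumptions.eps ℓ hℓ).1
    refine ⟨h1, ?_, ?_⟩
    · rw [h2]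
      exact mul_le_of_le_one_left (optMeasure_nonneg _ _ hδ0.le) h.valid.ς_le
    rw [h2]
    rcases le_or_gt ℓ 2 with hl | hl
    · exact (phi_model_nonpos_of_isMin hmin hs0 hl hδ0.le).trans (by positivity)
    · refine (phi_model_le_of_isMin hmin hs0 hs.le hσ.le (zero_le_one.trans hLb)
        (fun i hi => h.norm_tensor_le hD hacc (Finset.mem_Icc.2 ⟨?_, (Finset.mem_Icc.1 hi).2⟩))
        hl.le (hℓq.trans h.q_le_p) hδ0.le hδ1).trans_eq ?_
      · have := (Finset.mem_Icc.1 hi).1; omega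
      · have hk := h.kappaDelta_mul hσ.le
        have e : δs ℓ = I.kappaDelta c.σ * I.ε ℓ := if_neg (by omega)
        rw [← hk, pow_succ]
        nth_rewrite 2 [e]
        field_simp
        ring
  · exact if_pos ((Finset.mem_Icc.1 hℓ).2.trans (min_le_left _ _))
  · have e : δs ℓ = I.kappaDelta c.σ * I.ε ℓ :=
      if_neg (by have := (Finset.mem_Icc.1 hℓ).1; omega)
    rw [e]
    exact min_le_left _ _

lemma accConst_pos : 0 < accConst I.P I.p I.L := by
  have := h.valid.ω_pos
  have := h.valid.ω_lt_half
  have := h.valid.ς_pos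
  have := h.valid.θ_pos
  have := h.valid.σmin_pos
  have := h.radiusRatio_pos
  have h1 : 0 < 1 - I.P.ω := by linarith
  have hp : (0 : ℝ) < I.p := by exact_mod_cast h.one_le_p
  have : 0 < min (I.P.ς * I.P.θ * (1 - I.P.ω) / (4 * (1 + I.P.ω) ^ 2)) I.P.σmin :=
    lt_min (by positivity) (by positivity)
  rw [accConst]
  positivity

/-- Error bounds of the size `accConst * e ^ (p + 1)` meet the absolute accuracy requirements. -/
lemma accConst_le {e : ℝ} (he : 0 < e) {j : ℕ} (hj : j ∈ Finset.Icc 1 I.q) (hej : e ≤ I.ε j)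
    {δ β : ℝ} (hδ : radiusRatio I.P I.p I.L * I.ε j ≤ δ)
    (hβ : I.P.ς * I.P.θ * (1 - I.P.ω) / (4 * (1 + I.P.ω) ^ 2) ≤ β) :
    3 * I.p * (accConst I.P I.p I.L * e ^ (I.p + 1)) ≤
      I.P.ω * (β * I.ε j) * (δ ^ j / (j ! : ℝ)) := by
  obtain ⟨hj1, hjq⟩ := Finset.mem_Icc.1 hj
  have hjp := hjq.trans h.q_le_p
  have hε := h.assumptions.eps j hj
  have hω := h.valid.ω_pos
  have hω2 := h.valid.ω_lt_half
  have hς := h.valid.ς_pos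
  have hθ := h.valid.θ_pos
  have hρ := h.radiusRatio_pos
  have hρ1 := h.radiusRatio_le_one
  have h1ω : 0 < 1 - I.P.ω := by linarith
  have hp : (0 : ℝ) < I.p := by exact_mod_cast h.one_le_p
  have hb0 : 0 ≤ I.P.ς * I.P.θ * (1 - I.P.ω) / (4 * (1 + I.P.ω) ^ 2) := by positivity
  have hb := (min_le_left _ I.P.σmin).trans hβ
  have h1 : (radiusRatio I.P I.p I.L * e) ^ I.p ≤ δ ^ j :=
    calc _ ≤ (radiusRatio I.P I.p I.L * e) ^ j :=
          pow_le_pow_of_le_one (by positivity) (mul_le_one₀ hρ1 he.le (hej.trans hε.2)) hjp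
      _ ≤ _ := by
          refine pow_le_pow_left₀ (by positivity) (le_trans ?_ hδ) _
          gcongr
  have hβ0 : 0 ≤ β := hb0.trans hβ
  have h2 : (j ! : ℝ) ≤ ((I.p + 1)! : ℝ) := by exact_mod_cast Nat.factorial_le (by omega)
  calc _ = I.P.ω * (min (I.P.ς * I.P.θ * (1 - I.P.ω) / (4 * (1 + I.P.ω) ^ 2)) I.P.σmin * e) *
        ((radiusRatio I.P I.p I.L * e) ^ I.p / ((I.p + 1)! : ℝ)) := by
        rw [accConst, mul_pow, pow_succ e]; field_simp
    _ ≤ _ := by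
        have h0 : 0 ≤ δ ^ j := le_trans (by positivity) h1
        have h4 : 0 ≤ I.P.ω * (β * I.ε j) := mul_nonneg hω.le (mul_nonneg hβ0 hε.1.le)
        gcongr

lemma absolute_coeff_le : I.P.ς * I.P.θ * (1 - I.P.ω) / (4 * (1 + I.P.ω) ^ 2) ≤
    I.P.ς / (2 * (1 + I.P.ω)) := by
  have hω := h.valid.ω_pos
  have hς := h.valid.ς_pos
  have h1 : I.P.θ * (1 - I.P.ω) ≤ 2 * 1 :=
    mul_le_mul h.valid.θ_lt_two.le (by linarith) (by linarith [h.valid.ω_lt_half]) (by norm_num)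
  calc _ = I.P.ς / (2 * (1 + I.P.ω)) * (I.P.θ * (1 - I.P.ω) / (2 * (1 + I.P.ω))) := by
        field_simp; norm_num
    _ ≤ I.P.ς / (2 * (1 + I.P.ω)) * 1 := by
        refine mul_le_mul_of_nonneg_left ?_ (by positivity)
        rw [div_le_one (by positivity)]
        linarith
    _ = _ := mul_one _

section Insufficient

variable {e : ℝ} (he : 0 < e) (hacc : ∀ i ∈ Finset.Icc 1 I.p, c.acc i ≤
  accConst I.P I.p I.L * e ^ (I.p + 1))
include he hacc

lemma check1_ne_insufficient {j : ℕ} (hj : j ∈ Finset.Icc 1 I.q) (hej : e ≤ I.ε j)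
    (hδ : radiusRatio I.P I.p I.L * I.ε j ≤ c.δ j) (hδ1 : c.δ j ≤ 1) (d : Vec n) :
    I.check1 c j d ≠ .insufficient := by
  obtain ⟨hj1, hjq⟩ := Finset.mem_Icc.1 hj
  have hjp := hjq.trans h.q_le_p
  have hε := (h.assumptions.eps j hj).1
  have hω := h.valid.ω_pos
  have hς := h.valid.ς_pos
  have hδ0 : 0 ≤ c.δ j := le_trans (mul_pos h.radiusRatio_pos hε).le hδ
  have hA : 0 ≤ accConst I.P I.p I.L * e ^ (I.p + 1) := by have := h.accConst_pos; positivity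
  have hjp' : (j : ℝ) ≤ I.p := by exact_mod_cast hjp
  have hβ := h.absolute_coeff_le.trans (div_le_div_of_nonneg_left hς.le two_pos
    (show (2 : ℝ) ≤ 2 * (1 + I.P.ω) by linarith))
  refine check_ne_insufficient_of_absolute ((sum_acc_le hA hδ0
    (fun i _ => pow_le_one₀ hδ0 hδ1)
    (fun i hi => hacc i (Finset.Icc_subset_Icc_right hjp hi))).trans ?_)
  refine le_trans ?_ ((h.accConst_le he hj hej hδ hβ).trans_eq (by ring))
  nlinarith

lemma check2_ne_insufficient {j : ℕ} (hj : j ∈ Finset.Icc 1 I.q) (hej : e ≤ I.ε j)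
    (hσ : I.P.σmin ≤ c.σ)
    (hδ : radiusRatio I.P I.p I.L * I.ε j ≤ c.δ j) {s : Vec n}
    (hs : I.threshold c j ≤ modelDec I.p c.D c.σ s) :
    I.check2 c j s ≠ .insufficient := by
  have hε := h.assumptions.eps j hj
  have hω := h.valid.ω_pos
  have hς := h.valid.ς_pos
  have hσm := h.valid.σmin_pos
  have hσ0 := hσm.le.trans hσ
  have hδ0 : 0 < c.δ j := lt_of_lt_of_le (mul_pos h.radiusRatio_pos hε.1) hδ
  have hA : 0 ≤ accConst I.P I.p I.L * e ^ (I.p + 1) := by have := h.accConst_pos; positivity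
  have hp : (0 : ℝ) < I.p := by exact_mod_cast h.one_le_p
  have hth := h.threshold_pos (c := c) hj hδ0
  have hT := Input.threshold_le_taylorDec hσ0 hs
  refine check_ne_insufficient_of_relative (hth.trans_le hT) ?_
  -- short steps are covered by the decrease that the model must achieve, long ones by the
  -- regularization term, whose degree exceeds that of every error term
  rcases lt_or_ge ‖s‖ 1 with hs1 | hs1
  · refine (sum_acc_le hA (norm_nonneg s)
      (fun i _ => pow_le_one₀ (norm_nonneg s) hs1.le) hacc).trans ?_
    have h4 := h.accConst_le he hj hej hδ h.absolute_coeff_le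
    have h5 : I.P.ω * (I.P.ς / (2 * (1 + I.P.ω)) * I.ε j) * (c.δ j ^ j / (j ! : ℝ)) =
        I.P.ω * I.threshold c j := by rw [Input.threshold]; ring
    have h6 := mul_le_mul_of_nonneg_left hT hω.le
    have : 0 ≤ I.p * (accConst I.P I.p I.L * e ^ (I.p + 1)) := by positivity
    linarith
  · refine (sum_acc_le hA (norm_nonneg s) (B := ‖s‖ ^ (I.p + 1))
      (fun i hi => pow_le_pow_right₀ hs1 (by have := (Finset.mem_Icc.1 hi).2; omega)) hacc).trans ?_
    have he1 : e ^ (I.p + 1) ≤ 1 := pow_le_one₀ he.le (hej.trans hε.2)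
    have hρ1 : radiusRatio I.P I.p I.L ^ I.p ≤ 1 :=
      pow_le_one₀ h.radiusRatio_pos.le h.radiusRatio_le_one
    have hρ0 := h.radiusRatio_pos
    have h1 : I.p * (accConst I.P I.p I.L * e ^ (I.p + 1)) ≤
        I.P.ω * (c.σ / ((I.p + 1)! : ℝ)) := by
      calc _ ≤ 3 * (I.p * (accConst I.P I.p I.L * e ^ (I.p + 1))) := by
            have : 0 ≤ I.p * (accConst I.P I.p I.L * e ^ (I.p + 1)) := by positivity
            linarith
        _ = I.P.ω * (min (I.P.ς * I.P.θ * (1 - I.P.ω) / (4 * (1 + I.P.ω) ^ 2)) I.P.σmin *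
            (radiusRatio I.P I.p I.L ^ I.p * e ^ (I.p + 1)) / ((I.p + 1)! : ℝ)) := by
            rw [accConst]; field_simp
        _ ≤ I.P.ω * (I.P.σmin * 1 / ((I.p + 1)! : ℝ)) := by
            gcongr
            · exact min_le_right _ _
            · exact mul_le_one₀ hρ1 (by positivity) he1
        _ ≤ _ := by rw [mul_one]; gcongr
    have h2 := mul_le_mul_of_nonneg_right h1 (by positivity : 0 ≤ ‖s‖ ^ (I.p + 1))
    refine h2.trans ?_
    rw [mul_assoc]
    refine mul_le_mul_of_nonneg_left ?_ hω.le
    rw [modelDec_eq] at hs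
    linarith

lemma check3_ne_insufficient {l : ℕ} (hl : l ∈ Finset.Icc 1 I.q) (hel : e ≤ I.ε l)
    {δs : ℕ → ℝ} (hδ : radiusRatio I.P I.p I.L * I.ε l ≤ δs l) (hδ1 : δs l ≤ 1) (s : Vec n)
    (dm : ℕ → Vec n) : I.check3 c s δs dm l ≠ .insufficient := by
  obtain ⟨hl1, hlq⟩ := Finset.mem_Icc.1 hl
  have hlp := hlq.trans h.q_le_p
  have hε := (h.assumptions.eps l hl).1
  have hω := h.valid.ω_pos
  have hς := h.valid.ς_pos
  have hθ := h.valid.θ_pos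
  have h1ω : 0 < 1 - I.P.ω := by linarith [h.valid.ω_lt_half]
  have hδ0 : 0 ≤ δs l := le_trans (mul_pos h.radiusRatio_pos hε).le hδ
  have hA : 0 ≤ accConst I.P I.p I.L * e ^ (I.p + 1) := by have := h.accConst_pos; positivity
  have hlp' : (l : ℝ) ≤ I.p := by exact_mod_cast hlp
  refine check_ne_insufficient_of_absolute ((sum_acc_le (A := 3 * (accConst I.P I.p I.L *
    e ^ (I.p + 1))) (by positivity) hδ0
    (fun i _ => pow_le_one₀ hδ0 hδ1) (fun i hi => ?_)).trans ?_)
  · obtain ⟨hi1, hi2⟩ := Finset.mem_Icc.1 hi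
    refine mul_le_mul_of_nonneg_left (csSup_le ⟨_, i, ⟨le_rfl, hi2.trans hlp⟩, rfl⟩ ?_)
      (by norm_num)
    rintro _ ⟨t, ⟨ht1, ht2⟩, rfl⟩
    exact hacc t (Finset.mem_Icc.2 ⟨by omega, ht2⟩)
  · have hβ : I.P.ς * I.P.θ * (1 - I.P.ω) / (4 * (1 + I.P.ω) ^ 2) ≤
        I.P.ς * I.P.θ * (1 - I.P.ω) / (2 * (1 + I.P.ω) ^ 2) := by gcongr; norm_num
    refine le_trans ?_ ((h.accConst_le he hl hel hδ hβ).trans_eq (by ring))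
    nlinarith

end Insufficient

end Input.Good
end ARqpEDA2
end

noncomputable section
namespace ARqpEDA2

/-! ### The invariant of the algorithm -/

section Powers

variable {q : ℕ} {ε π : ℕ → ℝ}

lemma finite_image_Icc (f : ℕ → ℝ) (q : ℕ) : (f '' Set.Icc 1 q).Finite :=
  (Set.finite_Icc 1 q).image f

lemma minPow_le {j : ℕ} (hj : j ∈ Finset.Icc 1 q) : minPow q ε π ≤ ε j ^ π j :=
  csInf_le (finite_image_Icc _ q).bddBelow ⟨j, Finset.mem_Icc.1 hj, rfl⟩

lemma exists_minPow_eq (hq : 1 ≤ q) (ε π : ℕ → ℝ) :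
    ∃ j ∈ Finset.Icc 1 q, minPow q ε π = ε j ^ π j := by
  have hne : ((fun j => ε j ^ π j) '' Set.Icc 1 q).Nonempty := ⟨_, 1, ⟨le_rfl, hq⟩, rfl⟩
  obtain ⟨j, hj, hj'⟩ := hne.csInf_mem (finite_image_Icc _ q)
  exact ⟨j, Finset.mem_Icc.2 hj, hj'.symm⟩

lemma minPow_pos (hq : 1 ≤ q) (hε : ∀ j ∈ Finset.Icc 1 q, 0 < ε j) : 0 < minPow q ε π := by
  obtain ⟨j, hj, hj'⟩ := exists_minPow_eq hq ε π
  rw [hj']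
  exact Real.rpow_pos_of_pos (hε j hj) _

end Powers

/-- What the complexity analysis needs of the exponents `π_1, …, π_q`. -/
structure Exponents (p q : ℕ) (π : ℕ → ℝ) : Prop where
  le_of_one_le : ∀ l ∈ Finset.Icc 1 q, ((p : ℝ) + 1) / (p - l + 1) ≤ π l
  le_of_three_le : ∀ l ∈ Finset.Icc 3 q, (l : ℝ) * (p + 1) / p ≤ π l

lemma Exponents.one_le {p q : ℕ} {π : ℕ → ℝ} (hπ : Exponents p q π) (hqp : q ≤ p) {l : ℕ}
    (hl : l ∈ Finset.Icc 1 q) : 1 ≤ π l := by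
  refine le_trans ?_ (hπ.le_of_one_le l hl)
  obtain ⟨h1, h2⟩ := Finset.mem_Icc.1 hl
  have h1' : (1 : ℝ) ≤ l := by exact_mod_cast h1
  have h2' : (l : ℝ) ≤ p := by exact_mod_cast h2.trans hqp
  rw [one_le_div (by linarith)]
  linarith

/-- The constant in the guaranteed decrease of `f` per successful iteration. -/
def decreaseConst (P : Params) (p : ℕ) (L : ℕ → ℝ) : ℝ :=
  (P.η₁ - 2 * P.ω) * (P.σmin / ((p + 1)! : ℝ)) * stepConst P p L

variable {n : ℕ} {I : Input n} {flow : ℝ} {c : Config n} {π : ℕ → ℝ}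

/-- The decrease of `f` that a successful iteration guarantees if the new point is not
approximately optimal. -/
def Input.unit (I : Input n) (π : ℕ → ℝ) : ℝ :=
  decreaseConst I.P I.p I.L * minPow I.q I.ε π

/-- At `x`, the optimality measure of some order is too large for the radii `δ` for the algorithm
to stop. -/
def Input.Far (I : Input n) (δ : ℕ → ℝ) (x : Vec n) : Prop :=
  ∃ l ∈ Finset.Icc 1 I.q,
    I.P.ς * (1 - I.P.ω) / (1 + I.P.ω) * I.ε l * (δ l ^ l / (l ! : ℝ)) ≤ phi I.f l (δ l) x

/-- The radii are in the range that the algorithm maintains. -/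
def Input.RadiiOK (I : Input n) (δ : ℕ → ℝ) : Prop :=
  ∀ l ∈ Finset.Icc 1 I.q, radiusRatio I.P I.p I.L * I.ε l ≤ δ l ∧ δ l ≤ 1

/-- The smallest tolerance. -/
def Input.epsMin (I : Input n) : ℝ := sInf (I.ε '' Set.Icc 1 I.q)

lemma Input.epsMin_le (I : Input n) {l : ℕ} (hl : l ∈ Finset.Icc 1 I.q) : I.epsMin ≤ I.ε l :=
  csInf_le (finite_image_Icc _ _).bddBelow ⟨l, Finset.mem_Icc.1 hl, rfl⟩

/-- Each of `Ns` successful iterations is paid for by a decrease `I.unit π` of `f`. -/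
def Input.Paid (I : Input n) (π : ℕ → ℝ) (x : Vec n) (Ns : ℕ) : Prop :=
  I.unit π * Ns ≤ I.f I.x₀ - I.f x

lemma Input.Good.radii_pos (h : I.Good flow) {δ : ℕ → ℝ} (hδ : I.RadiiOK δ) {l : ℕ}
    (hl : l ∈ Finset.Icc 1 I.q) : 0 < δ l :=
  lt_of_lt_of_le (mul_pos h.radiusRatio_pos (h.assumptions.eps l hl).1) (hδ l hl).1

namespace Input.Good

variable (h : I.Good flow)
include h

lemma exists_epsMin_eq : ∃ l ∈ Finset.Icc 1 I.q, I.epsMin = I.ε l := by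
  have hne : (I.ε '' Set.Icc 1 I.q).Nonempty := ⟨_, 1, ⟨le_rfl, h.one_le_q⟩, rfl⟩
  obtain ⟨j, hj, hj'⟩ := hne.csInf_mem (finite_image_Icc _ _)
  exact ⟨j, Finset.mem_Icc.2 hj, hj'.symm⟩

lemma epsMin_pos : 0 < I.epsMin := by
  obtain ⟨l, hl, hl'⟩ := h.exists_epsMin_eq
  exact hl' ▸ (h.assumptions.eps l hl).1

lemma modelLip_pos : 0 < modelLip I.P I.p I.L := by
  have h1 := h.one_le_L I.p le_rfl
  have h2 := h.sigmaMax_pos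
  rw [modelLip]
  positivity

lemma stepConst_pos : 0 < stepConst I.P I.p I.L := by
  have h1 := h.modelLip_pos
  have h2 := gapConst_pos h.valid
  have h3 := h.radiusRatio_pos
  have hp : (0 : ℝ) < I.p := by exact_mod_cast h.one_le_p
  have : 0 < min 1 (gapConst I.P / (modelLip I.P I.p I.L * I.p * (I.p ! : ℝ))) :=
    lt_min one_pos (by positivity)
  rw [stepConst]
  positivity

lemma stepConst_le_one : stepConst I.P I.p I.L ≤ 1 := by
  have h1 := h.modelLip_pos
  have h2 := gapConst_pos h.valid
  have h3 := h.radiusRatio_pos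
  have hp : (0 : ℝ) < I.p := by exact_mod_cast h.one_le_p
  have : 0 < min 1 (gapConst I.P / (modelLip I.P I.p I.L * I.p * (I.p ! : ℝ))) :=
    lt_min one_pos (by positivity)
  rw [stepConst]
  refine pow_le_one₀ (by positivity) (mul_le_one₀ (min_le_left _ _) (by positivity) ?_)
  exact pow_le_one₀ h3.le h.radiusRatio_le_one

lemma decreaseConst_pos : 0 < decreaseConst I.P I.p I.L := by
  have h1 := h.stepConst_pos
  have h2 := h.valid.two_ω_lt_η₁
  have h3 := h.valid.σmin_pos
  have : 0 < I.P.η₁ - 2 * I.P.ω := by linarith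
  rw [decreaseConst]; positivity

lemma unit_pos (π : ℕ → ℝ) : 0 < I.unit π :=
  mul_pos h.decreaseConst_pos (minPow_pos h.one_le_q fun j hj => (h.assumptions.eps j hj).1)

lemma minPow_le_one (hπ : Exponents I.p I.q π) : minPow I.q I.ε π ≤ 1 := by
  have h1 : 1 ∈ Finset.Icc 1 I.q := Finset.mem_Icc.2 ⟨le_rfl, h.one_le_q⟩
  have hε := h.assumptions.eps 1 h1
  exact (minPow_le h1).trans
    (Real.rpow_le_one hε.1.le hε.2 (zero_le_one.trans (hπ.one_le h.q_le_p h1)))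

/-- The decrease of `f` in a successful iteration, in terms of the length of the step. -/
lemma norm_step_le_decrease (hσ : I.P.σmin ≤ c.σ) {s : Vec n} (hs : I.StepGood c s) {fx fs : ℝ}
    {m : ℕ} (hv : I.Values c s fx fs m) (hρ : I.P.η₁ ≤ I.rho c s fx fs) :
    (I.P.η₁ - 2 * I.P.ω) * (I.P.σmin / ((I.p + 1)! : ℝ)) * ‖s‖ ^ (I.p + 1) ≤
      I.f c.x - I.f (c.x + s) := by
  refine le_trans ?_ (hs.le_decrease hv hρ)
  rw [mul_assoc]
  refine mul_le_mul_of_nonneg_left (le_trans ?_ hs.reg) (by linarith [h.valid.two_ω_lt_η₁])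
  gcongr

/-- A step that leads to a point which is not approximately optimal is long. -/
lemma stepConst_mul_minPow_le (hπ : Exponents I.p I.q π) (hD : I.TensorsOK c)
    (hacc : ∀ i ∈ Finset.Icc 1 I.p, 0 ≤ c.acc i) (hσ : 0 ≤ c.σ)
    (hσ' : c.σ ≤ sigmaMax I.P I.p I.L) {d s : Vec n} (hs0 : s ≠ 0) (hs1 : ‖s‖ < 1) {δs : ℕ → ℝ}
    {dm : ℕ → Vec n} (hs : I.StepOK c d s δs dm) (hδs : I.RadiiOK δs)
    (hδ1 : ∀ ℓ ∈ Finset.Icc 1 (min 2 I.q), δs ℓ = 1)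
    (h3 : ∀ ℓ ∈ Finset.Icc 1 I.q, I.check3 c s δs dm ℓ ≠ .insufficient)
    (hfar : I.Far δs (c.x + s)) :
    stepConst I.P I.p I.L * minPow I.q I.ε π ≤ ‖s‖ ^ (I.p + 1) := by
  obtain ⟨l, hl, hphi⟩ := hfar
  obtain ⟨hl1, hlq⟩ := Finset.mem_Icc.1 hl
  have hε := h.assumptions.eps l hl
  obtain ⟨_, ho1, ho2⟩ := hs.optimal.resolve_left hs1.not_ge l hl
  have hsum := h.gap_le_model_error hD hacc hσ hσ' hl hs0 hs1 (hs.radii l hl).1 ho1 ho2 (h3 l hl)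
    hphi
  have h4 := rpow_le_of_sum hl1 (hlq.trans h.q_le_p) (gapConst_pos h.valid) h.modelLip_pos
    h.radiusRatio_pos h.radiusRatio_le_one (norm_pos_iff.2 hs0) hs1 (hs.radii l hl).1 hε.1 hε.2
    (fun hl2 => hδ1 l (Finset.mem_Icc.2 ⟨hl1, le_min hl2 hlq⟩)) (fun _ => (hδs l hl).1)
    (hπ.le_of_one_le l hl)
    (fun hl3 => hπ.le_of_three_le l (Finset.mem_Icc.2 ⟨hl3, hlq⟩)) hsum
  exact (mul_le_mul_of_nonneg_left (minPow_le hl) h.stepConst_pos.le).trans h4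

end Input.Good

/-- The part of the invariant of the algorithm that depends on the point reached, after `Ns`
successful iterations.

A successful iteration is certain to decrease `f` by `I.unit π` only if the algorithm does not stop
at the new point. So the last one may be unpaid as long as all tests at the new point succeed at
once, with the radii unchanged. -/
def Input.PhaseInv (I : Input n) (π : ℕ → ℝ) (c : Config n) (Ns : ℕ) : Phase n → Prop
  | .start => I.Far c.δ c.x → I.Paid π c.x Ns
  | .test δ0 j => j ∈ Finset.Icc 1 I.q ∧ c.avail = true ∧ I.RadiiOK δ0 ∧
      (∀ i ∈ Finset.Icc 1 I.q, i < j → phi I.f i (c.δ i) c.x ≤ I.ε i * c.δ i ^ i / (i ! : ℝ)) ∧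
      (I.Far δ0 c.x → I.Paid π c.x Ns) ∧ (c.δ = δ0 ∨ I.Paid π c.x Ns)
  | .solve δ0 j d => j ∈ Finset.Icc 1 I.q ∧ c.avail = true ∧ I.RadiiOK δ0 ∧
      I.threshold c j ≤ modelDec I.p c.D c.σ d ∧ I.Paid π c.x Ns
  | .verify δ0 j s δs dm => j ∈ Finset.Icc 1 I.q ∧ c.avail = true ∧ I.RadiiOK δ0 ∧
      I.threshold c j ≤ modelDec I.p c.D c.σ s ∧ I.Paid π c.x Ns ∧
      (∃ d, I.StepOK c d s δs dm) ∧
      (‖s‖ < 1 → I.RadiiOK δs ∧ ∀ ℓ ∈ Finset.Icc 1 (min 2 I.q), δs ℓ = 1)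
  | .accept s δs => c.avail = true ∧ I.StepGood c s ∧ I.Paid π c.x Ns ∧
      (‖s‖ < 1 → I.RadiiOK δs ∧ (I.Far δs (c.x + s) →
        stepConst I.P I.p I.L * minPow I.q I.ε π ≤ ‖s‖ ^ (I.p + 1)))
  | .finished => ∀ j ∈ Finset.Icc 1 I.q,
      phi I.f j (c.δ j) c.x ≤ I.ε j * c.δ j ^ j / (j ! : ℝ)

/-- The invariant of the algorithm, after `Ns` successful and `Nf` unsuccessful iterations, and `Ni`
improvements of the derivative error bounds. -/
structure Input.Inv (I : Input n) (π : ℕ → ℝ) (c : Config n) (Ns Nf Ni : ℕ) : Prop where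
  acc_eq : ∀ i ∈ Finset.Icc 1 I.p, c.acc i = I.P.γacc ^ Ni * I.acc₀ i
  σ_ge : I.P.σmin ≤ c.σ
  σ_le : c.σ ≤ sigmaMax I.P I.p I.L
  σ_count : I.P.σ₀ * (I.P.γ₁ ^ Ns * I.P.γ₂ ^ Nf) ≤ c.σ
  radii : I.RadiiOK c.δ
  tensors : c.avail = true → I.TensorsOK c
  nf_le : c.nf ≤ 2 * (Ns + Nf)
  nd_le : c.nd + (if c.avail then 0 else 1) ≤ Ns + Ni + 1
  improved : Ni ≠ 0 →
    accConst I.P I.p I.L * I.epsMin ^ (I.p + 1) ≤ I.P.γacc ^ (Ni - 1) * I.P.accMax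
  decrease : I.unit π * Ns ≤ I.f I.x₀ - I.f c.x + I.unit π
  phaseInv : I.PhaseInv π c Ns c.phase

namespace Input.Good

variable (h : I.Good flow)
include h

lemma inv_init (π : ℕ → ℝ) : I.Inv π I.init 0 0 0 where
  acc_eq i _ := by simp [Input.init]
  σ_ge := h.valid.σmin_le
  σ_le := le_max_left _ _
  σ_count := by simp [Input.init]
  radii l hl := by
    have h1 := h.assumptions.radii l hl
    refine ⟨le_trans ?_ h1.1, h1.2⟩
    exact mul_le_of_le_one_left (h.assumptions.eps l hl).1.le h.radiusRatio_le_one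
  tensors h' := by simp [Input.init] at h'
  nf_le := by simp [Input.init]
  nd_le := by simp [Input.init]
  improved h' := absurd rfl h'
  decrease := by simpa [Input.init] using (h.unit_pos π).le
  phaseInv _ := by simp [Input.Paid, Input.init]

lemma acc_nonneg {Ns Nf Ni : ℕ} (hI : I.Inv π c Ns Nf Ni) {i : ℕ} (hi : i ∈ Finset.Icc 1 I.p) :
    0 ≤ c.acc i := by
  rw [hI.acc_eq i hi]
  exact mul_nonneg (pow_nonneg h.valid.γacc_pos.le _) (h.assumptions.acc i hi).1

lemma acc_le {Ns Nf Ni : ℕ} (hI : I.Inv π c Ns Nf Ni) {i : ℕ} (hi : i ∈ Finset.Icc 1 I.p) :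
    c.acc i ≤ I.P.γacc ^ Ni * I.P.accMax := by
  rw [hI.acc_eq i hi]
  exact mul_le_mul_of_nonneg_left (h.assumptions.acc i hi).2 (pow_nonneg h.valid.γacc_pos.le _)

lemma acc_le_accMax {Ns Nf Ni : ℕ} (hI : I.Inv π c Ns Nf Ni) {i : ℕ}
    (hi : i ∈ Finset.Icc 1 I.p) : c.acc i ≤ I.P.accMax :=
  (h.acc_le hI hi).trans (mul_le_of_le_one_left h.valid.accMax_nonneg
    (pow_le_one₀ h.valid.γacc_pos.le h.valid.γacc_lt.le))

lemma σ_pos {Ns Nf Ni : ℕ} (hI : I.Inv π c Ns Nf Ni) : 0 < c.σ :=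
  h.valid.σmin_pos.trans_le hI.σ_ge

/-- The error bounds are improved only if one of them exceeds `accConst * epsMin ^ (p + 1)`, which
limits the number of improvements. -/
lemma inv_improve {Ns Nf Ni : ℕ} (hI : I.Inv π c Ns Nf Ni) (ha : c.avail = true)
    {δ0 : ℕ → ℝ} (hδ0 : I.RadiiOK δ0) (hpaid : I.Far δ0 c.x → I.Paid π c.x Ns)
    (hacc : ¬ ∀ i ∈ Finset.Icc 1 I.p,
      c.acc i ≤ accConst I.P I.p I.L * I.epsMin ^ (I.p + 1)) :
    I.Inv π (c.improve I.P.γacc δ0) Ns Nf (Ni + 1) where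
  acc_eq i hi := by
    change I.P.γacc * c.acc i = _
    rw [hI.acc_eq i hi]; ring
  σ_ge := hI.σ_ge
  σ_le := hI.σ_le
  σ_count := hI.σ_count
  radii := hδ0
  tensors h' := by simp [Config.improve] at h'
  nf_le := hI.nf_le
  nd_le := by
    have := hI.nd_le
    rw [ha] at this
    simp only [Config.improve, if_true, Bool.false_eq_true, if_false] at this ⊢
    omega
  improved _ := by
    push Not at hacc
    obtain ⟨i, hi, hlt⟩ := hacc
    simpa using hlt.le.trans (h.acc_le hI hi)
  decrease := hI.decrease
  phaseInv := hpaid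

/-- The regularization parameter stays bounded. -/
lemma sigma_update_le {Ns Nf Ni : ℕ} (hI : I.Inv π c Ns Nf Ni) (hD : I.TensorsOK c) {s : Vec n}
    (hs : I.StepGood c s) {fx fs : ℝ} {m : ℕ} (hv : I.Values c s fx fs m) {σ' : ℝ}
    (hσ : I.P.SigmaUpdate (I.rho c s fx fs) c.σ σ') : σ' ≤ sigmaMax I.P I.p I.L := by
  have hσ0 := h.σ_pos hI
  rcases le_or_gt I.P.η₂ (I.rho c s fx fs) with h2 | h2
  · exact (hσ.1 h2).2.trans hI.σ_le
  have h3 : c.σ ≤ 4 * I.L I.p * (I.p + 1)! / (1 - I.P.η₂) := by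
    by_contra hc
    exact h2.not_ge (h.le_rho hD hs hv (not_le.1 hc).le)
  have hγ := h.valid.γ₃_gt
  have hγ0 : 0 < I.P.γ₃ := by linarith [h.valid.γ₂_gt]
  have h4 : σ' ≤ I.P.γ₃ * c.σ := by
    rcases le_or_gt I.P.η₁ (I.rho c s fx fs) with h1 | h1
    · exact (hσ.2.1 h1 h2).2.trans (by gcongr)
    · exact (hσ.2.2 h1).2
  exact h4.trans ((mul_le_mul_of_nonneg_left h3 hγ0.le).trans (le_max_right _ _))

/-- A successful iteration that is not short, or that leads to a point far from optimal, pays for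
itself. -/
lemma inv_success (hπ : Exponents I.p I.q π) {Ns Nf Ni : ℕ} (hI : I.Inv π c Ns Nf Ni) {s : Vec n}
    {δs : ℕ → ℝ} {fx fs σ' : ℝ} {m : ℕ} (hc : c.phase = .accept s δs)
    (hv : I.Values c s fx fs m) (hρ : I.P.η₁ ≤ I.rho c s fx fs)
    (hσ : I.P.SigmaUpdate (I.rho c s fx fs) c.σ σ') :
    I.Inv π { c with
        phase := .start, x := c.x + s, σ := σ', δ := if ‖s‖ < 1 then δs else c.δ,
        avail := false, fval := some fs, nf := c.nf + m } (Ns + 1) Nf Ni := by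
  have hph := hI.phaseInv
  rw [hc] at hph
  obtain ⟨ha, hs, hpaid, hshort⟩ := hph
  have hD := hI.tensors ha
  have hσ0 := h.σ_pos hI
  have hγ₁ := h.valid.γ₁_pos
  have hγ₁' := h.valid.γ₁_lt
  have hγ₂ := h.valid.γ₂_gt
  have hdec := h.norm_step_le_decrease hI.σ_ge hs hv hρ
  have hη := h.valid.two_ω_lt_η₁
  have hη' : 0 < I.P.η₁ - 2 * I.P.ω := by linarith
  have hσm := h.valid.σmin_pos
  have hσ₁ : I.P.σmin ≤ σ' ∧ I.P.γ₁ * c.σ ≤ σ' := by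
    rcases le_or_gt I.P.η₂ (I.rho c s fx fs) with h2 | h2
    · exact max_le_iff.1 (hσ.1 h2).1
    · have h3 := (hσ.2.1 hρ h2).1
      exact ⟨hI.σ_ge.trans h3, le_trans (mul_le_of_le_one_left hσ0.le hγ₁'.le) h3⟩
  have hpaid' : I.unit π * Ns ≤ I.f I.x₀ - I.f c.x := hpaid
  exact {
    acc_eq := hI.acc_eq
    σ_ge := hσ₁.1
    σ_le := h.sigma_update_le hI hD hs hv hσ
    σ_count := by
      refine le_trans ?_ hσ₁.2
      refine le_trans (le_of_eq ?_) (mul_le_mul_of_nonneg_left hI.σ_count hγ₁.le)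
      rw [pow_succ]; ring
    radii := by
      change I.RadiiOK (if ‖s‖ < 1 then δs else c.δ)
      split_ifs with h1
      · exact (hshort h1).1
      · exact hI.radii
    tensors := fun h' => by simp at h'
    nf_le := by
      have h1 := hI.nf_le
      have h2 : m ≤ 2 := by rcases hv.count with h | h <;> omega
      change c.nf + m ≤ _
      omega
    nd_le := by
      have := hI.nd_le
      rw [ha] at this
      simp only [if_true, Bool.false_eq_true, if_false] at this ⊢
      omega
    improved := hI.improved
    decrease := by
      have h0 : 0 ≤ (I.P.η₁ - 2 * I.P.ω) * (I.P.σmin / ((I.p + 1)! : ℝ)) * ‖s‖ ^ (I.p + 1) := by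
        positivity
      change _ ≤ I.f I.x₀ - I.f (c.x + s) + I.unit π
      push_cast
      linarith
    phaseInv := by
      change I.Far (if ‖s‖ < 1 then δs else c.δ) (c.x + s) → I.Paid π (c.x + s) (Ns + 1)
      intro hfar
      have h1 : stepConst I.P I.p I.L * minPow I.q I.ε π ≤ ‖s‖ ^ (I.p + 1) := by
        split_ifs at hfar with h1
        · exact (hshort h1).2 hfar
        · have h2 : 0 ≤ minPow I.q I.ε π :=
            (minPow_pos h.one_le_q fun j hj => (h.assumptions.eps j hj).1).le
          exact (mul_le_one₀ h.stepConst_le_one h2 (h.minPow_le_one hπ)).trans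
            (one_le_pow₀ (not_lt.1 h1))
      have h2 : I.unit π ≤ I.f c.x - I.f (c.x + s) := by
        refine le_trans ?_ hdec
        rw [Input.unit, decreaseConst, mul_assoc _ (stepConst _ _ _)]
        exact mul_le_mul_of_nonneg_left h1 (by positivity)
      rw [Input.Paid]
      push_cast
      linarith }

lemma inv_failure {Ns Nf Ni : ℕ} (hI : I.Inv π c Ns Nf Ni) {s : Vec n}
    {δs : ℕ → ℝ} {fx fs σ' : ℝ} {m : ℕ} (hc : c.phase = .accept s δs)
    (hv : I.Values c s fx fs m) (hρ : I.rho c s fx fs < I.P.η₁)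
    (hσ : I.P.SigmaUpdate (I.rho c s fx fs) c.σ σ') :
    I.Inv π { c with
        phase := .start, σ := σ', fval := some fx, nf := c.nf + m } Ns (Nf + 1) Ni := by
  have hph := hI.phaseInv
  rw [hc] at hph
  obtain ⟨ha, hs, hpaid, hshort⟩ := hph
  have hD := hI.tensors ha
  have hσ0 := h.σ_pos hI
  have hγ₂ := h.valid.γ₂_gt
  have hσ₁ := (hσ.2.2 hρ).1
  exact {
    acc_eq := hI.acc_eq
    σ_ge := hI.σ_ge.trans (le_trans (le_mul_of_one_le_left hσ0.le hγ₂.le) hσ₁)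
    σ_le := h.sigma_update_le hI hD hs hv hσ
    σ_count := by
      refine le_trans ?_ hσ₁
      refine le_trans (le_of_eq ?_) (mul_le_mul_of_nonneg_left hI.σ_count (by linarith))
      rw [pow_succ]; ring
    radii := hI.radii
    tensors := hI.tensors
    nf_le := by
      have h1 := hI.nf_le
      have h2 : m ≤ 2 := by rcases hv.count with h | h <;> omega
      change c.nf + m ≤ _
      omega
    nd_le := hI.nd_le
    improved := hI.improved
    decrease := hI.decrease
    phaseInv := fun _ => hpaid }

end Input.Good
end ARqpEDA2
end

noncomputable section
namespace ARqpEDA2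

/-! ### Progress and termination -/

variable {n : ℕ} {I : Input n} {flow : ℝ} {c c' : Config n} {π : ℕ → ℝ} {Ns Nf Ni : ℕ}

/-- Elementary steps that do not end an iteration decrease this number, except for the halving of a
radius, which leaves it unchanged. -/
def Phase.rank (q : ℕ) : Phase n → ℕ
  | .start => q + 4
  | .test _ j => q + 4 - j
  | .solve _ _ _ => 3
  | .verify _ _ _ _ _ => 2
  | .accept _ _ => 1
  | .finished => 0

/-- A number that decreases whenever the radius under test is halved. -/
def Input.halvings (I : Input n) (c : Config n) : ℕ :=
  match c.phase with
  | .test _ j => ⌊c.δ j / (radiusRatio I.P I.p I.L * I.ε j)⌋₊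
  | _ => 0

/-- `c'` is closer than `c` to the end of the iteration. -/
def Input.Closer (I : Input n) (c' c : Config n) : Prop :=
  c'.phase.rank I.q < c.phase.rank I.q ∨
    (c'.phase.rank I.q = c.phase.rank I.q ∧ I.halvings c' < I.halvings c)

lemma Params.Valid.exists_sigmaUpdate {P : Params} (hP : P.Valid) (ρ : ℝ) {σ : ℝ}
    (hσ : P.σmin ≤ σ) : ∃ σ', P.SigmaUpdate ρ σ σ' := by
  have hσ0 : 0 ≤ σ := hP.σmin_pos.le.trans hσ
  have hγ : σ ≤ P.γ₂ * σ := le_mul_of_one_le_left hσ0 hP.γ₂_gt.le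
  rcases lt_or_ge ρ P.η₁ with h1 | h1
  · have h2 := h1.trans_le hP.η₁_le
    exact ⟨P.γ₂ * σ, fun h => absurd h h2.not_ge, fun h => absurd h h1.not_ge,
      fun _ => ⟨le_rfl, mul_le_mul_of_nonneg_right hP.γ₃_gt.le hσ0⟩⟩
  · exact ⟨σ, fun _ => ⟨max_le hσ (mul_le_of_le_one_left hσ0 hP.γ₁_lt.le), le_rfl⟩,
      fun _ _ => ⟨le_rfl, hγ⟩, fun h => absurd h h1.not_gt⟩

namespace Input.Good

variable (h : I.Good flow)
include h

lemma not_acc_le_of_check1 (hI : I.Inv π c Ns Nf Ni) {j : ℕ} (hj : j ∈ Finset.Icc 1 I.q)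
    {d : Vec n} (h1 : I.check1 c j d = .insufficient) :
    ¬ ∀ i ∈ Finset.Icc 1 I.p, c.acc i ≤ accConst I.P I.p I.L * I.epsMin ^ (I.p + 1) := fun hacc =>
  h.check1_ne_insufficient h.epsMin_pos hacc hj (I.epsMin_le hj) (hI.radii j hj).1
    (hI.radii j hj).2 d h1

lemma not_acc_le_of_insufficient2 (hI : I.Inv π c Ns Nf Ni) {δ0 : ℕ → ℝ} {j : ℕ} {s : Vec n}
    {δs : ℕ → ℝ} {dm : ℕ → Vec n} (hc : c.phase = .verify δ0 j s δs dm)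
    (h2 : I.Insufficient2 c j s δs dm) :
    ¬ ∀ i ∈ Finset.Icc 1 I.p, c.acc i ≤ accConst I.P I.p I.L * I.epsMin ^ (I.p + 1) := by
  intro hacc
  have hph := hI.phaseInv
  rw [hc] at hph
  obtain ⟨hj, -, -, hs, -, -, hr⟩ := hph
  rcases h2 with h2 | ⟨hs1, l, hl, h2⟩
  · exact h.check2_ne_insufficient h.epsMin_pos hacc hj (I.epsMin_le hj) hI.σ_ge (hI.radii j hj).1
      hs h2
  · exact h.check3_ne_insufficient h.epsMin_pos hacc hl (I.epsMin_le hl) ((hr hs1).1 l hl).1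
      ((hr hs1).1 l hl).2 s dm h2

lemma far_of_not_small (hI : I.Inv π c Ns Nf Ni) (ha : c.avail = true) {j : ℕ}
    (hj : j ∈ Finset.Icc 1 I.q) {d : Vec n} (hd : I.Displacement c j d)
    (h1 : I.check1 c j d ≠ .insufficient) (h2 : ¬ I.Small c j d) : I.Far c.δ c.x :=
  ⟨j, hj, h.le_phi_of_not_small (hI.tensors ha) hj (h.radii_pos hI.radii hj) hd h1 h2⟩

/-- A radius is halved only if the result stays in the admissible range. -/
lemma halve_radius (hI : I.Inv π c Ns Nf Ni) (ha : c.avail = true) {j : ℕ}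
    (hj : j ∈ Finset.Icc 1 I.q) {d : Vec n} (hd : I.Displacement c j d)
    (h2 : ¬ I.Small c j d) (h3 : ¬ I.Big c j d) :
    2 * (radiusRatio I.P I.p I.L * I.ε j) < c.δ j := by
  by_contra hc
  exact h3 (h.big_of_not_small (hI.tensors ha) (fun i hi => h.acc_le_accMax hI hi) hI.σ_le hj
    (h.radii_pos hI.radii hj) (hI.radii j hj).2 (not_lt.1 hc) hd.1 h2)

/-- Every elementary step preserves the invariant, and either ends an iteration or gets closer to
the end of the current one. -/
lemma inv_step (hπ : Exponents I.p I.q π) (hI : I.Inv π c Ns Nf Ni) (hst : I.RuleStep c c') :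
    ∃ Ns' Nf' Ni', I.Inv π c' Ns' Nf' Ni' ∧ (Ns' + Nf' + Ni' = Ns + Nf + Ni + 1 ∨
      (Ns' + Nf' + Ni' = Ns + Nf + Ni ∧ I.Closer c' c)) := by
  obtain ⟨hstep, hrule⟩ := hst
  have hph := hI.phaseInv
  have h1q : 1 ∈ Finset.Icc 1 I.q := Finset.mem_Icc.2 ⟨le_rfl, h.one_le_q⟩
  have hq := h.one_le_q
  have hno : ∀ i ∈ Finset.Icc 1 I.q, i < 1 →
      phi I.f i (c.δ i) c.x ≤ I.ε i * c.δ i ^ i / (i ! : ℝ) := fun i hi hi1 =>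
    absurd (Finset.mem_Icc.1 hi).1 hi1.not_ge
  cases hstep with
  | evaluate D hc ha hD =>
    rw [hc] at hph
    refine ⟨Ns, Nf, Ni, { hI with
      tensors := fun _ => hD
      nd_le := ?_
      phaseInv := ⟨h1q, rfl, hI.radii, hno, hph, Or.inl rfl⟩ }, Or.inr ⟨rfl, Or.inl ?_⟩⟩
    · have := hI.nd_le
      rw [ha] at this
      simpa using this
    · rw [hc]; simp only [Phase.rank]; omega
  | reuse hc ha =>
    rw [hc] at hph
    refine ⟨Ns, Nf, Ni, { hI with
      phaseInv := ⟨h1q, ha, hI.radii, hno, hph, Or.inl rfl⟩ }, Or.inr ⟨rfl, Or.inl ?_⟩⟩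
    rw [hc]; simp only [Phase.rank]; omega
  | testImprove δ0 j d hc hd h1 =>
    rw [hc] at hph
    obtain ⟨hj, ha, hδ0, -, hfar, -⟩ := hph
    exact ⟨Ns, Nf, Ni + 1, h.inv_improve hI ha hδ0 hfar (h.not_acc_le_of_check1 hI hj h1),
      Or.inl (by omega)⟩
  | testNext δ0 j d hc hd h1 h2 hjq =>
    rw [hc] at hph
    obtain ⟨hj, ha, hδ0, hpass, hfar, hor⟩ := hph
    have hj1 := (Finset.mem_Icc.1 hj).1
    refine ⟨Ns, Nf, Ni, { hI with
      phaseInv := ⟨Finset.mem_Icc.2 ⟨by omega, hjq⟩, ha, hδ0, fun i hi hij => ?_, hfar, hor⟩ },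
      Or.inr ⟨rfl, Or.inl ?_⟩⟩
    · rcases Nat.lt_succ_iff_lt_or_eq.1 hij with hij | rfl
      · exact hpass i hi hij
      · exact h.phi_le_of_small (hI.tensors ha) hi (h.radii_pos hI.radii hi) hd h1 h2
    · rw [hc]; simp only [Phase.rank]; omega
  | testStop δ0 j d hc hd h1 h2 hjq =>
    rw [hc] at hph
    obtain ⟨hj, ha, hδ0, hpass, hfar, hor⟩ := hph
    refine ⟨Ns, Nf, Ni, { hI with phaseInv := fun i hi => ?_ }, Or.inr ⟨rfl, Or.inl ?_⟩⟩
    · rcases ((Finset.mem_Icc.1 hi).2.trans_eq hjq.symm).lt_or_eq with hij | rfl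
      · exact hpass i hi hij
      · exact h.phi_le_of_small (hI.tensors ha) hi (h.radii_pos hI.radii hi) hd h1 h2
    · rw [hc]; simp only [Phase.rank]; omega
  | testSolve δ0 j d hc hd h1 h2 h3 =>
    rw [hc] at hph
    obtain ⟨hj, ha, hδ0, hpass, hfar, hor⟩ := hph
    have hpaid : I.Paid π c.x Ns := by
      have hf := h.far_of_not_small hI ha hj hd h1 h2
      rcases hor with hor | hor
      · exact hfar (hor ▸ hf)
      · exact hor
    refine ⟨Ns, Nf, Ni, { hI with phaseInv := ⟨hj, ha, hδ0, h3, hpaid⟩ },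
      Or.inr ⟨rfl, Or.inl ?_⟩⟩
    have hj2 := (Finset.mem_Icc.1 hj).2
    rw [hc]; simp only [Phase.rank]; omega
  | testHalve δ0 j d hc hd h1 h2 h3 =>
    rw [hc] at hph
    obtain ⟨hj, ha, hδ0, hpass, hfar, hor⟩ := hph
    have hpaid : I.Paid π c.x Ns := by
      have hf := h.far_of_not_small hI ha hj hd h1 h2
      rcases hor with hor | hor
      · exact hfar (hor ▸ hf)
      · exact hor
    have hhalf := h.halve_radius hI ha hj hd h2 h3
    have hρε : 0 < radiusRatio I.P I.p I.L * I.ε j :=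
      mul_pos h.radiusRatio_pos (h.assumptions.eps j hj).1
    refine ⟨Ns, Nf, Ni, { hI with
      radii := fun l hl => ?_
      phaseInv := ?_ }, Or.inr ⟨rfl, Or.inr ⟨rfl, ?_⟩⟩⟩
    · change _ ≤ Function.update c.δ j (c.δ j / 2) l ∧ Function.update c.δ j (c.δ j / 2) l ≤ 1
      rcases eq_or_ne l j with rfl | hlj
      · rw [Function.update_self]
        exact ⟨by linarith, by linarith [(hI.radii l hl).2]⟩
      · rw [Function.update_of_ne hlj]
        exact hI.radii l hl
    · change I.PhaseInv π _ Ns c.phase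
      rw [hc]
      refine ⟨hj, ha, hδ0, fun i hi hij => ?_, hfar, Or.inr hpaid⟩
      change phi I.f i (Function.update c.δ j (c.δ j / 2) i) c.x ≤
        I.ε i * Function.update c.δ j (c.δ j / 2) i ^ i / (i ! : ℝ)
      rw [Function.update_of_ne hij.ne]
      exact hpass i hi hij
    · simp only [Input.halvings, hc, Function.update_self]
      set y := c.δ j / (radiusRatio I.P I.p I.L * I.ε j) with hy
      have hy2 : 2 ≤ y := by rw [hy, le_div_iff₀ hρε]; exact hhalf.le
      have e : c.δ j / 2 / (radiusRatio I.P I.p I.L * I.ε j) = y / 2 := by rw [hy]; ring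
      rw [e, Nat.lt_iff_add_one_le, ← Nat.floor_add_one (by linarith)]
      exact Nat.floor_le_floor (by linarith)
  | solve δ0 j d s δs dm hc hs =>
    rw [hc] at hph
    obtain ⟨hj, ha, hδ0, hth, hpaid⟩ := hph
    have hr := hrule δ0 j s δs dm rfl
    refine ⟨Ns, Nf, Ni, { hI with
      phaseInv := ⟨hj, ha, hδ0, hth.trans hs.descent, hpaid,
        ⟨d, hs.descent, hs.radii, hs.optimal⟩,
        fun hs1 => ⟨fun l hl => ⟨?_, (hs.radii l hl).2⟩, (hr hs1).1⟩⟩ },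
      Or.inr ⟨rfl, Or.inl ?_⟩⟩
    · have hε := h.assumptions.eps l hl
      obtain ⟨hl1, hlq⟩ := Finset.mem_Icc.1 hl
      rcases le_or_gt l 2 with hl2 | hl2
      · rw [(hr hs1).1 l (Finset.mem_Icc.2 ⟨hl1, le_min hl2 hlq⟩)]
        exact mul_le_one₀ h.radiusRatio_le_one hε.1.le hε.2
      · refine le_trans (le_min ?_ (hδ0 l hl).1) ((hr hs1).2 l (Finset.mem_Icc.2 ⟨hl2, hlq⟩))
        exact mul_le_mul_of_nonneg_right
          (h.radiusRatio_le_kappaDelta (h.σ_pos hI).le hI.σ_le) hε.1.le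
    · rw [hc]; simp [Phase.rank]
  | verifyImprove δ0 j s δs dm hc h2 =>
    have hph' := hph
    rw [hc] at hph
    obtain ⟨hj, ha, hδ0, hth, hpaid, -⟩ := hph
    exact ⟨Ns, Nf, Ni + 1, h.inv_improve hI ha hδ0 (fun _ => hpaid)
      (h.not_acc_le_of_insufficient2 hI hc h2), Or.inl (by omega)⟩
  | verifyAccept δ0 j s δs dm hc h2 =>
    rw [hc] at hph
    obtain ⟨hj, ha, hδ0, hth, hpaid, ⟨d, hs⟩, hr⟩ := hph
    have hδ := h.radii_pos hI.radii hj
    have hσ := (h.σ_pos hI).le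
    have hgood := h.stepGood hσ hj hδ hth fun h' => h2 (Or.inl h')
    refine ⟨Ns, Nf, Ni, { hI with
      phaseInv := ⟨ha, ⟨hgood.pos, hgood.reg, hgood.acc⟩, hpaid, fun hs1 =>
        ⟨(hr hs1).1, fun hfar => ?_⟩⟩ }, Or.inr ⟨rfl, Or.inl ?_⟩⟩
    · exact h.stepConst_mul_minPow_le hπ (hI.tensors ha) (fun i hi => h.acc_nonneg hI hi) hσ
        hI.σ_le (h.step_ne_zero hj hδ hth) hs1 hs (hr hs1).1 (hr hs1).2
        (fun l hl h' => h2 (Or.inr ⟨hs1, l, hl, h'⟩)) hfar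
    · rw [hc]; simp [Phase.rank]
  | success s δs fx fs σ' m hc hv hρ hσ =>
    exact ⟨Ns + 1, Nf, Ni, h.inv_success hπ hI hc hv hρ hσ, Or.inl (by omega)⟩
  | failure s δs fx fs σ' m hc hv hρ hσ =>
    exact ⟨Ns, Nf + 1, Ni, h.inv_failure hI hc hv hρ hσ, Or.inl (by omega)⟩

/-- The algorithm can always be continued until it terminates. -/
lemma exists_ruleStep (hI : I.Inv π c Ns Nf Ni) (hc : c.phase ≠ .finished) :
    ∃ c', I.RuleStep c c' := by
  have hph := hI.phaseInv
  have hω := h.valid.ω_pos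
  rcases hphase : c.phase with _ | ⟨δ0, j⟩ | ⟨δ0, j, d⟩ | ⟨δ0, j, s, δs, dm⟩ | ⟨s, δs⟩ | _
  · cases ha : c.avail
    · refine ⟨_, .evaluate c (exactTensors I.f c.x) hphase ha fun i hi => ?_, ?_⟩
      · rw [exactTensors, sub_self, norm_zero]
        exact h.acc_nonneg hI hi
      · intro _ _ _ _ _ hc'; cases hc'
    · exact ⟨_, .reuse c hphase ha, by intro _ _ _ _ _ hc'; cases hc'⟩
  · rw [hphase] at hph
    obtain ⟨hj, -⟩ := hph
    obtain ⟨d, hd⟩ := h.exists_displacement (h.radii_pos hI.radii hj).le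
    by_cases h1 : I.check1 c j d = .insufficient
    · exact ⟨_, .testImprove c δ0 j d hphase hd h1, by intro _ _ _ _ _ hc'; cases hc'⟩
    by_cases h2 : I.Small c j d
    · rcases (Finset.mem_Icc.1 hj).2.lt_or_eq with hjq | hjq
      · exact ⟨_, .testNext c δ0 j d hphase hd h1 h2 hjq, by intro _ _ _ _ _ hc'; cases hc'⟩
      · exact ⟨_, .testStop c δ0 j d hphase hd h1 h2 hjq, by intro _ _ _ _ _ hc'; cases hc'⟩
    by_cases h3 : I.Big c j d
    · exact ⟨_, .testSolve c δ0 j d hphase hd h1 h2 h3, by intro _ _ _ _ _ hc'; cases hc'⟩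
    · refine ⟨_, .testHalve c δ0 j d hphase hd h1 h2 h3, ?_⟩
      intro _ _ _ _ _ hc'
      change c.phase = _ at hc'
      rw [hphase] at hc'
      cases hc'
  · rw [hphase] at hph
    obtain ⟨hj, ha, hδ0, hth, -⟩ := hph
    obtain ⟨s, δs, dm, hs, hr⟩ := h.exists_step (hI.tensors ha)
      (fun i hi => h.acc_le_accMax hI hi) (h.σ_pos hI) hj (h.radii_pos hI.radii hj) hth δ0
    refine ⟨_, .solve c δ0 j d s δs dm hphase hs, ?_⟩
    intro _ _ _ _ _ hc'
    cases hc'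
    exact hr
  · by_cases h2 : I.Insufficient2 c j s δs dm
    · exact ⟨_, .verifyImprove c δ0 j s δs dm hphase h2, by intro _ _ _ _ _ hc'; cases hc'⟩
    · exact ⟨_, .verifyAccept c δ0 j s δs dm hphase h2, by intro _ _ _ _ _ hc'; cases hc'⟩
  · rw [hphase] at hph
    obtain ⟨-, hs, -⟩ := hph
    have h0 : 0 ≤ I.P.ω * taylorDec c.D I.p s := mul_nonneg hω.le hs.pos.le
    have hv : I.Values c s (I.f c.x) (I.f (c.x + s)) 2 :=
      ⟨by simpa using h0, by simpa using h0, Or.inl rfl⟩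
    obtain ⟨σ', hσ'⟩ := h.valid.exists_sigmaUpdate (I.rho c s (I.f c.x) (I.f (c.x + s))) hI.σ_ge
    rcases le_or_gt I.P.η₁ (I.rho c s (I.f c.x) (I.f (c.x + s))) with hρ | hρ
    · exact ⟨_, .success c s δs _ _ σ' 2 hphase hv hρ hσ', by intro _ _ _ _ _ hc'; cases hc'⟩
    · exact ⟨_, .failure c s δs _ _ σ' 2 hphase hv hρ hσ', by intro _ _ _ _ _ hc'; cases hc'⟩
  · exact absurd hphase hc

lemma exists_inv_of_reachable (hπ : Exponents I.p I.q π)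
    (hc : Relation.ReflTransGen I.RuleStep I.init c) : ∃ Ns Nf Ni, I.Inv π c Ns Nf Ni := by
  induction hc with
  | refl => exact ⟨0, 0, 0, h.inv_init π⟩
  | tail _ hst ih =>
    obtain ⟨Ns, Nf, Ni, hI⟩ := ih
    obtain ⟨Ns', Nf', Ni', hI', -⟩ := h.inv_step hπ hI hst
    exact ⟨Ns', Nf', Ni', hI'⟩

/-- If the number of iterations is bounded, then the algorithm cannot be continued forever: the
number of iterations left, the rank of the phase, and the number of halvings left decrease
lexicographically. -/
lemma not_exists_infinite_run (hπ : Exponents I.p I.q π) {B : ℕ}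
    (hB : ∀ c Ns Nf Ni, I.Inv π c Ns Nf Ni → Ns + Nf + Ni ≤ B) :
    ¬ ∃ run : ℕ → Config n, run 0 = I.init ∧ ∀ t, I.RuleStep (run t) (run (t + 1)) := by
  have key : ∀ (a b e : ℕ) (run : ℕ → Config n) (Ns Nf Ni : ℕ), I.Inv π (run 0) Ns Nf Ni →
      B - (Ns + Nf + Ni) = a → (run 0).phase.rank I.q = b → I.halvings (run 0) = e →
      ¬ ∀ t, I.RuleStep (run t) (run (t + 1)) := by
    intro a
    induction a using Nat.strong_induction_on with | _ a iha
    intro b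
    induction b using Nat.strong_induction_on with | _ b ihb
    intro e
    induction e using Nat.strong_induction_on with | _ e ihe
    intro run Ns Nf Ni hI ha hb he hrun
    have hrun' : ∀ t, I.RuleStep (run (t + 1)) (run (t + 1 + 1)) := fun t => hrun (t + 1)
    obtain ⟨Ns', Nf', Ni', hI', hlt⟩ := h.inv_step hπ hI (hrun 0)
    have hB' := hB _ _ _ _ hI'
    rcases hlt with hlt | ⟨hN, hlt | ⟨hr, hlt⟩⟩
    · exact iha (B - (Ns' + Nf' + Ni')) (by omega) _ _ (fun t => run (t + 1)) Ns' Nf' Ni' hI'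
        rfl rfl rfl hrun'
    · exact ihb _ (hb ▸ hlt) _ (fun t => run (t + 1)) Ns' Nf' Ni' hI' (by omega) rfl rfl hrun'
    · exact ihe _ (he ▸ hlt) (fun t => run (t + 1)) Ns' Nf' Ni' hI' (by omega) (hr.trans hb) rfl
        hrun'
  rintro ⟨run, h0, hrun⟩
  exact key _ _ _ run 0 0 0 (h0 ▸ h.inv_init π) rfl rfl rfl hrun

end Input.Good
end ARqpEDA2
end

noncomputable section
namespace ARqpEDA2

/-! ### Evaluation counts -/

variable {n : ℕ} {I : Input n} {flow : ℝ} {c : Config n} {π : ℕ → ℝ} {Ns Nf Ni : ℕ}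

namespace Input.Good

variable (h : I.Good flow)
include h

/-- All successful iterations except possibly the last one are paid for. -/
lemma successful_le (hI : I.Inv π c Ns Nf Ni) :
    (Ns : ℝ) ≤ 1 / decreaseConst I.P I.p I.L * ((I.f I.x₀ - flow) / minPow I.q I.ε π) + 1 := by
  have h1 := hI.decrease
  have h2 := h.assumptions.bounded_below c.x
  have hu := h.unit_pos π
  have h3 : 1 / decreaseConst I.P I.p I.L * ((I.f I.x₀ - flow) / minPow I.q I.ε π) + 1 =
      (I.f I.x₀ - flow + I.unit π) / I.unit π := by
    rw [add_div, div_self hu.ne', Input.unit, one_div_mul_eq_div, div_div, mul_comm]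
  rw [h3, le_div_iff₀ hu]
  linarith

/-- Each unsuccessful iteration multiplies the bounded parameter `σ` by at least `γ₂`, and only
successful iterations reduce it. -/
lemma unsuccessful_le (hI : I.Inv π c Ns Nf Ni) :
    (Nf : ℝ) ≤ Real.log (sigmaMax I.P I.p I.L / I.P.σ₀) / Real.log I.P.γ₂ +
      -Real.log I.P.γ₁ / Real.log I.P.γ₂ * Ns := by
  have hσ₀ := h.valid.σmin_pos.trans_le h.valid.σmin_le
  have hγ₁ := h.valid.γ₁_pos
  have hγ₂ := h.valid.γ₂_gt
  have hlog : 0 < Real.log I.P.γ₂ := Real.log_pos hγ₂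
  have h1 : I.P.γ₁ ^ Ns * I.P.γ₂ ^ Nf ≤ sigmaMax I.P I.p I.L / I.P.σ₀ := by
    rw [le_div_iff₀ hσ₀, mul_comm]
    exact hI.σ_count.trans hI.σ_le
  have hγ₂0 : 0 < I.P.γ₂ := by linarith
  have h2 := Real.log_le_log (by positivity) h1
  rw [Real.log_mul (by positivity) (by positivity), Real.log_pow, Real.log_pow] at h2
  rw [div_mul_eq_mul_div, ← add_div, le_div_iff₀ hlog]
  linarith

/-- Error bounds that are still to be improved are above a multiple of `epsMin ^ (p + 1)`, and each
improvement contracts them by the factor `γacc`. -/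
lemma improvements_le (hI : I.Inv π c Ns Nf Ni) :
    (Ni : ℝ) ≤ (I.p + 1) / -Real.log I.P.γacc * |Real.log I.epsMin| +
      (|Real.log ((I.P.accMax + 1) / accConst I.P I.p I.L)| / -Real.log I.P.γacc + 1) := by
  have hγ := h.valid.γacc_pos
  have hlog : 0 < -Real.log I.P.γacc := by
    have := Real.log_neg hγ h.valid.γacc_lt; linarith
  rcases eq_or_ne Ni 0 with rfl | hN
  · rw [Nat.cast_zero]; positivity
  have hA := h.accConst_pos
  have he := h.epsMin_pos
  have hmax := h.valid.accMax_nonneg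
  have h1 : accConst I.P I.p I.L * I.epsMin ^ (I.p + 1) ≤
      I.P.γacc ^ (Ni - 1) * (I.P.accMax + 1) :=
    (hI.improved hN).trans (mul_le_mul_of_nonneg_left (by linarith) (by positivity))
  have h2 := Real.log_le_log (by positivity) h1
  rw [Real.log_mul (by positivity) (by positivity), Real.log_mul (by positivity) (by positivity),
    Real.log_pow, Real.log_pow, Nat.cast_sub (by omega)] at h2
  have h3 := le_abs_self (Real.log ((I.P.accMax + 1) / accConst I.P I.p I.L))
  rw [Real.log_div (by positivity) (by positivity)] at h3
  rw [Real.log_div (by positivity) (by positivity)]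
  have h4 : ((I.p : ℝ) + 1) * -Real.log I.epsMin ≤ (I.p + 1) * |Real.log I.epsMin| :=
    mul_le_mul_of_nonneg_left (neg_le_abs _) (by positivity)
  rw [div_mul_eq_mul_div, ← add_assoc, ← add_div, ← sub_le_iff_le_add, le_div_iff₀ hlog]
  push_cast at h2
  linarith

end Input.Good

/-- The complexity bounds, with approximate optimality for the final radii. -/
theorem exists_complexity_constants {p q : ℕ} (hq : 1 ≤ q) (hqp : q ≤ p) {P : Params}
    (hP : P.Valid) {L : ℕ → ℝ} (hL : ∀ j ≤ p, 1 ≤ L j) {π : ℕ → ℝ} (hπ : Exponents p q π) :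
    ∃ κs κa κc κe κf : ℝ, 0 < κs ∧ 0 < κa ∧ 0 < κc ∧ 0 < κe ∧ 0 < κf ∧
      ∀ (n : ℕ) (I : Input n) (flow : ℝ),
        I.p = p → I.q = q → I.P = P → I.L = L → I.Assumptions flow →
        I.ProducesWithin (boundF q π κa κc (I.f I.x₀ - flow) I.ε)
          (boundD q π κs κe κf (I.f I.x₀ - flow) I.ε)
          (fun c => ∀ j ∈ Finset.Icc 1 q, 0 < c.δ j ∧ c.δ j ≤ 1 ∧
            phi I.f j (c.δ j) c.x ≤ I.ε j * (c.δ j) ^ j / (j ! : ℝ)) := by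
  set a := decreaseConst P p L with ha
  set C₁ := Real.log (sigmaMax P p L / P.σ₀) / Real.log P.γ₂ with hC₁
  set C₂ := -Real.log P.γ₁ / Real.log P.γ₂ with hC₂
  set K := |Real.log ((P.accMax + 1) / accConst P p L)| / -Real.log P.γacc with hK
  have hσ₀ : 0 < P.σ₀ := hP.σmin_pos.trans_le hP.σmin_le
  have hlog₂ : 0 < Real.log P.γ₂ := Real.log_pos hP.γ₂_gt
  have hlogacc : 0 < -Real.log P.γacc := by
    have := Real.log_neg hP.γacc_pos hP.γacc_lt; linarith
  have hC₁0 : 0 ≤ C₁ := by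
    refine div_nonneg (Real.log_nonneg ?_) hlog₂.le
    rw [one_le_div hσ₀]
    exact le_max_left _ _
  have hC₂0 : 0 ≤ C₂ := by
    have := Real.log_neg hP.γ₁_pos hP.γ₁_lt
    exact div_nonneg (by linarith) hlog₂.le
  have hK0 : 0 ≤ K := div_nonneg (abs_nonneg _) hlogacc.le
  -- the constant of the decrease is positive because inputs satisfying all hypotheses exist
  have ha0 : 0 < a := by
    let I : Input 0 := ⟨p, q, P, fun _ => 0, 0, fun _ => 1, fun _ => 1, fun _ => 0, L⟩
    have hI : I.Good 0 := ⟨hq, hqp, hP, hL, contDiff_const, fun j hj x y => by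
      have : (0 : ℝ) ≤ L j := zero_le_one.trans (hL j hj)
      rw [Subsingleton.elim x y, sub_self, norm_zero]
      positivity, fun _ => le_rfl, fun _ _ => ⟨one_pos, le_rfl⟩, fun _ _ => ⟨le_rfl, le_rfl⟩,
      fun _ _ => ⟨le_rfl, hP.accMax_nonneg⟩⟩
    exact hI.decreaseConst_pos
  refine ⟨1 / a, 2 * (1 + C₂) / a, 2 * C₁ + 2 * (1 + C₂), (p + 1) / -Real.log P.γacc, K + 3,
    by positivity, by positivity, by positivity, by positivity, by positivity, ?_⟩
  rintro n I flow rfl rfl rfl rfl hA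
  have h : I.Good flow := ⟨hq, hqp, hP, hL, hA⟩
  set X := (I.f I.x₀ - flow) / minPow I.q I.ε π with hX
  have hNs : ∀ {c Ns Nf Ni}, I.Inv π c Ns Nf Ni → (Ns : ℝ) ≤ 1 / a * X + 1 := h.successful_le
  have hNf : ∀ {c Ns Nf Ni}, I.Inv π c Ns Nf Ni → (Nf : ℝ) ≤ C₁ + C₂ * (1 / a * X + 1) :=
    fun hI => (h.unsuccessful_le hI).trans
      (add_le_add_right (mul_le_mul_of_nonneg_left (hNs hI) hC₂0) _)
  have hNi : ∀ {c Ns Nf Ni}, I.Inv π c Ns Nf Ni →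
      (Ni : ℝ) ≤ (I.p + 1) / -Real.log I.P.γacc * |Real.log I.epsMin| + (K + 1) :=
    h.improvements_le
  constructor
  · intro c hc
    obtain ⟨Ns, Nf, Ni, hI⟩ := h.exists_inv_of_reachable hπ hc
    have h1 : (c.nf : ℝ) ≤ 2 * (Ns + Nf) := by exact_mod_cast hI.nf_le
    have h2 := hNs hI
    have h3 := hNf hI
    calc (c.nf : ℝ) ≤ 2 * ((1 / a * X + 1) + (C₁ + C₂ * (1 / a * X + 1))) := by linarith
      _ = _ := by rw [boundF]; ring
  · intro c hc
    obtain ⟨Ns, Nf, Ni, hI⟩ := h.exists_inv_of_reachable hπ hc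
    have h1 : (c.nd : ℝ) ≤ Ns + Ni + 1 := by
      exact_mod_cast (Nat.le_add_right _ _).trans hI.nd_le
    have h2 := hNs hI
    have h3 := hNi hI
    rw [boundD]
    change _ ≤ 1 / a * X + (I.p + 1) / -Real.log I.P.γacc * |Real.log I.epsMin| + (K + 3)
    linarith
  · intro c hc hne
    obtain ⟨Ns, Nf, Ni, hI⟩ := h.exists_inv_of_reachable hπ hc
    exact h.exists_ruleStep hI hne
  · refine h.not_exists_infinite_run hπ (B := ⌊(1 / a * X + 1) + (C₁ + C₂ * (1 / a * X + 1)) +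
      ((I.p + 1) / -Real.log I.P.γacc * |Real.log I.epsMin| + (K + 1))⌋₊) fun c Ns Nf Ni hI => ?_
    refine Nat.le_floor ?_
    push_cast
    linarith [hNs hI, hNf hI, hNi hI]
  · intro c hc hfin j hj
    obtain ⟨Ns, Nf, Ni, hI⟩ := h.exists_inv_of_reachable hπ hc
    have hph := hI.phaseInv
    rw [hfin] at hph
    exact ⟨h.radii_pos hI.radii hj, (hI.radii j hj).2, hph j hj⟩

/-- For orders one and two, approximate optimality for some radius implies approximate optimality
for the radius one: it is enough to scale the displacement, after changing its sign if it is an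
ascent direction. -/
lemma phi_one_le {g : Vec n → ℝ} {x : Vec n} {j : ℕ} (hj1 : 1 ≤ j) (hj2 : j ≤ 2) {δ ε : ℝ}
    (hδ : 0 < δ) (hδ1 : δ ≤ 1) (hphi : phi g j δ x ≤ ε * δ ^ j / (j ! : ℝ)) :
    phi g j 1 x ≤ ε / (j ! : ℝ) := by
  refine optMeasure_le zero_le_one fun d hd => ?_
  have hD : ∀ (i : ℕ) (t : ℝ), exactTensors g x i (fun _ => t • d) =
      t ^ i * exactTensors g x i (fun _ => d) := fun i t => by
    have := (exactTensors g x i).map_smul_univ (fun _ => t) (fun _ => d)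
    simpa using this
  have key : ∀ t : ℝ, |t| ≤ δ → taylorDec (exactTensors g x) j (t • d) ≤
      ε * δ ^ j / (j ! : ℝ) := fun t ht => by
    refine (taylorDec_le_optMeasure _ j ?_).trans hphi
    rw [norm_smul, Real.norm_eq_abs]
    exact (mul_le_of_le_one_right (abs_nonneg _) hd).trans ht
  have k1 := key δ (abs_of_pos hδ).le
  have k2 := key (-δ) (by rw [abs_neg, abs_of_pos hδ])
  refine le_of_mul_le_mul_left (a := δ ^ j) ?_ (by positivity)
  have e : δ ^ j * (ε / (j ! : ℝ)) = ε * δ ^ j / (j ! : ℝ) := by ring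
  rw [e]
  have e2 : Finset.Icc 1 2 = {1, 2} := rfl
  obtain rfl | rfl : j = 1 ∨ j = 2 := by omega
  · refine le_trans (le_of_eq ?_) k1
    simp only [taylorDec, Finset.Icc_self, Finset.sum_singleton, hD]
    ring
  · simp only [taylorDec, e2, Finset.sum_insert (show (1 : ℕ) ∉ ({2} : Finset ℕ) by simp),
      Finset.sum_singleton, hD] at k1 k2 ⊢
    simp only [Nat.factorial_one, Nat.cast_one, div_one, pow_one] at k1 k2 ⊢
    have h1 : δ ^ 2 ≤ δ := by nlinarith
    rcases le_total (exactTensors g x 1 fun _ => d) 0 with h0 | h0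
    · refine le_trans ?_ k1
      nlinarith
    · refine le_trans ?_ k2
      have h2 : 0 ≤ δ ^ 2 * (exactTensors g x 1 fun _ => d) := by positivity
      have h3 : 0 ≤ δ * (exactTensors g x 1 fun _ => d) := by positivity
      linarith

/-- The bounds are of the order `max_j ε_j ^ (-π_j)`. -/
lemma exists_bound_le_maxPow {q : ℕ} (hq : 1 ≤ q) {π : ℕ → ℝ} (hπ : ∀ l ∈ Finset.Icc 1 q, 1 ≤ π l)
    {κs κa κc κe κf : ℝ} (hκs : 0 < κs) (hκa : 0 < κa) (hκc : 0 < κc) (hκe : 0 < κe)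
    (hκf : 0 < κf) {gap : ℝ} (hgap : 0 ≤ gap) :
    ∃ C : ℝ, 0 < C ∧ ∀ ε : ℕ → ℝ, (∀ j ∈ Finset.Icc 1 q, 0 < ε j ∧ ε j ≤ 1) →
      boundF q π κa κc gap ε ≤ C * maxPow q ε π ∧ boundD q π κs κe κf gap ε ≤ C * maxPow q ε π := by
  refine ⟨κa * gap + κc + (κs * gap + κe + κf), by positivity, fun ε hε => ?_⟩
  have hle : ∀ j ∈ Finset.Icc 1 q, ε j ^ (-π j) ≤ maxPow q ε π := fun j hj =>
    le_csSup (finite_image_Icc _ q).bddAbove ⟨j, Finset.mem_Icc.1 hj, rfl⟩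
  set M := maxPow q ε π
  have h1q : 1 ∈ Finset.Icc 1 q := Finset.mem_Icc.2 ⟨le_rfl, hq⟩
  have hM1 : 1 ≤ M := by
    refine le_trans ?_ (hle 1 h1q)
    exact Real.one_le_rpow_of_pos_of_le_one_of_nonpos (hε 1 h1q).1 (hε 1 h1q).2
      (by linarith [hπ 1 h1q])
  have hgapM : gap / minPow q ε π ≤ gap * M := by
    obtain ⟨j, hj, hj'⟩ := exists_minPow_eq hq ε π
    rw [hj', div_eq_mul_inv, ← Real.rpow_neg (hε j hj).1.le]
    exact mul_le_mul_of_nonneg_left (hle j hj) hgap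
  have hlog : |Real.log (sInf (ε '' Set.Icc 1 q))| ≤ M := by
    have hne : (ε '' Set.Icc 1 q).Nonempty := ⟨_, 1, ⟨le_rfl, hq⟩, rfl⟩
    obtain ⟨l, hl, hl'⟩ := hne.csInf_mem (finite_image_Icc _ q)
    have hl2 := Finset.mem_Icc.2 hl
    obtain ⟨h0, h1⟩ := hε l hl2
    rw [← hl', abs_of_nonpos (Real.log_nonpos h0.le h1), ← Real.log_inv]
    have h2 := Real.log_le_sub_one_of_pos (inv_pos.2 h0)
    have h3 : (ε l)⁻¹ ≤ ε l ^ (-π l) := by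
      rw [← Real.rpow_neg_one]
      exact Real.rpow_le_rpow_of_exponent_ge h0 h1 (by linarith [hπ l hl2])
    linarith [hle l hl2]
  have e1 := mul_le_mul_of_nonneg_left hgapM hκa.le
  have e2 := mul_le_mul_of_nonneg_left hgapM hκs.le
  have e3 := mul_le_mul_of_nonneg_left hlog hκe.le
  have e4 := mul_le_mul_of_nonneg_left hM1 hκc.le
  have e5 := mul_le_mul_of_nonneg_left hM1 hκf.le
  have hM0 : 0 ≤ M := by linarith
  have e6 : 0 ≤ κs * (gap * M) := by positivity
  have e7 : 0 ≤ κa * (gap * M) := by positivity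
  have e8 : 0 ≤ κe * M := by positivity
  rw [boundF, boundD]
  constructor <;> nlinarith

lemma exponents_of_le_two {p q : ℕ} (hq2 : q ≤ 2) :
    Exponents p q (fun j => ((p : ℝ) + 1) / ((p : ℝ) - j + 1)) where
  le_of_one_le _ _ := le_rfl
  le_of_three_le l hl := by have := Finset.mem_Icc.1 hl; omega

/-- For `1 ≤ l ≤ p` one has `(l - 1) (p - l) ≥ 0`, that is, `p ≤ l (p - l + 1)`. -/
lemma exponents_general {p q : ℕ} (hqp : q ≤ p) :
    Exponents p q (fun j => (j : ℝ) * ((p : ℝ) + 1) / (p : ℝ)) where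
  le_of_one_le l hl := by
    obtain ⟨h1, h2⟩ := Finset.mem_Icc.1 hl
    have h1' : (1 : ℝ) ≤ l := by exact_mod_cast h1
    have h2' : (l : ℝ) ≤ p := by exact_mod_cast h2.trans hqp
    rw [div_le_div_iff₀ (by linarith) (by linarith)]
    have : 0 ≤ ((l : ℝ) - 1) * (p - l) := mul_nonneg (by linarith) (by linarith)
    have : 0 ≤ ((p : ℝ) + 1) * (((l : ℝ) - 1) * (p - l)) := mul_nonneg (by linarith) this
    nlinarith
  le_of_three_le _ _ := le_rfl

end ARqpEDA2
end

theorem mainTheorem1 (p q : ℕ) (hq : 1 ≤ q) (hqp : q ≤ p) (P : ARqpEDA2.Params) (hP : P.Valid)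
    (L : ℕ → ℝ) (hL : ∀ j ≤ p, 1 ≤ L j) :
    (q ≤ 2 →
      ∃ κs κa κc κe κf : ℝ, 0 < κs ∧ 0 < κa ∧ 0 < κc ∧ 0 < κe ∧ 0 < κf ∧
        (∀ (n : ℕ) (I : ARqpEDA2.Input n) (flow : ℝ),
          I.p = p → I.q = q → I.P = P → I.L = L → I.Assumptions flow →
          I.ProducesWithin
            (ARqpEDA2.boundF q (fun j => ((p : ℝ) + 1) / ((p : ℝ) - j + 1)) κa κc
              (I.f I.x₀ - flow) I.ε)
            (ARqpEDA2.boundD q (fun j => ((p : ℝ) + 1) / ((p : ℝ) - j + 1)) κs κe κf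
              (I.f I.x₀ - flow) I.ε)
            (fun c => ∀ j ∈ Finset.Icc 1 q,
              ARqpEDA2.phi I.f j 1 c.x ≤ I.ε j / (j.factorial : ℝ))) ∧
        (∀ gap : ℝ, 0 ≤ gap → ∃ C : ℝ, 0 < C ∧ ∀ ε : ℕ → ℝ,
          (∀ j ∈ Finset.Icc 1 q, 0 < ε j ∧ ε j ≤ 1) →
          ARqpEDA2.boundF q (fun j => ((p : ℝ) + 1) / ((p : ℝ) - j + 1)) κa κc gap ε ≤
              C * ARqpEDA2.maxPow q ε (fun j => ((p : ℝ) + 1) / ((p : ℝ) - j + 1)) ∧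
          ARqpEDA2.boundD q (fun j => ((p : ℝ) + 1) / ((p : ℝ) - j + 1)) κs κe κf gap ε ≤
              C * ARqpEDA2.maxPow q ε (fun j => ((p : ℝ) + 1) / ((p : ℝ) - j + 1)))) ∧
    (2 < q →
      ∃ κs κa κc κe κf : ℝ, 0 < κs ∧ 0 < κa ∧ 0 < κc ∧ 0 < κe ∧ 0 < κf ∧
        (∀ (n : ℕ) (I : ARqpEDA2.Input n) (flow : ℝ),
          I.p = p → I.q = q → I.P = P → I.L = L → I.Assumptions flow →
          I.ProducesWithin
            (ARqpEDA2.boundF q (fun j => (j : ℝ) * ((p : ℝ) + 1) / (p : ℝ)) κa κc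
              (I.f I.x₀ - flow) I.ε)
            (ARqpEDA2.boundD q (fun j => (j : ℝ) * ((p : ℝ) + 1) / (p : ℝ)) κs κe κf
              (I.f I.x₀ - flow) I.ε)
            (fun c => ∀ j ∈ Finset.Icc 1 q, 0 < c.δ j ∧ c.δ j ≤ 1 ∧
              ARqpEDA2.phi I.f j (c.δ j) c.x ≤ I.ε j * (c.δ j) ^ j / (j.factorial : ℝ))) ∧
        (∀ gap : ℝ, 0 ≤ gap → ∃ C : ℝ, 0 < C ∧ ∀ ε : ℕ → ℝ,
          (∀ j ∈ Finset.Icc 1 q, 0 < ε j ∧ ε j ≤ 1) →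
          ARqpEDA2.boundF q (fun j => (j : ℝ) * ((p : ℝ) + 1) / (p : ℝ)) κa κc gap ε ≤
              C * ARqpEDA2.maxPow q ε (fun j => (j : ℝ) * ((p : ℝ) + 1) / (p : ℝ)) ∧
          ARqpEDA2.boundD q (fun j => (j : ℝ) * ((p : ℝ) + 1) / (p : ℝ)) κs κe κf gap ε ≤
              C * ARqpEDA2.maxPow q ε (fun j => (j : ℝ) * ((p : ℝ) + 1) / (p : ℝ)))) := by
  refine ⟨fun hq2 => ?_, fun _ => ?_⟩
  · have hπ := ARqpEDA2.exponents_of_le_two (p := p) hq2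
    obtain ⟨κs, κa, κc, κe, κf, hs, ha, hc, he, hf, h⟩ :=
      ARqpEDA2.exists_complexity_constants hq hqp hP hL hπ
    refine ⟨κs, κa, κc, κe, κf, hs, ha, hc, he, hf, fun n I flow h1 h2 h3 h4 hA => ?_,
      fun gap hgap => ARqpEDA2.exists_bound_le_maxPow hq (fun l hl => hπ.one_le hqp hl) hs ha hc he
        hf hgap⟩
    have hI := h n I flow h1 h2 h3 h4 hA
    refine ⟨hI.count_f, hI.count_d, hI.progress, hI.finite, fun c hc hfin j hj => ?_⟩
    obtain ⟨hδ, hδ1, hphi⟩ := hI.final c hc hfin j hj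
    obtain ⟨hj1, hjq⟩ := Finset.mem_Icc.1 hj
    exact ARqpEDA2.phi_one_le hj1 (hjq.trans hq2) hδ hδ1 hphi
  · have hπ := ARqpEDA2.exponents_general hqp
    obtain ⟨κs, κa, κc, κe, κf, hs, ha, hc, he, hf, h⟩ :=
      ARqpEDA2.exists_complexity_constants hq hqp hP hL hπ
    exact ⟨κs, κa, κc, κe, κf, hs, ha, hc, he, hf, h, fun gap hgap =>
      ARqpEDA2.exists_bound_le_maxPow hq (fun l hl => hπ.one_le hqp hl) hs ha hc he hf hgap⟩
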